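/- Let $1\le k\le p$, $\alpha>0$, $\beta>-\alpha/k$. Let $\mathrm{St}_{p,k}=\{U\in\mathbb{C}^{p\times k}: U^HU=I_k\}$, let $\mathcal{H}_k^{++}$ be the set of $k\times k$ Hermitian positive definite matrices, and equip $\overline{\mathcal{M}}_{p,k}=\mathrm{St}_{p,k}\times\mathcal{H}^{++}_k$ with the Riemannian metric $$\langle\bar\xi,\bar\eta\rangle_{(U,\Sigma)}=\mathrm{Re}\,\mathrm{tr}\big(\xi_U^H(I_p-\tfrac12UU^H)\eta_U\big)+\alpha\,\mathrm{tr}(\Sigma^{-1}\xi_\Sigma\Sigma^{-1}\eta_\Sigma)+\beta\,\mathrm{tr}(\Sigma^{-1}\xi_\Sigma)\,\mathrm{tr}(\Sigma^{-1}\eta_\Sigma),$$ the sum of the canonical metric of $\mathrm{St}_{p,k}$ and of an affine-invariant metric of $\mathcal{H}_k^{++}$. Let $\mathcal{M}_{p,k}$ be the quotient manifold of $\overline{\mathcal{M}}_{p,k}$ by the action $(U,\Sigma)\mapsto(UO,O^H\Sigma O)$ of the unitary group $\mathcal{U}_k$, with projection $\pi$ and the induced Riemannian metric (the one for which $\pi$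 is a Riemannian submersion). The horizontal space $\mathcal{H}_{(U,\Sigma)}$ is the orthogonal complement, in the tangent space of $\overline{\mathcal{M}}_{p,k}$ at $(U,\Sigma)$, of the vertical space $\{(U\Omega,\Sigma\Omega-\Omega\Sigma):\Omega^H=-\Omega\}$. Let $\bar\theta=(U,\Sigma)\in\overline{\mathcal{M}}_{p,k}$ and $\bar\xi=(\xi_U,\xi_\Sigma)\in\mathcal{H}_{\bar\theta}$. Let $Q\in\mathbb{C}^{p\times m}$ and $R\in\mathbb{C}^{m\times k}$ satisfy $Q^HQ=I_m$ and $QR=(I_p-UU^H)\xi_U$; for instance a QR decomposition ($m=k$), or $Q=U_\perp$, $R=U_\perp^H\xi_U$, where $U_\perp\in\mathrm{St}_{p,p-k}$ and $U^HU_\perp=0$. For $t\in\mathbb{R}$ let $\bar\gamma(t)=(U(t),\Sigma(t))$, where $$U(t)=[\,U\ \ Q\,]\exp\!\left(t\begin{pmatrix}U^H\xi_U&-R^H\\R&0\end{pmatrix}\right)\begin{bmatrix}I_k\\0\end{bmatrix},\qquad \Sigma(t)=\Sigma^{1/2}\exp\!\left(t\,\Sigma^{-1/2}\xi_\Sigma\Sigma^{-1/2}\right)\Sigma^{1/2}.$$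 Then: 1. $\pi\circ\bar\gamma$ is a geodesic of $\mathcal{M}_{p,k}$ on $\mathbb{R}$, starting at $\pi(\bar\theta)$ with velocity $\mathrm{D}\pi(\bar\theta)[\bar\xi]$, and $\bar\gamma$ is a horizontal lift of it to $\overline{\mathcal{M}}_{p,k}$, with $\bar\gamma(0)=\bar\theta$ and $\dot{\bar\gamma}(0)=\bar\xi$. 2. Every geodesic $c$ of $\mathcal{M}_{p,k}$ on an open interval $J\ni0$ that starts at $\pi(\bar\theta)$ with velocity $\mathrm{D}\pi(\bar\theta)[\bar\xi]$ equals $\pi\circ\bar\gamma$ on $J$, and every horizontal lift of $c$ on $J$ starting at $\bar\theta$ equals $\bar\gamma$ on $J$. 3. $U(t)$ is a geodesic of $\mathrm{St}_{p,k}$ with the canonical metric, and $\Sigma(t)$ is a geodesic of $\mathcal{H}^{++}_k$ with the affine-invariant metric. -/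

import Mathlib

open Matrix Topology Set
open scoped ContDiff ComplexOrder MatrixOrder

attribute [local instance] Matrix.linftyOpNormedAddCommGroup Matrix.linftyOpNormedSpace

/-- A submersion `proj` from a submanifold `total` of a normed space `E` onto a quotient manifold
(a subset of `X`): the embedded manifold, the projection, the tangent spaces of `total`, the
vertical spaces (the tangent spaces of the fibres) and the Riemannian metric of `total`.
It is only used through the concrete instances below. For `proj = id` and zero vertical spaces
the quotient is `total` itself. -/
structure Submersion (E X : Type*) where
  total : Set E
  proj : E → X
  tangent : E → Set E
  vertical : E → Set E
  metric : E → E → E → ℝ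

namespace Submersion

noncomputable section

variable {E X : Type*} [NormedAddCommGroup E] [NormedSpace ℝ E] (G : Submersion E X)

/-- The horizontal space: the orthogonal complement of the vertical space in the tangent space. -/
def horizontal (θ : E) : Set E :=
  {ξ | ξ ∈ G.tangent θ ∧ ∀ ζ ∈ G.vertical θ, G.metric θ ξ ζ = 0}

open Classical in
/-- The orthogonal projection of a tangent vector at `θ` onto the horizontal space, along the
vertical space. -/
def horizontalPart (θ ξ : E) : E :=
  if h : ∃ ζ ∈ G.horizontal θ, ξ - ζ ∈ G.vertical θ then h.choose else 0

/-- `proj ∘ σ` is a smooth local parametrization (the inverse of a chart) of the quotient manifold,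
given by a smooth local section `σ` on an open set `V`: the derivative of `proj ∘ σ` at each point
of `V`, a linear map into tangent space modulo vertical space, is bijective. -/
structure IsParametrization {d : ℕ} (σ : EuclideanSpace ℝ (Fin d) → E)
    (V : Set (EuclideanSpace ℝ (Fin d))) : Prop where
  isOpen : IsOpen V
  smooth : ContDiffOn ℝ ∞ σ V
  mapsTo : MapsTo σ V G.total
  injOn : InjOn (fun x => G.proj (σ x)) V
  bijective : ∀ x ∈ V, ∀ ξ ∈ G.tangent (σ x), ∃! v, ξ - fderiv ℝ σ x v ∈ G.vertical (σ x)

/-- The Riemannian metric of the quotient, in the coordinates given by `σ`: the inner product of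
the horizontal representatives of two tangent vectors of the quotient. -/
def coordMetric {d : ℕ} (σ : EuclideanSpace ℝ (Fin d) → E)
    (x v w : EuclideanSpace ℝ (Fin d)) : ℝ :=
  G.metric (σ x) (G.horizontalPart (σ x) (fderiv ℝ σ x v))
    (G.horizontalPart (σ x) (fderiv ℝ σ x w))

/-- The Christoffel symbols of the first kind of the Levi-Civita connection of the quotient, in
the coordinates given by `σ`: the inner product of `∇_u v` with `w` at `x`, for `u`, `v`, `w`
constant in the coordinates (Koszul formula). -/
def christoffel {d : ℕ} (σ : EuclideanSpace ℝ (Fin d) → E)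
    (x u v w : EuclideanSpace ℝ (Fin d)) : ℝ :=
  (1 / 2) * (fderiv ℝ (fun y => G.coordMetric σ y v w) x u
    + fderiv ℝ (fun y => G.coordMetric σ y u w) x v
    - fderiv ℝ (fun y => G.coordMetric σ y u v) x w)

/-- `c` is a geodesic of the quotient Riemannian manifold on the set `J` of times: it is smooth
(locally, it has smooth lifts to `total`), and its covariant acceleration `∇_{c'} c'` for the
Levi-Civita connection vanishes, in all local coordinates. -/
def IsGeodesicOn (c : ℝ → X) (J : Set ℝ) : Prop :=
  ∀ t ∈ J,
    (∃ γ : ℝ → E, ContDiffAt ℝ ∞ γ t ∧ ∀ᶠ s in 𝓝 t, γ s ∈ G.total ∧ G.proj (γ s) = c s) ∧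
    ∀ (d : ℕ) (σ : EuclideanSpace ℝ (Fin d) → E) (V : Set (EuclideanSpace ℝ (Fin d))),
      G.IsParametrization σ V →
      ∀ x : ℝ → EuclideanSpace ℝ (Fin d), ContDiffAt ℝ ∞ x t →
        (∀ᶠ s in 𝓝 t, x s ∈ V ∧ G.proj (σ (x s)) = c s) →
        ∀ w, G.coordMetric σ (x t) (deriv (deriv x) t) w
          + G.christoffel σ (x t) (deriv x t) (deriv x t) w = 0

/-- The curve `c` of the quotient is at `proj θ` at time `t`, with velocity `D proj(θ)[ξ]`. -/
def HasVelocityAt (c : ℝ → X) (θ ξ : E) (t : ℝ) : Prop :=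
  ∃ γ : ℝ → E, (∀ᶠ s in 𝓝 t, γ s ∈ G.total ∧ G.proj (γ s) = c s) ∧ γ t = θ ∧ HasDerivAt γ ξ t

/-- `γ` is a horizontal lift to `total` of the curve `c` of the quotient, on `J`. -/
def IsHorizontalLiftOn (γ : ℝ → E) (c : ℝ → X) (J : Set ℝ) : Prop :=
  ∀ t ∈ J, γ t ∈ G.total ∧ G.proj (γ t) = c t ∧ ContDiffAt ℝ ∞ γ t ∧
    deriv γ t ∈ G.horizontal (γ t)

end

end Submersion

noncomputable section

/-- The complex Stiefel manifold with its canonical metric. -/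
def stiefel (p k : ℕ) : Submersion (Matrix (Fin p) (Fin k) ℂ) (Matrix (Fin p) (Fin k) ℂ) where
  total := {U | Uᴴ * U = 1}
  proj := id
  tangent U := {ξ | Uᴴ * ξ + ξᴴ * U = 0}
  vertical _ := {0}
  metric U ξ η := (trace (ξᴴ * (1 - (1 / 2 : ℂ) • (U * Uᴴ)) * η)).re

/-- The manifold of Hermitian positive definite matrices with the affine invariant metric of
parameters `α` and `β`. (The traces are real on Hermitian arguments.) -/
def hpd (k : ℕ) (α β : ℝ) :
    Submersion (Matrix (Fin k) (Fin k) ℂ) (Matrix (Fin k) (Fin k) ℂ) where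
  total := {S | S.PosDef}
  proj := id
  tangent _ := {ξ | ξ.IsHermitian}
  vertical _ := {0}
  metric S ξ η := α * (trace (S⁻¹ * ξ * S⁻¹ * η)).re
    + β * ((trace (S⁻¹ * ξ)).re * (trace (S⁻¹ * η)).re)

/-- The equivalence class `{(U O, Oᴴ Σ O) : O unitary}` of the pair `(U, Σ)`. -/
def orbit (p k : ℕ) (θ : Matrix (Fin p) (Fin k) ℂ × Matrix (Fin k) (Fin k) ℂ) :
    Set (Matrix (Fin p) (Fin k) ℂ × Matrix (Fin k) (Fin k) ℂ) :=
  {θ' | ∃ O ∈ Matrix.unitaryGroup (Fin k) ℂ, θ' = (θ.1 * O, Oᴴ * θ.2 * O)}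

/-- The quotient of the product of the Stiefel manifold and of the Hermitian positive definite
matrices by the unitary group, with the Riemannian metric induced by the product metric. -/
def rankQuotient (p k : ℕ) (α β : ℝ) :
    Submersion (Matrix (Fin p) (Fin k) ℂ × Matrix (Fin k) (Fin k) ℂ)
      (Set (Matrix (Fin p) (Fin k) ℂ × Matrix (Fin k) (Fin k) ℂ)) where
  total := (stiefel p k).total ×ˢ (hpd k α β).total
  proj := orbit p k
  tangent θ := (stiefel p k).tangent θ.1 ×ˢ (hpd k α β).tangent θ.2
  vertical θ := {ζ | ∃ Ω : Matrix (Fin k) (Fin k) ℂ, Ωᴴ = -Ω ∧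
    ζ = (θ.1 * Ω, θ.2 * Ω - Ω * θ.2)}
  metric θ ξ η := (stiefel p k).metric θ.1 ξ.1 η.1 + (hpd k α β).metric θ.2 ξ.2 η.2

/-- `[U Q] exp(t [[Uᴴ ξ, -Rᴴ], [R, 0]]) [I; 0]`. -/
def stiefelCurve {p k m : ℕ} (U ξ : Matrix (Fin p) (Fin k) ℂ) (Q : Matrix (Fin p) (Fin m) ℂ)
    (R : Matrix (Fin m) (Fin k) ℂ) (t : ℝ) : Matrix (Fin p) (Fin k) ℂ :=
  fromCols U Q * NormedSpace.exp (t • fromBlocks (Uᴴ * ξ) (-Rᴴ) R 0) *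
    fromRows (1 : Matrix (Fin k) (Fin k) ℂ) (0 : Matrix (Fin m) (Fin k) ℂ)

/-- `Σ^{1/2} exp(t Σ^{-1/2} ξ Σ^{-1/2}) Σ^{1/2}`. -/
def hpdCurve {k : ℕ} (S ξ : Matrix (Fin k) (Fin k) ℂ) (t : ℝ) : Matrix (Fin k) (Fin k) ℂ :=
  CFC.sqrt S * NormedSpace.exp (t • ((CFC.sqrt S)⁻¹ * ξ * (CFC.sqrt S)⁻¹)) * CFC.sqrt S

/-- The product of the two curves. -/
def liftedCurve {p k m : ℕ} (θ ξ : Matrix (Fin p) (Fin k) ℂ × Matrix (Fin k) (Fin k) ℂ)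
    (Q : Matrix (Fin p) (Fin m) ℂ) (R : Matrix (Fin m) (Fin k) ℂ) (t : ℝ) :
    Matrix (Fin p) (Fin k) ℂ × Matrix (Fin k) (Fin k) ℂ :=
  (stiefelCurve θ.1 ξ.1 Q R t, hpdCurve θ.2 ξ.2 t)

end

/-!
The proof avoids connections on manifolds altogether. Two facts about Riemannian submersions
`G : Submersion E X` carry it, both for a quotient with `Submersion.RiemannianData`.

*Horizontal geodesics project to geodesics*
(`Submersion.RiemannianData.coordMetric_add_christoffel_eq_zero`). Let `x` be the coordinates of
the projection of a horizontal curve `γ` in a chart `σ`. Then `γ = ρ (σ x)` for a curve `ρ` of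
symmetries moving points along the fibres, and the geodesic equation of `x` is the Euler–Lagrange
equation of its energy. The velocity term of the latter is the derivative of the momentum of `γ`.
The position term is found by comparing the energy of a varied curve with that of its projection:
the projected energy is the smaller one (`metric_horizProj_le`), with equality at `γ` because `γ`
is horizontal, so that the two have the same first derivative (`fderiv_coordForm_energy`). Hence
the geodesic equation of `x` is the Euler–Lagrange equation of `γ` in `G.total`, tested against
tangent vectors.

*Geodesics are determined by their initial data* (`eqOn_of_isGeodesicOn`). In a chart the geodesic
equation is an ordinary differential equation with smooth coefficients, which gives local
uniqueness (`eventuallyEq_of_geodesic`); the set of times near which two geodesics agree is then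
open and closed, because the quotient is Hausdorff and position and velocity are continuous.

It remains to verify the hypotheses. The Stiefel curve satisfies
`U'' = U' A - U (A² + U'ᴴ U')` with constant `A = Uᴴ U'` (`stiefelCurve_spec`), and the other curve
satisfies `Σ'' = Σ' Σ⁻¹ Σ'` with constant `Σ⁻¹ Σ'` and `Σ' Σ⁻¹` (`hpdCurve_spec`). These are the
Euler–Lagrange equations of the two metrics (`stiefel_acceleration`, `hpd_acceleration`), and the
conserved quantities determine the inner products of the velocity with vertical vectors, so that
the product curve stays horizontal (`liftedCurve_horizontal`). Charts of the quotient come from the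
invariants `(U C⁻¹, C Σ Cᴴ)`, `C = U₀ᴴ U`, of the unitary action (`isSlice_rankQuotient`); the
local section needs a smooth matrix square root near the identity (`exists_smooth_sqrt`). Finally,
two horizontal lifts of a curve differ by unitary matrices that do not depend on time
(`deriv_gauge_eq_zero`).
-/

/-! ### Riemannian submersions and their horizontal projections -/

set_option linter.unusedSectionVars false
set_option maxSynthPendingDepth 3

namespace Submersion

noncomputable section

open ContinuousLinearMap

variable {E X K : Type*} [NormedAddCommGroup E] [NormedSpace ℝ E]
  [NormedAddCommGroup K] [NormedSpace ℝ K]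

/-- The regularity that makes a `Submersion` a Riemannian submersion from a submanifold of `E`.
The vertical space at `θ` is parametrized injectively by the fixed space `K` (the Lie algebra of
the group whose orbits are the fibres), linearly in `θ`. The metric is a symmetric bilinear form on
all of `E`, smooth near the submanifold, but positive definite on tangent vectors only. -/
structure RiemannianData (G : Submersion E X) (K : Type*) [NormedAddCommGroup K]
    [NormedSpace ℝ K] where
  vert : E →L[ℝ] K →L[ℝ] E
  vertical_eq : ∀ θ ∈ G.total, G.vertical θ = range (vert θ)
  vert_injective : ∀ θ ∈ G.total, Function.Injective (vert θ)
  vert_mem : ∀ θ ∈ G.total, ∀ κ, vert θ κ ∈ G.tangent θ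
  tangent_add : ∀ θ ∈ G.total, ∀ ξ ∈ G.tangent θ, ∀ η ∈ G.tangent θ, ξ + η ∈ G.tangent θ
  metric_add : ∀ θ ξ ξ' η, G.metric θ (ξ + ξ') η = G.metric θ ξ η + G.metric θ ξ' η
  metric_smul : ∀ θ (a : ℝ) ξ η, G.metric θ (a • ξ) η = a * G.metric θ ξ η
  metric_comm : ∀ θ ξ η, G.metric θ ξ η = G.metric θ η ξ
  metric_smooth : ∀ θ ∈ G.total, ∀ ξ η, ContDiffAt ℝ ∞ (fun θ => G.metric θ ξ η) θ
  metric_pos : ∀ θ ∈ G.total, ∀ ξ ∈ G.tangent θ, ξ ≠ 0 → 0 < G.metric θ ξ ξ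
  deriv_mem : ∀ (γ : ℝ → E) ξ t, HasDerivAt γ ξ t → (∀ᶠ s in 𝓝 t, γ s ∈ G.total) →
    ξ ∈ G.tangent (γ t)

/-- A map into operators on a finite-dimensional space is smooth if it is so at each vector. -/
lemma contDiffAt_clm_of_apply {D F F' : Type*} [NormedAddCommGroup D] [NormedSpace ℝ D]
    [NormedAddCommGroup F] [NormedSpace ℝ F] [NormedAddCommGroup F'] [NormedSpace ℝ F']
    [FiniteDimensional ℝ F] {n : ℕ∞ω} {f : D → F →L[ℝ] F'} {x : D}
    (h : ∀ v, ContDiffAt ℝ n (fun y => f y v) x) : ContDiffAt ℝ n f x := by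
  let d := Module.finrank ℝ F
  have hd : d = Module.finrank ℝ (Fin d → ℝ) := (Module.finrank_fin_fun ℝ).symm
  let e₁ := ContinuousLinearEquiv.ofFinrankEq hd
  let e₂ := (e₁.arrowCongr (1 : F' ≃L[ℝ] F')).trans (ContinuousLinearEquiv.piRing (Fin d))
  have h1 : ContDiffAt ℝ n (fun y => e₂ (f y)) x := contDiffAt_pi.mpr fun i => h _
  have h2 := e₂.symm.contDiff.contDiffAt.comp x h1
  have h3 : e₂.symm ∘ (fun y => e₂ (f y)) = f := funext fun y => e₂.symm_apply_apply (f y)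
  rwa [h3] at h2

/-- A positive definite bilinear form identifies a finite-dimensional space with its dual. -/
lemma exists_equiv_of_pos {F : Type*} [NormedAddCommGroup F] [NormedSpace ℝ F]
    [FiniteDimensional ℝ F] (B : F →L[ℝ] F →L[ℝ] ℝ) (hB : ∀ v, v ≠ 0 → 0 < B v v) :
    ∃ e : F ≃L[ℝ] (F →L[ℝ] ℝ), (e : F →L[ℝ] F →L[ℝ] ℝ) = B := by
  have hinj : Function.Injective B := by
    rw [injective_iff_map_eq_zero]
    intro v hv
    by_contra hne
    exact (hB v hne).ne' (by rw [hv]; rfl)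
  have hfr : Module.finrank ℝ F = Module.finrank ℝ (F →L[ℝ] ℝ) := by
    rw [← (LinearMap.toContinuousLinearMap (𝕜 := ℝ) (E := F) (F' := ℝ)).finrank_eq]
    exact (Subspace.dual_finrank_eq (K := ℝ) (V := F)).symm
  exact ⟨(LinearEquiv.ofInjectiveOfFinrankEq B.toLinearMap hinj
    hfr).toContinuousLinearEquiv, rfl⟩

namespace RiemannianData

variable {G : Submersion E X}

/-- The metric as a bilinear form. -/
def form (D : RiemannianData G K) [FiniteDimensional ℝ E] (θ : E) : E →L[ℝ] E →L[ℝ] ℝ :=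
  LinearMap.toContinuousLinearMap
    ((LinearMap.toContinuousLinearMap (𝕜 := ℝ) (E := E) (F' := ℝ)).toLinearMap ∘ₗ
      LinearMap.mk₂ ℝ (G.metric θ) (D.metric_add θ) (D.metric_smul θ)
      (fun ξ η η' => by
        rw [D.metric_comm, D.metric_add, D.metric_comm θ η, D.metric_comm θ η'])
      (fun a ξ η => by rw [D.metric_comm, D.metric_smul, D.metric_comm θ η, smul_eq_mul]))

variable [FiniteDimensional ℝ E] [FiniteDimensional ℝ K]

@[simp] lemma form_apply (D : RiemannianData G K) (θ ξ η : E) : D.form θ ξ η = G.metric θ ξ η := rfl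

lemma form_smooth (D : RiemannianData G K) {θ : E} (hθ : θ ∈ G.total) : ContDiffAt ℝ ∞ D.form θ :=
  contDiffAt_clm_of_apply fun ξ => contDiffAt_clm_of_apply fun η => D.metric_smooth θ hθ ξ η

/-- Precomposition with `L`, as an operator on linear functionals. -/
def pull {F F' : Type*} [NormedAddCommGroup F] [NormedSpace ℝ F] [NormedAddCommGroup F']
    [NormedSpace ℝ F'] (L : F →L[ℝ] F') : (F' →L[ℝ] ℝ) →L[ℝ] (F →L[ℝ] ℝ) :=
  (compL ℝ F F' ℝ).flip L

lemma pull_smooth {A F F' : Type*} [NormedAddCommGroup A] [NormedSpace ℝ A]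
    [NormedAddCommGroup F] [NormedSpace ℝ F] [NormedAddCommGroup F'] [NormedSpace ℝ F']
    [FiniteDimensional ℝ F'] {n : ℕ∞ω} {L : A → F →L[ℝ] F'} {a : A} (hL : ContDiffAt ℝ n L a) :
    ContDiffAt ℝ n (fun a => pull (L a)) a :=
  contDiffAt_clm_of_apply fun _ => contDiffAt_const.clm_comp hL

/-- The Gram form of the vertical space, as an operator from `K` to its dual. -/
def gram (D : RiemannianData G K) (θ : E) : K →L[ℝ] K →L[ℝ] ℝ :=
  (pull (D.vert θ)).comp ((D.form θ).comp (D.vert θ))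

@[simp] lemma gram_apply (D : RiemannianData G K) (θ : E) (κ κ' : K) :
    D.gram θ κ κ' = G.metric θ (D.vert θ κ) (D.vert θ κ') := rfl

/-- The orthogonal projection along the vertical space, given by the normal equations; unlike
`Submersion.horizontalPart` it is visibly smooth in the base point. -/
def horizProj (D : RiemannianData G K) (θ : E) : E →L[ℝ] E :=
  ContinuousLinearMap.id ℝ E -
    (D.vert θ).comp ((D.gram θ).inverse.comp ((pull (D.vert θ)).comp (D.form θ)))

lemma exists_gram_equiv (D : RiemannianData G K) {θ : E} (hθ : θ ∈ G.total) :
    ∃ e : K ≃L[ℝ] (K →L[ℝ] ℝ), (e : K →L[ℝ] K →L[ℝ] ℝ) = D.gram θ := by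
  refine exists_equiv_of_pos _ fun κ hκ => D.metric_pos θ hθ _ (D.vert_mem θ hθ κ) fun h => hκ ?_
  exact D.vert_injective θ hθ (h.trans (map_zero _).symm)

lemma horizProj_smooth (D : RiemannianData G K) {θ : E} (hθ : θ ∈ G.total) :
    ContDiffAt ℝ ∞ D.horizProj θ := by
  have hv : ContDiffAt ℝ ∞ D.vert θ := D.vert.contDiff.contDiffAt
  have hp : ContDiffAt ℝ ∞ (fun θ => pull (D.vert θ)) θ := pull_smooth hv
  have hf := D.form_smooth hθ
  have hg : ContDiffAt ℝ ∞ D.gram θ := hp.clm_comp (hf.clm_comp hv)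
  have hi : ContDiffAt ℝ ∞ (fun θ => (D.gram θ).inverse) θ := by
    obtain ⟨e, he⟩ := D.exists_gram_equiv hθ
    have := contDiffAt_map_inverse (n := ∞) e
    rw [he] at this
    exact this.comp θ hg
  exact contDiffAt_const.sub (hv.clm_comp (hi.clm_comp (hp.clm_comp hf)))

lemma sub_horizProj (D : RiemannianData G K) (θ ξ : E) : ∃ κ, ξ - D.horizProj θ ξ = D.vert θ κ :=
  ⟨_, sub_sub_cancel _ _⟩

lemma horizProj_orthogonal (D : RiemannianData G K) {θ : E} (hθ : θ ∈ G.total) (ξ : E) (κ : K) :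
    G.metric θ (D.horizProj θ ξ) (D.vert θ κ) = 0 := by
  obtain ⟨e, he⟩ := D.exists_gram_equiv hθ
  set f : K →L[ℝ] ℝ := pull (D.vert θ) (D.form θ ξ) with hf
  have h1 : D.horizProj θ ξ = ξ - D.vert θ ((D.gram θ).inverse f) := rfl
  have h2 : D.gram θ ((D.gram θ).inverse f) = f := by
    rw [← he, inverse_equiv]; simp
  rw [← D.form_apply, h1, map_sub, _root_.sub_apply, sub_eq_zero]
  have h3 := DFunLike.congr_fun h2 κ
  rw [gram_apply] at h3
  simpa [hf, pull] using h3.symm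

lemma vert_mem_vertical (D : RiemannianData G K) {θ : E} (hθ : θ ∈ G.total) (κ : K) :
    D.vert θ κ ∈ G.vertical θ := by
  rw [D.vertical_eq θ hθ]; exact ⟨κ, rfl⟩

lemma metric_add_right (D : RiemannianData G K) (θ ξ η η' : E) :
    G.metric θ ξ (η + η') = G.metric θ ξ η + G.metric θ ξ η' := by
  simp only [← D.form_apply, map_add]

lemma metric_sub_left (D : RiemannianData G K) (θ ξ ξ' η : E) :
    G.metric θ (ξ - ξ') η = G.metric θ ξ η - G.metric θ ξ' η := by
  simp only [← D.form_apply, map_sub, _root_.sub_apply]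

lemma horizProj_mem (D : RiemannianData G K) {θ ξ : E} (hθ : θ ∈ G.total) (hξ : ξ ∈ G.tangent θ) :
    D.horizProj θ ξ ∈ G.horizontal θ := by
  constructor
  · obtain ⟨κ, hκ⟩ := D.sub_horizProj θ ξ
    have : D.horizProj θ ξ = ξ + D.vert θ (-κ) := by rw [map_neg, ← hκ]; abel
    rw [this]
    exact D.tangent_add θ hθ _ hξ _ (D.vert_mem θ hθ _)
  · intro ζ hζ
    rw [D.vertical_eq θ hθ] at hζ
    obtain ⟨κ, rfl⟩ := hζ
    exact D.horizProj_orthogonal hθ ξ κ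

/-- Horizontal vectors that differ by a vertical one are equal. -/
lemma horizontal_ext (D : RiemannianData G K) {θ ξ η : E} (hθ : θ ∈ G.total)
    (hξ : ξ ∈ G.horizontal θ)
    (hη : η ∈ G.horizontal θ) (κ : K) (h : ξ - η = D.vert θ κ) : ξ = η := by
  by_contra hne
  have h1 := D.metric_pos θ hθ _ (D.vert_mem θ hθ κ) (h ▸ sub_ne_zero.mpr hne)
  have hv := D.vert_mem_vertical hθ κ
  nth_rewrite 1 [← h] at h1
  rw [D.metric_sub_left, hξ.2 _ hv, hη.2 _ hv, sub_self] at h1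
  exact lt_irrefl _ h1

lemma horizontalPart_eq (D : RiemannianData G K) {θ ξ η : E} (hθ : θ ∈ G.total)
    (hη : η ∈ G.horizontal θ)
    (κ : K) (h : ξ - η = D.vert θ κ) : G.horizontalPart θ ξ = η := by
  have hex : ∃ ζ ∈ G.horizontal θ, ξ - ζ ∈ G.vertical θ :=
    ⟨η, hη, h ▸ D.vert_mem_vertical hθ κ⟩
  have hs := hex.choose_spec
  rw [horizontalPart, dif_pos hex]
  generalize hex.choose = ζ at hs ⊢
  obtain ⟨κ', hκ'⟩ : ξ - ζ ∈ range (D.vert θ) := D.vertical_eq θ hθ ▸ hs.2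
  refine D.horizontal_ext hθ hs.1 hη (κ - κ') ?_
  rw [map_sub, ← h]
  exact (sub_eq_of_eq_add (by rw [hκ']; abel)).symm

lemma horizontalPart_eq_horizProj (D : RiemannianData G K) {θ ξ : E} (hθ : θ ∈ G.total)
    (hξ : ξ ∈ G.tangent θ) :
    G.horizontalPart θ ξ = D.horizProj θ ξ := by
  obtain ⟨κ, hκ⟩ := D.sub_horizProj θ ξ
  exact D.horizontalPart_eq hθ (D.horizProj_mem hθ hξ) κ hκ

/-- The length of a horizontal part is the least among all vertical translates. -/
lemma metric_horizProj_le (D : RiemannianData G K) {θ ξ : E} (hθ : θ ∈ G.total) (κ : K) :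
    G.metric θ (D.horizProj θ ξ) (D.horizProj θ ξ)
      ≤ G.metric θ (ξ + D.vert θ κ) (ξ + D.vert θ κ) := by
  obtain ⟨κ', hκ'⟩ := D.sub_horizProj θ ξ
  set η := D.horizProj θ ξ with hη
  have h1 : ξ + D.vert θ κ = η + D.vert θ (κ' + κ) := by rw [map_add, ← hκ']; abel
  have h2 : G.metric θ η (D.vert θ (κ' + κ)) = 0 := D.horizProj_orthogonal hθ ξ _
  have h3 : 0 ≤ G.metric θ (D.vert θ (κ' + κ)) (D.vert θ (κ' + κ)) := by
    by_cases h0 : D.vert θ (κ' + κ) = 0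
    · rw [h0, ← D.form_apply, map_zero]
    · exact (D.metric_pos θ hθ _ (D.vert_mem θ hθ _) h0).le
  rw [h1, D.metric_add, D.metric_add_right, D.metric_add_right,
    D.metric_comm θ (D.vert θ (κ' + κ)) η, h2]
  linarith

/-! ### The metric in local coordinates -/

section Coordinates

variable {d : ℕ} {σ : EuclideanSpace ℝ (Fin d) → E} {V : Set (EuclideanSpace ℝ (Fin d))}

lemma fderiv_mem_tangent (D : RiemannianData G K) (hσ : G.IsParametrization σ V)
    {x : EuclideanSpace ℝ (Fin d)}
    (hx : x ∈ V) (v : EuclideanSpace ℝ (Fin d)) : fderiv ℝ σ x v ∈ G.tangent (σ x) := by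
  have h1 : DifferentiableAt ℝ σ x :=
    (hσ.smooth.contDiffAt (hσ.isOpen.mem_nhds hx)).differentiableAt (by simp)
  have hl : HasDerivAt (fun τ : ℝ => x + τ • v) v 0 := by
    simpa using ((hasDerivAt_id (0 : ℝ)).smul_const v).const_add x
  have h2 : HasDerivAt (fun τ : ℝ => σ (x + τ • v)) (fderiv ℝ σ x v) 0 := by
    have h1' : HasFDerivAt σ (fderiv ℝ σ x) (x + (0 : ℝ) • v) := by simpa using h1.hasFDerivAt
    exact h1'.comp_hasDerivAt (0 : ℝ) hl
  have h3 := D.deriv_mem _ _ 0 h2 ?_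
  · simpa using h3
  · have : ∀ᶠ s in 𝓝 (0 : ℝ), x + s • v ∈ V :=
      hl.continuousAt.eventually_mem (by simpa using hσ.isOpen.mem_nhds hx)
    exact this.mono fun s hs => hσ.mapsTo hs

/-- The horizontal lift of a coordinate vector. -/
def coordLift (D : RiemannianData G K) (σ : EuclideanSpace ℝ (Fin d) → E)
    (x : EuclideanSpace ℝ (Fin d)) :
    EuclideanSpace ℝ (Fin d) →L[ℝ] E :=
  (D.horizProj (σ x)).comp (fderiv ℝ σ x)

/-- The metric of the quotient in coordinates, as a bilinear form. -/
def coordForm (D : RiemannianData G K) (σ : EuclideanSpace ℝ (Fin d) → E)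
    (x : EuclideanSpace ℝ (Fin d)) :
    EuclideanSpace ℝ (Fin d) →L[ℝ] EuclideanSpace ℝ (Fin d) →L[ℝ] ℝ :=
  (pull (D.coordLift σ x)).comp ((D.form (σ x)).comp (D.coordLift σ x))

lemma coordForm_apply (D : RiemannianData G K) (x v w : EuclideanSpace ℝ (Fin d)) :
    D.coordForm σ x v w = G.metric (σ x) (D.coordLift σ x v) (D.coordLift σ x w) := rfl

lemma coordForm_smooth (D : RiemannianData G K) (hσ : G.IsParametrization σ V)
    {x : EuclideanSpace ℝ (Fin d)}
    (hx : x ∈ V) : ContDiffAt ℝ ∞ (D.coordForm σ) x := by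
  have h1 := hσ.smooth.contDiffAt (hσ.isOpen.mem_nhds hx)
  have hl : ContDiffAt ℝ ∞ (D.coordLift σ) x :=
    ((D.horizProj_smooth (hσ.mapsTo hx)).comp x h1).clm_comp (h1.fderiv_right (by simp))
  exact (pull_smooth hl).clm_comp
    (((D.form_smooth (hσ.mapsTo hx)).comp x h1).clm_comp hl)

lemma coordMetric_eq (D : RiemannianData G K) (hσ : G.IsParametrization σ V)
    {x : EuclideanSpace ℝ (Fin d)}
    (hx : x ∈ V) (v w : EuclideanSpace ℝ (Fin d)) :
    G.coordMetric σ x v w = D.coordForm σ x v w := by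
  rw [coordMetric, D.horizontalPart_eq_horizProj (hσ.mapsTo hx) (D.fderiv_mem_tangent hσ hx v),
    D.horizontalPart_eq_horizProj (hσ.mapsTo hx) (D.fderiv_mem_tangent hσ hx w)]
  rfl

lemma coordLift_eq (D : RiemannianData G K) (hσ : G.IsParametrization σ V)
    {x : EuclideanSpace ℝ (Fin d)} (hx : x ∈ V) {v : EuclideanSpace ℝ (Fin d)} {η : E}
    (hη : η ∈ G.horizontal (σ x)) (κ : K) (h : η = fderiv ℝ σ x v + D.vert (σ x) κ) :
    D.coordLift σ x v = η := by
  have hx' := hσ.mapsTo hx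
  rw [coordLift, ContinuousLinearMap.comp_apply, ← D.horizontalPart_eq_horizProj hx'
    (D.fderiv_mem_tangent hσ hx v)]
  refine D.horizontalPart_eq hx' hη (-κ) ?_
  rw [h, map_neg]; abel

/-- In the metric of the quotient only one argument has to be projected. -/
lemma coordForm_eq_left (D : RiemannianData G K) (hσ : G.IsParametrization σ V)
    {x : EuclideanSpace ℝ (Fin d)} (hx : x ∈ V) (v w : EuclideanSpace ℝ (Fin d)) :
    D.coordForm σ x v w = G.metric (σ x) (D.coordLift σ x v) (fderiv ℝ σ x w) := by
  have hx' := hσ.mapsTo hx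
  obtain ⟨κ', hκ'⟩ := D.sub_horizProj (σ x) (fderiv ℝ σ x w)
  have h2 : fderiv ℝ σ x w = D.coordLift σ x w + D.vert (σ x) κ' := by
    rw [← hκ', coordLift, ContinuousLinearMap.comp_apply]; abel
  have h3 : G.metric (σ x) (D.coordLift σ x v) (D.vert (σ x) κ') = 0 :=
    (D.horizProj_mem hx' (D.fderiv_mem_tangent hσ hx v)).2 _ (D.vert_mem_vertical hx' _)
  rw [coordForm_apply, h2, D.metric_add_right, h3, add_zero]

lemma coordForm_pos (D : RiemannianData G K) (hσ : G.IsParametrization σ V)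
    {x : EuclideanSpace ℝ (Fin d)}
    (hx : x ∈ V) {v : EuclideanSpace ℝ (Fin d)} (hv : v ≠ 0) : 0 < D.coordForm σ x v v := by
  have hx' := hσ.mapsTo hx
  have ht := D.fderiv_mem_tangent hσ hx v
  refine D.metric_pos _ hx' _ (D.horizProj_mem hx' ht).1 fun h0 => hv ?_
  obtain ⟨κ, hκ⟩ := D.sub_horizProj (σ x) (fderiv ℝ σ x v)
  have h0t : (0 : E) ∈ G.tangent (σ x) := by simpa using D.vert_mem _ hx' 0
  refine (hσ.bijective x hx 0 h0t).unique ?_ ?_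
  · have h1 : 0 - fderiv ℝ σ x v = D.vert (σ x) (-κ) := by
      have h0' : D.horizProj (σ x) (fderiv ℝ σ x v) = 0 := h0
      rw [map_neg, ← hκ, h0']; abel
    rw [h1]; exact D.vert_mem_vertical hx' _
  · simpa using D.vert_mem_vertical hx' 0

lemma fderiv_coordMetric (D : RiemannianData G K) (hσ : G.IsParametrization σ V)
    {x : EuclideanSpace ℝ (Fin d)}
    (hx : x ∈ V) (u v w : EuclideanSpace ℝ (Fin d)) :
    fderiv ℝ (fun y => G.coordMetric σ y v w) x u = fderiv ℝ (D.coordForm σ) x u v w := by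
  have h1 : (fun y => G.coordMetric σ y v w) =ᶠ[𝓝 x] fun y => D.coordForm σ y v w :=
    (hσ.isOpen.eventually_mem hx).mono fun y hy => D.coordMetric_eq hσ hy v w
  have h2 := ((D.coordForm_smooth hσ hx).differentiableAt (by simp)).hasFDerivAt
  have h3 := (h2.clm_apply (hasFDerivAt_const v x)).clm_apply (hasFDerivAt_const w x)
  rw [h1.fderiv_eq, h3.fderiv]
  simp

/-- For equal first arguments the Christoffel symbol is the Euler–Lagrange expression of the
energy. -/
lemma christoffel_self (D : RiemannianData G K) (hσ : G.IsParametrization σ V)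
    {x : EuclideanSpace ℝ (Fin d)}
    (hx : x ∈ V) (u w : EuclideanSpace ℝ (Fin d)) :
    G.christoffel σ x u u w = fderiv ℝ (D.coordForm σ) x u u w
      - (1 / 2) * fderiv ℝ (D.coordForm σ) x w u u := by
  rw [christoffel, D.fderiv_coordMetric hσ hx, D.fderiv_coordMetric hσ hx]
  ring

end Coordinates

end RiemannianData

end

end Submersion

/-! ### Horizontal geodesics of the total space project to geodesics -/

lemma contDiffAt_deriv {F : Type*} [NormedAddCommGroup F] [NormedSpace ℝ F] {f : ℝ → F} {t : ℝ}
    {m n : ℕ∞ω} (hf : ContDiffAt ℝ n f t) (hmn : m + 1 ≤ n) : ContDiffAt ℝ m (deriv f) t := by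
  have h1 := (hf.fderiv_right hmn).clm_apply (contDiffAt_const (c := (1 : ℝ)))
  have h2 : (fun s => fderiv ℝ f s 1) = deriv f := funext fun s => fderiv_apply_one_eq_deriv
  rwa [h2] at h1

lemma eventually_hasDerivAt {F : Type*} [NormedAddCommGroup F] [NormedSpace ℝ F] {f : ℝ → F}
    {t : ℝ} {n : ℕ∞ω} (hf : ContDiffAt ℝ n f t) (hn : 1 ≤ n) :
    ∀ᶠ s in 𝓝 t, HasDerivAt f (deriv f s) s :=
  ((hf.of_le hn).eventually (by simp)).mono fun _ hs =>
    (hs.differentiableAt (by simp)).hasDerivAt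

namespace Submersion

namespace RiemannianData

noncomputable section

variable {E X K : Type*} [NormedAddCommGroup E] [NormedSpace ℝ E]
  [NormedAddCommGroup K] [NormedSpace ℝ K] [FiniteDimensional ℝ E] [FiniteDimensional ℝ K]
  {G : Submersion E X}

/-- A curve `ρ` of linear maps of `E` that acts at time `s` as a symmetry of the submersion moving
points along the fibres. -/
structure IsGaugeAt (D : RiemannianData G K) (ρ : ℝ → E →L[ℝ] E) (s : ℝ) : Prop where
  mapsTo : ∀ θ ∈ G.total, ρ s θ ∈ G.total
  isometry : ∀ θ ∈ G.total, ∀ ξ η, G.metric (ρ s θ) (ρ s ξ) (ρ s η) = G.metric θ ξ η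
  vertical : ∀ θ ∈ G.total, ∀ κ, ρ s (D.vert θ κ) ∈ G.vertical (ρ s θ)
  deriv_eq : ∃ κ, ∀ θ, deriv ρ s θ = ρ s (D.vert θ κ)

/-- The covariant acceleration of `γ` in `G.total`, paired with the tangent vector `W`: the
Euler–Lagrange expression of the energy, in the linear coordinates of the ambient space. -/
def acceleration (D : RiemannianData G K) (γ : ℝ → E) (t : ℝ) (W : E) : ℝ :=
  G.metric (γ t) (deriv (deriv γ) t) W + fderiv ℝ D.form (γ t) (deriv γ t) (deriv γ t) W
    - (1 / 2) * fderiv ℝ D.form (γ t) W (deriv γ t) (deriv γ t)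

section

variable {d : ℕ} {σ : EuclideanSpace ℝ (Fin d) → E} {V : Set (EuclideanSpace ℝ (Fin d))}

/-- The velocity of a horizontal curve `s ↦ ρ s (σ (x s))`, transported back by `ρ s`, is the
horizontal lift of the coordinate velocity. -/
lemma coordLift_of_gauge (D : RiemannianData G K) (hσ : G.IsParametrization σ V)
    {ρ : ℝ → E →L[ℝ] E} {s : ℝ} {x u : EuclideanSpace ℝ (Fin d)} (hx : x ∈ V)
    (hg : D.IsGaugeAt ρ s)
    (hh : ρ s (fderiv ℝ σ x u) + deriv ρ s (σ x) ∈ G.horizontal (ρ s (σ x))) :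
    ρ s (D.coordLift σ x u) = ρ s (fderiv ℝ σ x u) + deriv ρ s (σ x) := by
  obtain ⟨κ, hκ⟩ := hg.deriv_eq
  have hx' := hσ.mapsTo hx
  have h1 : ρ s (fderiv ℝ σ x u) + deriv ρ s (σ x)
      = ρ s (fderiv ℝ σ x u + D.vert (σ x) κ) := by rw [hκ, map_add]
  rw [h1] at hh ⊢
  rw [D.coordLift_eq hσ hx ?_ κ rfl]
  refine ⟨D.tangent_add _ hx' _ (D.fderiv_mem_tangent hσ hx u) _ (D.vert_mem _ hx' κ), ?_⟩
  intro ζ hζ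
  obtain ⟨κ', rfl⟩ : ζ ∈ range (D.vert (σ x)) := D.vertical_eq _ hx' ▸ hζ
  rw [← hg.isometry _ hx']
  exact hh.2 _ (hg.vertical _ hx' κ')

variable {x : ℝ → EuclideanSpace ℝ (Fin d)} {t : ℝ} {γ : ℝ → E} {ρ : ℝ → E →L[ℝ] E}

/-- The first term of the Euler–Lagrange expression, computed on the lift. -/
lemma fderiv_coordForm_velocity (D : RiemannianData G K) (hσ : G.IsParametrization σ V)
    (hx : ContDiffAt ℝ ∞ x t) (hxV : ∀ᶠ s in 𝓝 t, x s ∈ V) (hρ : ContDiffAt ℝ ∞ ρ t)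
    (hg : ∀ᶠ s in 𝓝 t, D.IsGaugeAt ρ s) (hγ : ∀ᶠ s in 𝓝 t, ρ s (σ (x s)) = γ s)
    (hγs : ContDiffAt ℝ ∞ γ t)
    (hγ' : ∀ᶠ s in 𝓝 t, deriv γ s = ρ s (fderiv ℝ σ (x s) (deriv x s)) + deriv ρ s (σ (x s)))
    (hh : ∀ᶠ s in 𝓝 t, deriv γ s ∈ G.horizontal (γ s)) (w : EuclideanSpace ℝ (Fin d)) :
    fderiv ℝ (D.coordForm σ) (x t) (deriv x t) (deriv x t) w
        + D.coordForm σ (x t) (deriv (deriv x) t) w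
      = fderiv ℝ D.form (γ t) (deriv γ t) (deriv γ t) (ρ t (fderiv ℝ σ (x t) w))
        + G.metric (γ t) (deriv (deriv γ) t) (ρ t (fderiv ℝ σ (x t) w))
        + G.metric (γ t) (deriv γ t) (deriv ρ t (fderiv ℝ σ (x t) w)
          + ρ t (fderiv ℝ (fderiv ℝ σ) (x t) (deriv x t) w)) := by
  have hxt := hxV.self_of_nhds
  have hσx := hσ.smooth.contDiffAt (hσ.isOpen.mem_nhds hxt)
  have hx1 : HasDerivAt x (deriv x t) t := (hx.differentiableAt (by simp)).hasDerivAt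
  have hx2 : HasDerivAt (deriv x) (deriv (deriv x) t) t :=
    ((contDiffAt_deriv (m := ∞) hx (by simp)).differentiableAt (by simp)).hasDerivAt
  have hγ1 : HasDerivAt γ (deriv γ t) t := (hγs.differentiableAt (by simp)).hasDerivAt
  have hγ2 : HasDerivAt (deriv γ) (deriv (deriv γ) t) t :=
    ((contDiffAt_deriv (m := ∞) hγs (by simp)).differentiableAt (by simp)).hasDerivAt
  have hρ1 : HasDerivAt ρ (deriv ρ t) t := (hρ.differentiableAt (by simp)).hasDerivAt
  have hS : HasFDerivAt (fderiv ℝ σ) (fderiv ℝ (fderiv ℝ σ) (x t)) (x t) :=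
    ((hσx.fderiv_right (m := ∞) (by simp)).differentiableAt (by simp)).hasFDerivAt
  have hform : HasFDerivAt D.form (fderiv ℝ D.form (γ t)) (γ t) := by
    refine ((D.form_smooth ?_).differentiableAt (by simp)).hasFDerivAt
    rw [← hγ.self_of_nhds]
    exact hg.self_of_nhds.mapsTo _ (hσ.mapsTo hxt)
  have hL := (((((D.coordForm_smooth hσ hxt).differentiableAt
    (by simp)).hasFDerivAt.comp_hasDerivAt t hx1).clm_apply hx2).clm_apply (hasDerivAt_const t w))
  have hW := hρ1.clm_apply ((hS.comp_hasDerivAt t hx1).clm_apply (hasDerivAt_const t w))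
  have hR := ((hform.comp_hasDerivAt t hγ1).clm_apply hγ2).clm_apply hW
  have heq : (fun s => D.form (γ s) (deriv γ s) (ρ s (fderiv ℝ σ (x s) w))) =ᶠ[𝓝 t]
      fun s => D.coordForm σ (x s) (deriv x s) w := by
    filter_upwards [hxV, hg, hγ, hγ', hh] with s h1 h2 h3 h4 h5
    rw [h4, ← h3] at h5
    rw [D.coordForm_eq_left hσ h1, ← h2.isometry _ (hσ.mapsTo h1),
      D.coordLift_of_gauge hσ h1 h2 h5, h3, ← h4]
    rfl
  have := (hR.congr_of_eventuallyEq heq.symm).unique hL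
  simp only [Function.comp_apply, _root_.add_apply, map_zero, add_zero, form_apply] at this
  exact this.symm

/-- The second term of the Euler–Lagrange expression. The energy of the projected variation is at
most that of its lift, with equality at the curve, so that the two have the same derivative. -/
lemma fderiv_coordForm_energy (D : RiemannianData G K) (hσ : G.IsParametrization σ V)
    (hxt : x t ∈ V) (hg : D.IsGaugeAt ρ t) (hγ : ρ t (σ (x t)) = γ t)
    (hγ' : deriv γ t = ρ t (fderiv ℝ σ (x t) (deriv x t)) + deriv ρ t (σ (x t)))
    (hh : deriv γ t ∈ G.horizontal (γ t)) (w : EuclideanSpace ℝ (Fin d)) :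
    fderiv ℝ (D.coordForm σ) (x t) w (deriv x t) (deriv x t)
      = fderiv ℝ D.form (γ t) (ρ t (fderiv ℝ σ (x t) w)) (deriv γ t) (deriv γ t)
        + 2 * G.metric (γ t) (deriv γ t) (deriv ρ t (fderiv ℝ σ (x t) w)
          + ρ t (fderiv ℝ (fderiv ℝ σ) (x t) (deriv x t) w)) := by
  have hσx := hσ.smooth.contDiffAt (hσ.isOpen.mem_nhds hxt)
  set u := deriv x t with hu
  have hl0 : x t + (0 : ℝ) • w = x t := by simp
  have hS1 : HasDerivAt (fun τ : ℝ => σ (x t + τ • w)) (fderiv ℝ σ (x t) w) 0 :=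
    (hσx.differentiableAt (by simp)).hasFDerivAt.hasLineDerivAt w
  have hS2 : HasDerivAt (fun τ : ℝ => fderiv ℝ σ (x t + τ • w))
      (fderiv ℝ (fderiv ℝ σ) (x t) w) 0 :=
    ((hσx.fderiv_right (m := ∞) (by simp)).differentiableAt
      (by simp)).hasFDerivAt.hasLineDerivAt w
  have hC : HasDerivAt (fun τ : ℝ => D.coordForm σ (x t + τ • w))
      (fderiv ℝ (D.coordForm σ) (x t) w) 0 :=
    ((D.coordForm_smooth hσ hxt).differentiableAt (by simp)).hasFDerivAt.hasLineDerivAt w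
  have hform : HasFDerivAt D.form (fderiv ℝ D.form (γ t)) (ρ t (σ (x t + (0 : ℝ) • w))) := by
    rw [hl0, hγ]
    refine ((D.form_smooth ?_).differentiableAt (by simp)).hasFDerivAt
    rw [← hγ]
    exact hg.mapsTo _ (hσ.mapsTo hxt)
  have hθ : HasDerivAt (fun τ : ℝ => ρ t (σ (x t + τ • w))) (ρ t (fderiv ℝ σ (x t) w)) 0 :=
    (ρ t).hasFDerivAt.comp_hasDerivAt (0 : ℝ) hS1
  have hF : HasDerivAt (fun τ : ℝ => D.form (ρ t (σ (x t + τ • w))))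
      (fderiv ℝ D.form (γ t) (ρ t (fderiv ℝ σ (x t) w))) 0 :=
    HasFDerivAt.comp_hasDerivAt (f := fun τ : ℝ => ρ t (σ (x t + τ • w))) (0 : ℝ) hform hθ
  have hY := ((ρ t).hasFDerivAt.comp_hasDerivAt (0 : ℝ)
    (hS2.clm_apply (hasDerivAt_const (0 : ℝ) u))).add
    ((deriv ρ t).hasFDerivAt.comp_hasDerivAt (0 : ℝ) hS1)
  have hR := (hF.clm_apply hY).clm_apply hY
  have hL := (hC.clm_apply (hasDerivAt_const (0 : ℝ) u)).clm_apply (hasDerivAt_const (0 : ℝ) u)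
  have hsymm : fderiv ℝ (fderiv ℝ σ) (x t) w u = fderiv ℝ (fderiv ℝ σ) (x t) u w :=
    (hσx.isSymmSndFDerivAt (by simpa using ENat.LEInfty.out)).eq w u
  have hlift := D.coordLift_of_gauge hσ hxt hg (hγ' ▸ hγ ▸ hh)
  have hmin := IsLocalMin.hasDerivAt_eq_zero ?_ (hR.sub hL)
  · simp only [Pi.add_apply, Function.comp_apply, _root_.add_apply, hl0, hγ, map_zero, add_zero,
      ← hγ', form_apply, hsymm] at hmin
    rw [D.metric_comm _ _ (deriv γ t), add_comm (ρ t _)] at hmin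
    linarith
  · have hV : ∀ᶠ τ : ℝ in 𝓝 0, x t + τ • w ∈ V :=
      (hσ.isOpen.preimage (by fun_prop : Continuous fun τ : ℝ => x t + τ • w)).mem_nhds
        (by simpa using hxt)
    filter_upwards [hV] with τ hτ
    obtain ⟨κ, hκ⟩ := hg.deriv_eq
    simp only [Pi.add_apply, Pi.sub_apply, Function.comp_apply, hl0]
    have h0 : D.form (ρ t (σ (x t))) (ρ t (fderiv ℝ σ (x t) u) + deriv ρ t (σ (x t)))
        (ρ t (fderiv ℝ σ (x t) u) + deriv ρ t (σ (x t))) = D.coordForm σ (x t) u u := by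
      rw [← hlift, form_apply, hg.isometry _ (hσ.mapsTo hxt)]; rfl
    rw [h0, sub_self, sub_nonneg, hκ, ← map_add, form_apply, hg.isometry _ (hσ.mapsTo hτ)]
    exact D.metric_horizProj_le (hσ.mapsTo hτ) κ

/-- A horizontal curve whose acceleration in the total space is orthogonal to the tangent space
projects to a curve with vanishing covariant acceleration. -/
theorem coordMetric_add_christoffel_eq_zero (D : RiemannianData G K)
    (hσ : G.IsParametrization σ V)
    (hx : ContDiffAt ℝ ∞ x t) (hxV : ∀ᶠ s in 𝓝 t, x s ∈ V) (hρ : ContDiffAt ℝ ∞ ρ t)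
    (hg : ∀ᶠ s in 𝓝 t, D.IsGaugeAt ρ s) (hγ : ∀ᶠ s in 𝓝 t, ρ s (σ (x s)) = γ s)
    (hγs : ContDiffAt ℝ ∞ γ t)
    (hh : ∀ᶠ s in 𝓝 t, deriv γ s ∈ G.horizontal (γ s))
    (hacc : ∀ W ∈ G.tangent (γ t), D.acceleration γ t W = 0) (w : EuclideanSpace ℝ (Fin d)) :
    G.coordMetric σ (x t) (deriv (deriv x) t) w
      + G.christoffel σ (x t) (deriv x t) (deriv x t) w = 0 := by
  have hxt := hxV.self_of_nhds
  have hσx := hσ.smooth.contDiffAt (hσ.isOpen.mem_nhds hxt)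
  have hγ' : ∀ᶠ s in 𝓝 t, deriv γ s
      = ρ s (fderiv ℝ σ (x s) (deriv x s)) + deriv ρ s (σ (x s)) := by
    filter_upwards [eventually_hasDerivAt hx (by simp), eventually_hasDerivAt hρ (by simp),
      hγ.eventually_nhds, hxV] with s h1 h2 h3 h4
    have h5 := ((hσ.smooth.contDiffAt (hσ.isOpen.mem_nhds h4)).differentiableAt
      (by simp)).hasFDerivAt.comp_hasDerivAt s h1
    have h6 := (h2.clm_apply h5).congr_of_eventuallyEq
      (f₁ := γ) (h3.mono fun _ h => h.symm)
    rw [h6.deriv, add_comm]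
    rfl
  have h1 := D.fderiv_coordForm_velocity hσ hx hxV hρ hg hγ hγs hγ' hh w
  have h2 := D.fderiv_coordForm_energy hσ hxt hg.self_of_nhds hγ.self_of_nhds hγ'.self_of_nhds
    hh.self_of_nhds w
  have hW : ρ t (fderiv ℝ σ (x t) w) ∈ G.tangent (γ t) := by
    have h4 : HasDerivAt (fun τ : ℝ => ρ t (σ (x t + τ • w))) (ρ t (fderiv ℝ σ (x t) w)) 0 :=
      (ρ t).hasFDerivAt.comp_hasDerivAt (0 : ℝ)
        ((hσx.differentiableAt (by simp)).hasFDerivAt.hasLineDerivAt w)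
    have h5 : ∀ᶠ τ : ℝ in 𝓝 0, x t + τ • w ∈ V :=
      (hσ.isOpen.preimage (by fun_prop : Continuous fun τ : ℝ => x t + τ • w)).mem_nhds
        (by simpa using hxt)
    have h6 := D.deriv_mem _ _ 0 h4
      (h5.mono fun τ hτ => hg.self_of_nhds.mapsTo _ (hσ.mapsTo hτ))
    simpa [hγ.self_of_nhds] using h6
  have h3 := hacc _ hW
  rw [acceleration] at h3
  rw [D.coordMetric_eq hσ hxt, D.christoffel_self hσ hxt, h2]
  linarith

/-! ### Local uniqueness of geodesics -/

/-- The covector `w ↦ Γ(v, v, w)` at `x`, where `Γ` is the Christoffel symbol of the metric `g` on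
an open set of `F` and `y = (x, v)`. -/
def christoffelForm {F : Type*} [NormedAddCommGroup F] [NormedSpace ℝ F]
    (g : F → F →L[ℝ] F →L[ℝ] ℝ) (y : F × F) : F →L[ℝ] ℝ :=
  fderiv ℝ g y.1 y.2 y.2 - (1 / 2 : ℝ) • ((fderiv ℝ g y.1).flip y.2).flip y.2

lemma christoffelForm_smooth {F : Type*} [NormedAddCommGroup F] [NormedSpace ℝ F]
    [FiniteDimensional ℝ F] {g : F → F →L[ℝ] F →L[ℝ] ℝ} {y : F × F}
    (hg : ContDiffAt ℝ ∞ g y.1) : ContDiffAt ℝ ∞ (christoffelForm g) y := by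
  have h2 : ContDiffAt ℝ ∞ (fun y : F × F => fderiv ℝ g y.1) y :=
    ContDiffAt.comp y (hg.fderiv_right (m := ∞) (by simp)) contDiffAt_fst
  refine contDiffAt_clm_of_apply fun w => ContDiffAt.sub ?_ ?_
  · exact ((h2.clm_apply contDiffAt_snd).clm_apply contDiffAt_snd).clm_apply contDiffAt_const
  · exact contDiffAt_const.smul
      (((h2.clm_apply contDiffAt_const).clm_apply contDiffAt_snd).clm_apply contDiffAt_snd)

/-- The geodesic equation as a first-order system for position and velocity. -/
def geodesicField (D : RiemannianData G K) (σ : EuclideanSpace ℝ (Fin d) → E)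
    (y : EuclideanSpace ℝ (Fin d) × EuclideanSpace ℝ (Fin d)) :
    EuclideanSpace ℝ (Fin d) × EuclideanSpace ℝ (Fin d) :=
  (y.2, -(D.coordForm σ y.1).inverse (christoffelForm (D.coordForm σ) y))

lemma geodesicField_smooth (D : RiemannianData G K) (hσ : G.IsParametrization σ V)
    {y : EuclideanSpace ℝ (Fin d) × EuclideanSpace ℝ (Fin d)} (hy : y.1 ∈ V) :
    ContDiffAt ℝ ∞ (D.geodesicField σ) y := by
  have h1 : ContDiffAt ℝ ∞ (fun y : EuclideanSpace ℝ (Fin d) × EuclideanSpace ℝ (Fin d) =>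
      D.coordForm σ y.1) y := (D.coordForm_smooth hσ hy).comp y contDiffAt_fst
  have h3 : ContDiffAt ℝ ∞ (christoffelForm (D.coordForm σ)) y :=
    christoffelForm_smooth (D.coordForm_smooth hσ hy)
  have h4 : ContDiffAt ℝ ∞ (fun y : EuclideanSpace ℝ (Fin d) × EuclideanSpace ℝ (Fin d) =>
      (D.coordForm σ y.1).inverse) y := by
    obtain ⟨e, he⟩ := exists_equiv_of_pos (D.coordForm σ y.1) fun v hv => D.coordForm_pos hσ hy hv
    have := contDiffAt_map_inverse (n := ∞) e
    rw [he] at this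
    exact ContDiffAt.comp y this h1
  exact contDiffAt_snd.prodMk (h4.clm_apply h3).neg

lemma deriv_deriv_eq_of_geodesic (D : RiemannianData G K) (hσ : G.IsParametrization σ V)
    {y u a : EuclideanSpace ℝ (Fin d)} (hy : y ∈ V)
    (h : ∀ w, G.coordMetric σ y a w + G.christoffel σ y u u w = 0) :
    a = -(D.coordForm σ y).inverse (christoffelForm (D.coordForm σ) (y, u)) := by
  obtain ⟨e, he⟩ := exists_equiv_of_pos (D.coordForm σ y) fun v hv => D.coordForm_pos hσ hy hv
  rw [← he, ContinuousLinearMap.inverse_equiv, ← map_neg, ContinuousLinearEquiv.coe_coe,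
    e.eq_symm_apply]
  ext w
  have h1 := h w
  rw [D.coordMetric_eq hσ hy, D.christoffel_self hσ hy, ← he] at h1
  exact eq_neg_of_add_eq_zero_left h1

/-- Two solutions of the geodesic equation with the same position and velocity agree. -/
theorem eventuallyEq_of_geodesic (D : RiemannianData G K) (hσ : G.IsParametrization σ V)
    {x₁ x₂ : ℝ → EuclideanSpace ℝ (Fin d)} (h₁ : ContDiffAt ℝ ∞ x₁ t) (h₂ : ContDiffAt ℝ ∞ x₂ t)
    (hV₁ : ∀ᶠ s in 𝓝 t, x₁ s ∈ V) (hV₂ : ∀ᶠ s in 𝓝 t, x₂ s ∈ V)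
    (hg₁ : ∀ᶠ s in 𝓝 t, ∀ w, G.coordMetric σ (x₁ s) (deriv (deriv x₁) s) w
      + G.christoffel σ (x₁ s) (deriv x₁ s) (deriv x₁ s) w = 0)
    (hg₂ : ∀ᶠ s in 𝓝 t, ∀ w, G.coordMetric σ (x₂ s) (deriv (deriv x₂) s) w
      + G.christoffel σ (x₂ s) (deriv x₂ s) (deriv x₂ s) w = 0)
    (h0 : x₁ t = x₂ t) (h0' : deriv x₁ t = deriv x₂ t) : x₁ =ᶠ[𝓝 t] x₂ := by
  obtain ⟨C, s, hs, hlip⟩ := ((D.geodesicField_smooth hσ (y := (x₁ t, deriv x₁ t))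
    hV₁.self_of_nhds).of_le (m := 1) (by simp)).exists_lipschitzOnWith
  have key : ∀ x : ℝ → EuclideanSpace ℝ (Fin d), ContDiffAt ℝ ∞ x t → (∀ᶠ s in 𝓝 t, x s ∈ V) →
      (∀ᶠ s in 𝓝 t, ∀ w, G.coordMetric σ (x s) (deriv (deriv x) s) w
        + G.christoffel σ (x s) (deriv x s) (deriv x s) w = 0) →
      (x t, deriv x t) = (x₁ t, deriv x₁ t) →
      ∀ᶠ τ in 𝓝 t, HasDerivAt (fun τ => (x τ, deriv x τ))
        (D.geodesicField σ (x τ, deriv x τ)) τ ∧ (x τ, deriv x τ) ∈ s := by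
    intro x hx hxV hgx heq
    have hx' := contDiffAt_deriv (m := ∞) hx (by simp)
    have hc : ContinuousAt (fun τ => (x τ, deriv x τ)) t :=
      hx.continuousAt.prodMk hx'.continuousAt
    filter_upwards [eventually_hasDerivAt hx (by simp), eventually_hasDerivAt hx' (by simp),
      hxV, hgx, hc.eventually_mem (by rw [heq]; exact hs)] with τ h1 h2 h3 h4 h5
    refine ⟨?_, h5⟩
    rw [D.deriv_deriv_eq_of_geodesic hσ h3 h4] at h2
    exact h1.prodMk h2
  have := ODE_solution_unique_of_eventually (v := fun _ => D.geodesicField σ) (s := fun _ => s)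
    (.of_forall fun _ => hlip) (key x₁ h₁ hV₁ hg₁ rfl) (key x₂ h₂ hV₂ hg₂ (by rw [h0, h0']))
    (by simp only [h0, h0'])
  exact this.mono fun τ hτ => congrArg Prod.fst hτ

end

end

end RiemannianData

end Submersion

/-! ### Calculus of matrix-valued functions -/

noncomputable section

section MatrixCalculus

variable {l m n : Type*} [Fintype l] [Fintype m] [Fintype n]

/-- A bilinear map on finite-dimensional spaces is continuous. -/
def bilinToCLM {E F F' : Type*} [NormedAddCommGroup E] [NormedSpace ℝ E]
    [FiniteDimensional ℝ E] [NormedAddCommGroup F] [NormedSpace ℝ F] [FiniteDimensional ℝ F]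
    [NormedAddCommGroup F'] [NormedSpace ℝ F'] (f : E →ₗ[ℝ] F →ₗ[ℝ] F') : E →L[ℝ] F →L[ℝ] F' :=
  LinearMap.toContinuousLinearMap
    ((LinearMap.toContinuousLinearMap (𝕜 := ℝ) (E := F) (F' := F')).toLinearMap ∘ₗ f)

/-- Matrix multiplication as a real bilinear map. -/
def mulL : Matrix l m ℂ →L[ℝ] Matrix m n ℂ →L[ℝ] Matrix l n ℂ :=
  bilinToCLM (LinearMap.mk₂ ℝ (fun A B => A * B) Matrix.add_mul (fun c A B => Matrix.smul_mul c A B)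
    Matrix.mul_add (fun c A B => Matrix.mul_smul A c B))

/-- The conjugate transpose as a real linear map. -/
def conjTransposeL : Matrix m n ℂ →L[ℝ] Matrix n m ℂ :=
  LinearMap.toContinuousLinearMap
    { toFun := fun A => Aᴴ
      map_add' := conjTranspose_add
      map_smul' := fun c A => by simp }

/-- The real part of the trace as a real linear map. -/
def reTraceL : Matrix n n ℂ →L[ℝ] ℝ :=
  LinearMap.toContinuousLinearMap
    { toFun := fun A => (trace A).re
      map_add' := fun A B => by simp
      map_smul' := fun c A => by simp }

variable {F : Type*} [NormedAddCommGroup F] [NormedSpace ℝ F]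

lemma ContDiffAt.matrixMul {r : ℕ∞ω} {A : F → Matrix l m ℂ} {B : F → Matrix m n ℂ} {x : F}
    (hA : ContDiffAt ℝ r A x) (hB : ContDiffAt ℝ r B x) :
    ContDiffAt ℝ r (fun y => A y * B y) x :=
  ((mulL.contDiff.contDiffAt.comp x hA).clm_apply hB : )

lemma ContDiffAt.conjTranspose {r : ℕ∞ω} {A : F → Matrix m n ℂ} {x : F}
    (hA : ContDiffAt ℝ r A x) : ContDiffAt ℝ r (fun y => (A y)ᴴ) x :=
  (conjTransposeL.contDiff.contDiffAt.comp x hA : )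

lemma ContDiffAt.reTrace {r : ℕ∞ω} {A : F → Matrix n n ℂ} {x : F}
    (hA : ContDiffAt ℝ r A x) : ContDiffAt ℝ r (fun y => (trace (A y)).re) x :=
  (reTraceL.contDiff.contDiffAt.comp x hA : )

lemma ContDiffAt.matrixInv [DecidableEq n] {r : ℕ∞ω} {A : F → Matrix n n ℂ} {x : F}
    (hA : ContDiffAt ℝ r A x) (hu : IsUnit (A x)) : ContDiffAt ℝ r (fun y => (A y)⁻¹) x := by
  let _ : NormedRing (Matrix n n ℂ) := Matrix.linftyOpNormedRing
  let _ : NormedAlgebra ℝ (Matrix n n ℂ) := Matrix.linftyOpNormedAlgebra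
  obtain ⟨u, hu⟩ := hu
  have h1 : ContDiffAt ℝ r Ring.inverse (A x) := hu ▸ contDiffAt_ringInverse ℝ u
  have h2 : (fun y => (A y)⁻¹) = fun y => Ring.inverse (A y) :=
    funext fun y => nonsing_inv_eq_ringInverse _
  rw [h2]
  exact h1.comp x hA

lemma HasDerivAt.matrixMul {A : ℝ → Matrix l m ℂ} {B : ℝ → Matrix m n ℂ} {A' : Matrix l m ℂ}
    {B' : Matrix m n ℂ} {t : ℝ} (hA : HasDerivAt A A' t) (hB : HasDerivAt B B' t) :
    HasDerivAt (fun s => A s * B s) (A' * B t + A t * B') t := by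
  have h := mulL.hasDerivAt_of_bilinear (fun _ => hA) (fun _ => hB)
  rw [add_comm] at h
  exact h

lemma HasDerivAt.matrixConjTranspose {A : ℝ → Matrix m n ℂ} {A' : Matrix m n ℂ} {t : ℝ}
    (hA : HasDerivAt A A' t) : HasDerivAt (fun s => (A s)ᴴ) A'ᴴ t :=
  (conjTransposeL.hasFDerivAt.comp_hasDerivAt t hA : )

lemma HasDerivAt.reTrace {A : ℝ → Matrix n n ℂ} {A' : Matrix n n ℂ} {t : ℝ}
    (hA : HasDerivAt A A' t) : HasDerivAt (fun s => (trace (A s)).re) (trace A').re t :=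
  (reTraceL.hasFDerivAt.comp_hasDerivAt t hA : )

lemma HasDerivAt.matrixInv [DecidableEq n] {A : ℝ → Matrix n n ℂ} {A' : Matrix n n ℂ} {t : ℝ}
    (hA : HasDerivAt A A' t) (hu : IsUnit (A t)) :
    HasDerivAt (fun s => (A s)⁻¹) (-((A t)⁻¹ * A' * (A t)⁻¹)) t := by
  let _ : NormedRing (Matrix n n ℂ) := Matrix.linftyOpNormedRing
  let _ : NormedAlgebra ℝ (Matrix n n ℂ) := Matrix.linftyOpNormedAlgebra
  obtain ⟨u, hu⟩ := hu
  have h1 := hasFDerivAt_ringInverse (𝕜 := ℝ) u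
  have h2 : (fun y => (A y)⁻¹) = fun y => Ring.inverse (A y) :=
    funext fun y => nonsing_inv_eq_ringInverse _
  have h3 : (A t)⁻¹ = (↑u⁻¹ : Matrix n n ℂ) := by
    rw [nonsing_inv_eq_ringInverse, ← hu, Ring.inverse_unit]
  rw [h2, h3]
  rw [hu] at h1
  exact h1.comp_hasDerivAt t hA

lemma hasDerivAt_matrixExp [DecidableEq n] (X : Matrix n n ℂ) (t : ℝ) :
    HasDerivAt (fun s : ℝ => NormedSpace.exp (s • X)) (NormedSpace.exp (t • X) * X) t := by
  let _ : NormedRing (Matrix n n ℂ) := Matrix.linftyOpNormedRing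
  let _ : NormedAlgebra ℝ (Matrix n n ℂ) := Matrix.linftyOpNormedAlgebra
  exact hasDerivAt_exp_smul_const X t

lemma contDiff_matrixExp [DecidableEq n] (X : Matrix n n ℂ) :
    ContDiff ℝ ∞ (fun s : ℝ => NormedSpace.exp (s • X)) := by
  have hd : deriv (fun s : ℝ => NormedSpace.exp (s • X)) = fun s => NormedSpace.exp (s • X) * X :=
    funext fun s => (hasDerivAt_matrixExp X s).deriv
  rw [contDiff_infty]
  intro r
  induction r with
  | zero =>
    exact contDiff_zero.mpr (continuous_iff_continuousAt.mpr fun s =>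
      (hasDerivAt_matrixExp X s).continuousAt)
  | succ r ih =>
    push_cast
    refine contDiff_succ_iff_deriv.mpr ⟨fun s => (hasDerivAt_matrixExp X s).differentiableAt,
      fun h => absurd h (by simp), ?_⟩
    have h : ContDiff ℝ r fun s : ℝ => NormedSpace.exp (s • X) * X :=
      contDiff_iff_contDiffAt.mpr fun s => ih.contDiffAt.matrixMul contDiffAt_const
    rw [← hd] at h
    exact h

lemma re_trace_conjTranspose (A : Matrix n n ℂ) : (trace Aᴴ).re = (trace A).re := by
  rw [trace_conjTranspose]; simp

/-- The real trace of a product of a skew-Hermitian and a Hermitian matrix vanishes. -/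
lemma re_trace_skew_mul_herm {B H : Matrix n n ℂ} (hB : Bᴴ = -B) (hH : Hᴴ = H) :
    (trace (B * H)).re = 0 := by
  have h := re_trace_conjTranspose (B * H)
  rw [conjTranspose_mul, hB, hH, trace_mul_comm, Matrix.neg_mul, trace_neg, Complex.neg_re] at h
  linarith

lemma re_trace_conjTranspose_mul_self_nonneg (A : Matrix m n ℂ) : 0 ≤ (trace (Aᴴ * A)).re :=
  (Complex.le_def.mp (posSemidef_conjTranspose_mul_self A).trace_nonneg).1

lemma eq_zero_of_re_trace {A : Matrix m n ℂ} (h : (trace (Aᴴ * A)).re = 0) : A = 0 := by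
  have h0 := (posSemidef_conjTranspose_mul_self A).trace_nonneg
  rw [← trace_conjTranspose_mul_self_eq_zero_iff]
  exact Complex.ext h (Complex.le_def.mp h0).2.symm

end MatrixCalculus

namespace Submersion.RiemannianData

variable {E X K : Type*} [NormedAddCommGroup E] [NormedSpace ℝ E]
  [NormedAddCommGroup K] [NormedSpace ℝ K] [FiniteDimensional ℝ E] [FiniteDimensional ℝ K]
  {G : Submersion E X}

lemma fderiv_form_eq (D : RiemannianData G K) {θ ξ η ζ : E} {a : ℝ} (hθ : θ ∈ G.total)
    (h : HasDerivAt (fun τ : ℝ => G.metric (θ + τ • ξ) η ζ) a 0) :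
    fderiv ℝ D.form θ ξ η ζ = a := by
  have h1 : HasDerivAt (fun τ : ℝ => D.form (θ + τ • ξ)) (fderiv ℝ D.form θ ξ) 0 :=
    ((D.form_smooth hθ).differentiableAt (by simp)).hasFDerivAt.hasLineDerivAt ξ
  have h2 := (h1.clm_apply (hasDerivAt_const (0 : ℝ) η)).clm_apply (hasDerivAt_const (0 : ℝ) ζ)
  simpa [-form_apply] using h2.unique h

end Submersion.RiemannianData

/-! ### The Stiefel manifold -/

section Stiefel

variable {p k : ℕ}

lemma stiefel_metric_comm (U ξ η : Matrix (Fin p) (Fin k) ℂ) :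
    (stiefel p k).metric U ξ η = (stiefel p k).metric U η ξ := by
  simp only [stiefel]
  rw [← re_trace_conjTranspose]
  simp [conjTranspose_mul, Matrix.mul_assoc]

lemma stiefel_metric_eq (U ξ η : Matrix (Fin p) (Fin k) ℂ) :
    (stiefel p k).metric U ξ η
      = (trace (ξᴴ * η)).re + -(1 / 2) * (trace (ξᴴ * (U * Uᴴ) * η)).re := by
  simp only [stiefel, Matrix.mul_sub, Matrix.sub_mul, Matrix.mul_one, trace_sub, Complex.sub_re,
    Matrix.mul_smul, Matrix.smul_mul, trace_smul]
  simp
  ring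

lemma stiefel_metric_smooth (U ξ η : Matrix (Fin p) (Fin k) ℂ) :
    ContDiffAt ℝ ∞ (fun U => (stiefel p k).metric U ξ η) U := by
  simp only [stiefel_metric_eq]
  have h : ContDiffAt ℝ ∞ (fun U : Matrix (Fin p) (Fin k) ℂ => U * Uᴴ) U :=
    contDiffAt_id.matrixMul contDiffAt_id.conjTranspose
  exact contDiffAt_const.add (contDiffAt_const.mul
    ((contDiffAt_const.matrixMul h).matrixMul contDiffAt_const).reTrace)

lemma stiefel_metric_self {U : Matrix (Fin p) (Fin k) ℂ} (hU : Uᴴ * U = 1)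
    (ξ : Matrix (Fin p) (Fin k) ℂ) :
    (stiefel p k).metric U ξ ξ = (trace ((ξ - U * (Uᴴ * ξ))ᴴ * (ξ - U * (Uᴴ * ξ)))).re
      + 1 / 2 * (trace ((Uᴴ * ξ)ᴴ * (Uᴴ * ξ))).re := by
  have h1 : (ξ - U * (Uᴴ * ξ))ᴴ * (ξ - U * (Uᴴ * ξ)) = ξᴴ * ξ - (Uᴴ * ξ)ᴴ * (Uᴴ * ξ) := by
    have h2 : ∀ B : Matrix (Fin k) (Fin k) ℂ, Uᴴ * (U * B) = B := fun B => by
      rw [← Matrix.mul_assoc, hU, Matrix.one_mul]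
    simp [Matrix.mul_sub, Matrix.sub_mul, Matrix.mul_assoc, h2]
  have h3 : ξᴴ * (1 - (1 / 2 : ℂ) • (U * Uᴴ)) * ξ
      = ξᴴ * ξ - (1 / 2 : ℂ) • ((Uᴴ * ξ)ᴴ * (Uᴴ * ξ)) := by
    simp [Matrix.mul_sub, Matrix.sub_mul, Matrix.mul_assoc]
  simp only [stiefel]
  rw [h1, h3]
  simp
  ring

lemma stiefel_metric_line (U ξ η ζ : Matrix (Fin p) (Fin k) ℂ) :
    HasDerivAt (fun τ : ℝ => (stiefel p k).metric (U + τ • ξ) η ζ)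
      (-(1 / 2) * (trace (ηᴴ * (ξ * Uᴴ + U * ξᴴ) * ζ)).re) 0 := by
  have hl : HasDerivAt (fun τ : ℝ => U + τ • ξ) ξ 0 := (hasFDerivAt_id U).hasLineDerivAt ξ
  have h1 := hl.matrixMul hl.matrixConjTranspose
  have h2 := (((hasDerivAt_const (0 : ℝ) ηᴴ).matrixMul h1).matrixMul
    (hasDerivAt_const (0 : ℝ) ζ)).reTrace.const_mul (-(1 / 2 : ℝ))
  have h3 := h2.const_add (trace (ηᴴ * ζ)).re
  simp only [zero_smul, add_zero, Matrix.zero_mul, zero_add, Matrix.mul_zero] at h3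
  exact h3.congr_of_eventuallyEq (.of_forall fun τ => stiefel_metric_eq _ _ _)

/-- The geodesic equation `U'' = U' A - U (A² + U'ᴴ U')` with `A = Uᴴ U'` says that the acceleration
for the canonical metric is orthogonal to the tangent space. -/
lemma stiefel_acceleration {U U' U'' W : Matrix (Fin p) (Fin k) ℂ} (hU : Uᴴ * U = 1)
    (hU' : (Uᴴ * U')ᴴ = -(Uᴴ * U'))
    (hU'' : U'' = U' * (Uᴴ * U') - U * (Uᴴ * U' * (Uᴴ * U') + U'ᴴ * U'))
    (hW : W ∈ (stiefel p k).tangent U) :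
    (stiefel p k).metric U U'' W + -(1 / 2) * (trace (U'ᴴ * (U' * Uᴴ + U * U'ᴴ) * W)).re
      - 1 / 2 * (-(1 / 2) * (trace (U'ᴴ * (W * Uᴴ + U * Wᴴ) * U')).re) = 0 := by
  set A := Uᴴ * U' with hA
  set H := U'ᴴ * U' with hH
  have hHh : Hᴴ = H := by simp [hH]
  have hWU : (Wᴴ * U)ᴴ = -(Wᴴ * U) := by
    rw [conjTranspose_mul, conjTranspose_conjTranspose]
    exact eq_neg_of_add_eq_zero_left hW
  have h1 : (1 - (1 / 2 : ℂ) • (U * Uᴴ)) * U'' = U' * A - U * (A * A) - (1 / 2 : ℂ) • (U * H) := by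
    have h2 : Uᴴ * U'' = -H := by
      rw [hU'', Matrix.mul_sub, ← Matrix.mul_assoc, ← Matrix.mul_assoc Uᴴ U, hU, Matrix.one_mul,
        ← hA]
      abel
    rw [Matrix.sub_mul, Matrix.one_mul, Matrix.smul_mul, Matrix.mul_assoc, h2, hU'',
      Matrix.mul_neg, Matrix.mul_add]
    have h3 : U * H = (1 / 2 : ℂ) • (U * H) + (1 / 2 : ℂ) • (U * H) := by
      rw [← add_smul]; norm_num
    nth_rewrite 1 [h3]
    simp only [smul_neg]
    abel
  have hx2 : (trace (Wᴴ * (U * (A * A)))).re = 0 := by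
    rw [← Matrix.mul_assoc]
    exact re_trace_skew_mul_herm hWU (by rw [conjTranspose_mul, hU', neg_mul_neg])
  have hx3 : (trace (Wᴴ * (U * H))).re = 0 := by
    rw [← Matrix.mul_assoc]
    exact re_trace_skew_mul_herm hWU hHh
  have e1 : (stiefel p k).metric U U'' W = (trace (Wᴴ * (U' * A))).re := by
    rw [stiefel_metric_comm]
    simp only [stiefel]
    rw [Matrix.mul_assoc, h1, Matrix.mul_sub, Matrix.mul_sub, Matrix.mul_smul, trace_sub,
      trace_sub, trace_smul, Complex.sub_re, Complex.sub_re, hx2]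
    have : ((1 / 2 : ℂ) • trace (Wᴴ * (U * H))).re = 1 / 2 * (trace (Wᴴ * (U * H))).re := by
      simp
    rw [this, hx3]
    ring
  have e2 : (trace (U'ᴴ * (U' * Uᴴ + U * U'ᴴ) * W)).re = (trace (Wᴴ * (U' * A))).re := by
    rw [← re_trace_conjTranspose]
    have : (U'ᴴ * (U' * Uᴴ + U * U'ᴴ) * W)ᴴ = Wᴴ * U * H + Wᴴ * (U' * A) := by
      simp only [conjTranspose_mul, conjTranspose_add, conjTranspose_conjTranspose, hA, hH]
      simp only [Matrix.mul_add, Matrix.add_mul, Matrix.mul_assoc]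
    rw [this, trace_add, Complex.add_re, re_trace_skew_mul_herm hWU hHh, zero_add]
  have e3 : (trace (U'ᴴ * (W * Uᴴ + U * Wᴴ) * U')).re = -2 * (trace (Wᴴ * (U' * A))).re := by
    have h4 : U'ᴴ * (W * Uᴴ + U * Wᴴ) * U' = (Aᴴ * (Wᴴ * U'))ᴴ + Aᴴ * (Wᴴ * U') := by
      simp only [conjTranspose_mul, conjTranspose_conjTranspose, hA]
      simp only [Matrix.mul_add, Matrix.add_mul, Matrix.mul_assoc]
    have h5 : trace (Aᴴ * (Wᴴ * U')) = -trace (Wᴴ * (U' * A)) := by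
      rw [hU', Matrix.neg_mul, trace_neg, trace_mul_comm, Matrix.mul_assoc]
    rw [h4, trace_add, Complex.add_re, re_trace_conjTranspose, h5, Complex.neg_re]
    ring
  rw [e1, e2, e3]
  ring

/-- The Stiefel manifold, with trivial vertical spaces. -/
def stiefelData (p k : ℕ) : (stiefel p k).RiemannianData PUnit.{1} where
  vert := 0
  vertical_eq θ _ := by ext; simp [stiefel]
  vert_injective θ _ := Function.injective_of_subsingleton _
  vert_mem θ _ κ := by simp [stiefel]
  tangent_add U _ ξ hξ η hη := by
    change Uᴴ * (ξ + η) + (ξ + η)ᴴ * U = 0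
    change Uᴴ * ξ + ξᴴ * U = 0 at hξ
    change Uᴴ * η + ηᴴ * U = 0 at hη
    rw [Matrix.mul_add, conjTranspose_add, Matrix.add_mul, add_add_add_comm, hξ, hη, add_zero]
  metric_add U ξ ξ' η := by simp [stiefel, Matrix.add_mul]
  metric_smul U a ξ η := by simp [stiefel]
  metric_comm := stiefel_metric_comm
  metric_smooth U _ := stiefel_metric_smooth U
  metric_pos U hU ξ _ hne := by
    have h1 := re_trace_conjTranspose_mul_self_nonneg (ξ - U * (Uᴴ * ξ))
    have h2 := re_trace_conjTranspose_mul_self_nonneg (Uᴴ * ξ)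
    rw [stiefel_metric_self hU]
    by_contra hcon
    have h3 : ξ - U * (Uᴴ * ξ) = 0 := eq_zero_of_re_trace (by linarith)
    have h4 : Uᴴ * ξ = 0 := eq_zero_of_re_trace (by linarith)
    rw [h4, Matrix.mul_zero, sub_zero] at h3
    exact hne h3
  deriv_mem γ ξ t hγ hs := by
    have h1 := hγ.matrixConjTranspose.matrixMul hγ
    have h2 : (fun s => (γ s)ᴴ * γ s) =ᶠ[𝓝 t] fun _ => 1 := hs
    have h3 := (h1.congr_of_eventuallyEq h2.symm).unique (hasDerivAt_const t _)
    change (γ t)ᴴ * ξ + ξᴴ * γ t = 0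
    rw [← h3, add_comm]

end Stiefel

end

/-! ### Hermitian positive definite matrices -/

noncomputable section

section Hpd

variable {k : ℕ} {α β : ℝ}

lemma hpd_metric_comm (S ξ η : Matrix (Fin k) (Fin k) ℂ) :
    (hpd k α β).metric S ξ η = (hpd k α β).metric S η ξ := by
  simp only [hpd]
  have h : trace (S⁻¹ * ξ * S⁻¹ * η) = trace (S⁻¹ * η * S⁻¹ * ξ) := by
    rw [Matrix.mul_assoc (S⁻¹ * ξ), trace_mul_comm, Matrix.mul_assoc (S⁻¹ * η)]
  rw [h]
  ring

lemma hpd_metric_smooth {S : Matrix (Fin k) (Fin k) ℂ} (hS : S.PosDef)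
    (ξ η : Matrix (Fin k) (Fin k) ℂ) :
    ContDiffAt ℝ ∞ (fun S => (hpd k α β).metric S ξ η) S := by
  have h : ContDiffAt ℝ ∞ (fun S : Matrix (Fin k) (Fin k) ℂ => S⁻¹) S :=
    contDiffAt_id.matrixInv hS.isUnit
  have hc : ∀ ζ : Matrix (Fin k) (Fin k) ℂ,
      ContDiffAt ℝ ∞ (fun S : Matrix (Fin k) (Fin k) ℂ => S⁻¹ * ζ) S :=
    fun ζ => h.matrixMul contDiffAt_const
  exact (contDiffAt_const.mul (((hc ξ).matrixMul h).matrixMul contDiffAt_const).reTrace).add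
    (contDiffAt_const.mul ((hc ξ).reTrace.mul (hc η).reTrace))

/-- The square root of a positive definite matrix is a Hermitian invertible square root. -/
lemma sqrt_spec {S : Matrix (Fin k) (Fin k) ℂ} (hS : S.PosDef) :
    CFC.sqrt S * CFC.sqrt S = S ∧ (CFC.sqrt S)ᴴ = CFC.sqrt S ∧ IsUnit (CFC.sqrt S).det := by
  have h0 : (0 : Matrix (Fin k) (Fin k) ℂ) ≤ S := Matrix.nonneg_iff_posSemidef.mpr hS.posSemidef
  have h1 : CFC.sqrt S * CFC.sqrt S = S := CFC.sqrt_mul_sqrt_self S h0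
  refine ⟨h1, ?_, ?_⟩
  · exact (Matrix.nonneg_iff_posSemidef.mp (CFC.sqrt_nonneg S)).isHermitian
  · have h2 := (Matrix.isUnit_iff_isUnit_det _).mp hS.isUnit
    rw [← h1, det_mul] at h2
    exact isUnit_of_mul_isUnit_left h2

/-- The Cauchy–Schwarz inequality `(tr Y)² ≤ k tr(Y²)` for Hermitian `Y`. -/
lemma sq_trace_le (hk : 0 < k) {Y : Matrix (Fin k) (Fin k) ℂ} (hY : Yᴴ = Y) :
    (trace Y).re ^ 2 ≤ k * (trace (Y * Y)).re := by
  set c : ℝ := (trace Y).re / k with hc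
  have hk' : (0 : ℝ) < k := by exact_mod_cast hk
  have h := re_trace_conjTranspose_mul_self_nonneg (Y - c • (1 : Matrix (Fin k) (Fin k) ℂ))
  have h1 : (Y - c • (1 : Matrix (Fin k) (Fin k) ℂ))ᴴ * (Y - c • (1 : Matrix (Fin k) (Fin k) ℂ))
      = Y * Y - c • Y - c • Y + (c * c) • 1 := by
    rw [conjTranspose_sub, hY, conjTranspose_smul, conjTranspose_one, star_trivial]
    simp only [Matrix.mul_sub, Matrix.sub_mul, Matrix.smul_mul, Matrix.mul_smul, Matrix.one_mul,
      Matrix.mul_one, smul_sub, smul_smul]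
    abel
  have h2 : (trace Y).re = c * k := by rw [hc]; field_simp
  rw [h1, trace_add, trace_sub, trace_sub, trace_smul, trace_smul, trace_one] at h
  simp only [Complex.add_re, Complex.sub_re, Complex.smul_re, smul_eq_mul, Fintype.card_fin,
    Complex.natCast_re] at h
  rw [h2] at h ⊢
  nlinarith

lemma hpd_metric_pos (hk : 0 < k) (hα : 0 < α) (hβ : -(α / k) < β)
    {S ξ : Matrix (Fin k) (Fin k) ℂ} (hS : S.PosDef) (hξ : ξᴴ = ξ) (hne : ξ ≠ 0) :
    0 < (hpd k α β).metric S ξ ξ := by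
  obtain ⟨h1, h2, h3⟩ := sqrt_spec hS
  set L := CFC.sqrt S
  have hSi : S⁻¹ = L⁻¹ * L⁻¹ := by rw [← h1, Matrix.mul_inv_rev]
  have hLi : (L⁻¹)ᴴ = L⁻¹ := by rw [conjTranspose_nonsing_inv, h2]
  set Y := L⁻¹ * ξ * L⁻¹ with hY
  have hYh : Yᴴ = Y := by simp only [hY, conjTranspose_mul, hLi, hξ, Matrix.mul_assoc]
  have e1 : trace (S⁻¹ * ξ * S⁻¹ * ξ) = trace (Y * Y) := by
    have : S⁻¹ * ξ * S⁻¹ * ξ = L⁻¹ * (L⁻¹ * ξ * L⁻¹ * L⁻¹ * ξ) := by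
      simp only [hSi, Matrix.mul_assoc]
    rw [this, trace_mul_comm]
    simp only [hY, Matrix.mul_assoc]
  have e2 : trace (S⁻¹ * ξ) = trace Y := by
    rw [hSi, Matrix.mul_assoc, trace_mul_comm]
  have hY0 : Y ≠ 0 := by
    intro h0
    apply hne
    have : ξ = L * Y * L := by
      rw [hY, Matrix.mul_assoc L⁻¹, ← Matrix.mul_assoc L, Matrix.mul_nonsing_inv _ h3,
        Matrix.one_mul, Matrix.mul_assoc, Matrix.nonsing_inv_mul _ h3, Matrix.mul_one]
    rw [this, h0]; simp
  have hn : 0 < (trace (Y * Y)).re := by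
    have h4 := re_trace_conjTranspose_mul_self_nonneg Y
    rw [hYh] at h4
    refine lt_of_le_of_ne h4 fun h5 => hY0 (eq_zero_of_re_trace ?_)
    rw [hYh, ← h5]
  have hcs := sq_trace_le hk hYh
  simp only [hpd]
  rw [e1, e2]
  have hk' : (0 : ℝ) < k := by exact_mod_cast hk
  set n := (trace (Y * Y)).re
  set τ := (trace Y).re
  have hβ' : 0 < β * k + α := by
    have h6 := mul_lt_mul_of_pos_right hβ hk'
    have h7 : -(α / k) * k = -α := by field_simp
    linarith
  -- `k (α n + β τ²) = α (k n - τ²) + (α + β k) τ²` is a sum of nonnegative terms.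
  have h8 : 0 < k * (α * n + β * (τ * τ)) := by
    rcases eq_or_ne τ 0 with h0 | h0
    · rw [h0]; simp; positivity
    · have : 0 < τ ^ 2 := by positivity
      nlinarith [mul_nonneg hα.le (sub_nonneg.mpr hcs), mul_pos hβ' this]
  exact pos_of_mul_pos_right h8 hk'.le

lemma hpd_metric_line {S : Matrix (Fin k) (Fin k) ℂ} (hS : IsUnit S)
    (ξ η ζ : Matrix (Fin k) (Fin k) ℂ) :
    HasDerivAt (fun τ : ℝ => (hpd k α β).metric (S + τ • ξ) η ζ)
      (-(α * ((trace (S⁻¹ * ξ * S⁻¹ * η * S⁻¹ * ζ)).re + (trace (S⁻¹ * η * S⁻¹ * ξ * S⁻¹ * ζ)).re)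
        + β * ((trace (S⁻¹ * ξ * S⁻¹ * η)).re * (trace (S⁻¹ * ζ)).re
          + (trace (S⁻¹ * η)).re * (trace (S⁻¹ * ξ * S⁻¹ * ζ)).re))) 0 := by
  have hl : HasDerivAt (fun τ : ℝ => S + τ • ξ) ξ 0 := (hasFDerivAt_id S).hasLineDerivAt ξ
  have hi := hl.matrixInv (by simpa using hS)
  have hη := hi.matrixMul (hasDerivAt_const (0 : ℝ) η)
  have hζ := hi.matrixMul (hasDerivAt_const (0 : ℝ) ζ)
  have h1 := (((hη.matrixMul hi).matrixMul (hasDerivAt_const (0 : ℝ) ζ)).reTrace.const_mul α).add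
    ((hη.reTrace.mul hζ.reTrace).const_mul β)
  refine h1.congr_deriv ?_
  simp only [zero_smul, add_zero, Matrix.mul_zero, Matrix.neg_mul, Matrix.mul_neg, Matrix.add_mul,
    trace_add, trace_neg, Complex.add_re, Complex.neg_re, Matrix.mul_assoc]
  ring

/-- The geodesic equation `S'' = S' S⁻¹ S'` says that the acceleration for the affine invariant
metric vanishes. -/
lemma hpd_acceleration {S S' W : Matrix (Fin k) (Fin k) ℂ} :
    (hpd k α β).metric S (S' * S⁻¹ * S') W
      + -(α * ((trace (S⁻¹ * S' * S⁻¹ * S' * S⁻¹ * W)).re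
            + (trace (S⁻¹ * S' * S⁻¹ * S' * S⁻¹ * W)).re)
        + β * ((trace (S⁻¹ * S' * S⁻¹ * S')).re * (trace (S⁻¹ * W)).re
          + (trace (S⁻¹ * S')).re * (trace (S⁻¹ * S' * S⁻¹ * W)).re))
      - 1 / 2 * -(α * ((trace (S⁻¹ * W * S⁻¹ * S' * S⁻¹ * S')).re
            + (trace (S⁻¹ * S' * S⁻¹ * W * S⁻¹ * S')).re)
        + β * ((trace (S⁻¹ * W * S⁻¹ * S')).re * (trace (S⁻¹ * S')).re
          + (trace (S⁻¹ * S')).re * (trace (S⁻¹ * W * S⁻¹ * S')).re)) = 0 := by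
  have e1 : trace (S⁻¹ * W * S⁻¹ * S' * S⁻¹ * S') = trace (S⁻¹ * S' * S⁻¹ * S' * S⁻¹ * W) := by
    rw [show S⁻¹ * W * S⁻¹ * S' * S⁻¹ * S' = (S⁻¹ * W) * (S⁻¹ * S' * S⁻¹ * S') by
      simp only [Matrix.mul_assoc], trace_mul_comm]
    simp only [Matrix.mul_assoc]
  have e2 : trace (S⁻¹ * S' * S⁻¹ * W * S⁻¹ * S') = trace (S⁻¹ * S' * S⁻¹ * S' * S⁻¹ * W) := by
    rw [show S⁻¹ * S' * S⁻¹ * W * S⁻¹ * S' = (S⁻¹ * S' * S⁻¹ * W) * (S⁻¹ * S') by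
      simp only [Matrix.mul_assoc], trace_mul_comm]
    simp only [Matrix.mul_assoc]
  have e3 : trace (S⁻¹ * W * S⁻¹ * S') = trace (S⁻¹ * S' * S⁻¹ * W) := by
    rw [show S⁻¹ * W * S⁻¹ * S' = (S⁻¹ * W) * (S⁻¹ * S') by
      simp only [Matrix.mul_assoc], trace_mul_comm]
    simp only [Matrix.mul_assoc]
  simp only [hpd, ← Matrix.mul_assoc]
  rw [e1, e2, e3]
  ring

lemma hpd_deriv_mem {γ : ℝ → Matrix (Fin k) (Fin k) ℂ} {ξ : Matrix (Fin k) (Fin k) ℂ} {t : ℝ}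
    (hγ : HasDerivAt γ ξ t) (hs : ∀ᶠ s in 𝓝 t, (γ s).PosDef) : ξᴴ = ξ :=
  (hγ.matrixConjTranspose.congr_of_eventuallyEq
    (hs.mono fun _ h => h.isHermitian.symm)).unique hγ

lemma hpd_metric_add (S ξ ξ' η : Matrix (Fin k) (Fin k) ℂ) :
    (hpd k α β).metric S (ξ + ξ') η = (hpd k α β).metric S ξ η + (hpd k α β).metric S ξ' η := by
  simp only [hpd, Matrix.mul_add, Matrix.add_mul, trace_add, Complex.add_re]
  ring

lemma hpd_metric_smul (S : Matrix (Fin k) (Fin k) ℂ) (a : ℝ) (ξ η : Matrix (Fin k) (Fin k) ℂ) :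
    (hpd k α β).metric S (a • ξ) η = a * (hpd k α β).metric S ξ η := by
  simp only [hpd, Matrix.mul_smul, Matrix.smul_mul, trace_smul, Complex.smul_re, smul_eq_mul]
  ring

/-- The manifold of positive definite matrices, with trivial vertical spaces. -/
def hpdData (hk : 0 < k) (hα : 0 < α) (hβ : -(α / k) < β) :
    (hpd k α β).RiemannianData PUnit.{1} where
  vert := 0
  vertical_eq θ _ := by ext; simp [hpd]
  vert_injective θ _ := Function.injective_of_subsingleton _
  vert_mem θ _ κ := Matrix.isHermitian_zero
  tangent_add _ _ ξ hξ η hη := Matrix.IsHermitian.add hξ hη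
  metric_add := hpd_metric_add
  metric_smul := hpd_metric_smul
  metric_comm := hpd_metric_comm
  metric_smooth _ hS := hpd_metric_smooth hS
  metric_pos _ hS _ hξ hne := hpd_metric_pos hk hα hβ hS hξ hne
  deriv_mem _ _ _ hγ hs := hpd_deriv_mem hγ hs

end Hpd

/-! ### The quotient of the product -/

section RankQuotient

variable {p k : ℕ} {α β : ℝ}

/-- The skew-Hermitian matrices: the Lie algebra of the unitary group. -/
def skewHermitian (k : ℕ) : Submodule ℝ (Matrix (Fin k) (Fin k) ℂ) where
  carrier := {Ω | Ωᴴ = -Ω}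
  add_mem' {a b} ha hb := by
    change (a + b)ᴴ = -(a + b)
    rw [conjTranspose_add, ha, hb, neg_add]
  zero_mem' := by simp
  smul_mem' c a ha := by
    change (c • a)ᴴ = -(c • a)
    rw [conjTranspose_smul, ha, star_trivial, smul_neg]

/-- The vertical vector `(U Ω, Σ Ω - Ω Σ)` at `(U, Σ)`. -/
def rankVert (p k : ℕ) : (Matrix (Fin p) (Fin k) ℂ × Matrix (Fin k) (Fin k) ℂ) →L[ℝ]
    skewHermitian k →L[ℝ] (Matrix (Fin p) (Fin k) ℂ × Matrix (Fin k) (Fin k) ℂ) :=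
  bilinToCLM (LinearMap.mk₂ ℝ (fun θ Ω => (θ.1 * Ω.1, θ.2 * Ω.1 - Ω.1 * θ.2))
    (fun θ θ' Ω => by
      ext1
      · simp [Matrix.add_mul]
      · simp only [Prod.snd_add, Matrix.add_mul, Matrix.mul_add]; abel)
    (fun c θ Ω => by ext1 <;> simp [smul_sub])
    (fun θ Ω Ω' => by
      ext1
      · simp [Matrix.mul_add]
      · simp only [Submodule.coe_add, Prod.mk_add_mk, Matrix.add_mul, Matrix.mul_add]; abel)
    (fun c θ Ω => by ext1 <;> simp [smul_sub]))

lemma hasDerivAt_fst_of_prod {E F : Type*} [NormedAddCommGroup E] [NormedSpace ℝ E]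
    [NormedAddCommGroup F] [NormedSpace ℝ F] {γ : ℝ → E × F} {ξ : E × F} {t : ℝ}
    (h : HasDerivAt γ ξ t) : HasDerivAt (fun s => (γ s).1) ξ.1 t := h.fst

lemma hasDerivAt_snd_of_prod {E F : Type*} [NormedAddCommGroup E] [NormedSpace ℝ E]
    [NormedAddCommGroup F] [NormedSpace ℝ F] {γ : ℝ → E × F} {ξ : E × F} {t : ℝ}
    (h : HasDerivAt γ ξ t) : HasDerivAt (fun s => (γ s).2) ξ.2 t := h.snd

lemma ContDiffAt.comp_fst_of_eq {E F H : Type*} [NormedAddCommGroup E] [NormedSpace ℝ E]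
    [NormedAddCommGroup F] [NormedSpace ℝ F] [NormedAddCommGroup H] [NormedSpace ℝ H] {r : ℕ∞ω}
    {f : E → H} {x : E} {z : E × F} (hf : ContDiffAt ℝ r f x) (hz : z.1 = x) :
    ContDiffAt ℝ r (fun y : E × F => f y.1) z := by
  subst hz
  exact hf.comp z contDiffAt_fst

lemma ContDiffAt.comp_snd_of_eq {E F H : Type*} [NormedAddCommGroup E] [NormedSpace ℝ E]
    [NormedAddCommGroup F] [NormedSpace ℝ F] [NormedAddCommGroup H] [NormedSpace ℝ H] {r : ℕ∞ω}
    {f : F → H} {x : F} {z : E × F} (hf : ContDiffAt ℝ r f x) (hz : z.2 = x) :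
    ContDiffAt ℝ r (fun y : E × F => f y.2) z := by
  subst hz
  exact hf.comp z contDiffAt_snd

/-- The quotient manifold; the vertical spaces are parametrized by the Lie algebra of the unitary
group. -/
def rankData (p : ℕ) (hk : 0 < k) (hα : 0 < α) (hβ : -(α / k) < β) :
    (rankQuotient p k α β).RiemannianData (skewHermitian k) where
  vert := rankVert p k
  vertical_eq θ _ := by
    ext ζ
    constructor
    · rintro ⟨Ω, hΩ, rfl⟩
      exact ⟨⟨Ω, hΩ⟩, rfl⟩
    · rintro ⟨Ω, rfl⟩
      exact ⟨Ω.1, Ω.2, rfl⟩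
  vert_injective θ hθ Ω Ω' h := by
    have h1 : θ.1 * Ω.1 = θ.1 * Ω'.1 := congrArg Prod.fst h
    have h2 : θ.1ᴴ * θ.1 = 1 := hθ.1
    have h3 := congrArg (fun B => θ.1ᴴ * B) h1
    simp only [← Matrix.mul_assoc, h2, Matrix.one_mul] at h3
    exact Subtype.ext h3
  vert_mem θ hθ Ω := by
    have hΩ : Ω.1ᴴ = -Ω.1 := Ω.2
    have h1 : θ.1ᴴ * θ.1 = 1 := hθ.1
    have h2 : θ.2ᴴ = θ.2 := Matrix.PosDef.isHermitian hθ.2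
    constructor
    · change θ.1ᴴ * (θ.1 * Ω.1) + (θ.1 * Ω.1)ᴴ * θ.1 = 0
      rw [conjTranspose_mul, Matrix.mul_assoc (Ω.1)ᴴ, ← Matrix.mul_assoc θ.1ᴴ θ.1, h1, hΩ]
      simp
    · change (θ.2 * Ω.1 - Ω.1 * θ.2)ᴴ = θ.2 * Ω.1 - Ω.1 * θ.2
      rw [conjTranspose_sub, conjTranspose_mul, conjTranspose_mul, hΩ, h2]
      simp only [Matrix.neg_mul, Matrix.mul_neg]
      abel
  tangent_add θ hθ ξ hξ η hη :=
    ⟨(stiefelData p k).tangent_add _ hθ.1 _ hξ.1 _ hη.1,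
      (hpdData hk hα hβ).tangent_add _ hθ.2 _ hξ.2 _ hη.2⟩
  metric_add θ ξ ξ' η := by
    have h1 := (stiefelData p k).metric_add θ.1 ξ.1 ξ'.1 η.1
    have h2 := hpd_metric_add (α := α) (β := β) θ.2 ξ.2 ξ'.2 η.2
    simp only [rankQuotient, Prod.fst_add, Prod.snd_add, h1, h2]
    ring
  metric_smul θ a ξ η := by
    have h1 := (stiefelData p k).metric_smul θ.1 a ξ.1 η.1
    have h2 := hpd_metric_smul (α := α) (β := β) θ.2 a ξ.2 η.2
    simp only [rankQuotient, Prod.smul_fst, Prod.smul_snd, h1, h2]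
    ring
  metric_comm θ ξ η := by
    simp only [rankQuotient]
    rw [stiefel_metric_comm, hpd_metric_comm]
  metric_smooth θ hθ ξ η := by
    have h1 := stiefel_metric_smooth θ.1 ξ.1 η.1
    have hS : θ.2.PosDef := hθ.2
    have h2 := hpd_metric_smooth (α := α) (β := β) hS ξ.2 η.2
    exact (h1.comp_fst_of_eq rfl).add (h2.comp_snd_of_eq rfl)
  metric_pos θ hθ ξ hξ hne := by
    have h1 : ξ.1 ≠ 0 → 0 < (stiefel p k).metric θ.1 ξ.1 ξ.1 :=
      (stiefelData p k).metric_pos _ hθ.1 _ hξ.1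
    have h2 : ξ.2 ≠ 0 → 0 < (hpd k α β).metric θ.2 ξ.2 ξ.2 :=
      (hpdData hk hα hβ).metric_pos _ hθ.2 _ hξ.2
    have h3 : ξ.1 = 0 → (stiefel p k).metric θ.1 ξ.1 ξ.1 = 0 := fun h => by simp [stiefel, h]
    have h4 : ξ.2 = 0 → (hpd k α β).metric θ.2 ξ.2 ξ.2 = 0 := fun h => by simp [hpd, h]
    change 0 < (stiefel p k).metric θ.1 ξ.1 ξ.1 + (hpd k α β).metric θ.2 ξ.2 ξ.2
    by_cases h5 : ξ.1 = 0
    · have h6 : ξ.2 ≠ 0 := fun h => hne (Prod.ext h5 h)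
      rw [h3 h5, zero_add]
      exact h2 h6
    · by_cases h6 : ξ.2 = 0
      · rw [h4 h6, add_zero]
        exact h1 h5
      · exact add_pos (h1 h5) (h2 h6)
  deriv_mem γ ξ t hγ hs := by
    have h1 := hasDerivAt_fst_of_prod hγ
    have h2 := hasDerivAt_snd_of_prod hγ
    exact ⟨(stiefelData p k).deriv_mem (fun s => (γ s).1) ξ.1 t h1 (hs.mono fun _ h => h.1),
      (hpdData hk hα hβ).deriv_mem (fun s => (γ s).2) ξ.2 t h2 (hs.mono fun _ h => h.2)⟩

end RankQuotient

end

/-! ### The two explicit curves -/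

noncomputable section

section Curves

lemma exp_neg_mul_exp {n : Type*} [Fintype n] [DecidableEq n] (X : Matrix n n ℂ) :
    NormedSpace.exp (-X) * NormedSpace.exp X = 1 := by
  rw [Matrix.exp_neg]
  exact Matrix.nonsing_inv_mul _ ((Matrix.isUnit_iff_isUnit_det _).mp (Matrix.isUnit_exp X))

/-- If `M X = 0` then `M exp(t X) = M`. -/
lemma mul_exp_eq_self {l n : Type*} [Fintype l] [Fintype n] [DecidableEq n] {M : Matrix l n ℂ}
    {X : Matrix n n ℂ} (h : M * X = 0) (t : ℝ) : M * NormedSpace.exp (t • X) = M := by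
  have hd : ∀ s : ℝ, HasDerivAt (fun s : ℝ => M * NormedSpace.exp (s • X)) 0 s := fun s => by
    have hc : Commute X (NormedSpace.exp (s • X)) := ((Commute.refl X).smul_right s).exp_right
    have h1 := (hasDerivAt_const s M).matrixMul (hasDerivAt_matrixExp X s)
    refine h1.congr_deriv ?_
    rw [← hc.eq, ← Matrix.mul_assoc, h]
    simp
  have h2 := is_const_of_deriv_eq_zero (fun s => (hd s).differentiableAt)
    (fun s => (hd s).deriv) t 0
  simpa [NormedSpace.exp_zero] using h2

variable {p k m : ℕ}

/-- The Stiefel curve `U(t)` is smooth, stays on the manifold, satisfies the geodesic equation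
`U'' = U' A - U (A² + U'ᴴ U')`, and keeps `A = Uᴴ U'` constant. The columns of `Q` need not be
orthogonal to those of `U`; but `Q` may be replaced by `(1 - U Uᴴ) Q` without changing the curve,
because `Uᴴ Q R = 0`, and the blocks then decouple. -/
lemma stiefelCurve_spec {U ξ : Matrix (Fin p) (Fin k) ℂ} {Q : Matrix (Fin p) (Fin m) ℂ}
    {R : Matrix (Fin m) (Fin k) ℂ} (hU : Uᴴ * U = 1) (hξ : Uᴴ * ξ + ξᴴ * U = 0)
    (hQ : Qᴴ * Q = 1) (hQR : Q * R = (1 - U * Uᴴ) * ξ) :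
    ∃ c' c'' : ℝ → Matrix (Fin p) (Fin k) ℂ,
      (∀ t, HasDerivAt (stiefelCurve U ξ Q R) (c' t) t) ∧ (∀ t, HasDerivAt c' (c'' t) t) ∧
      stiefelCurve U ξ Q R 0 = U ∧ c' 0 = ξ ∧
      (∀ t, (stiefelCurve U ξ Q R t)ᴴ * stiefelCurve U ξ Q R t = 1) ∧
      (∀ t, (stiefelCurve U ξ Q R t)ᴴ * c' t = Uᴴ * ξ) ∧
      (∀ t, c'' t = c' t * (Uᴴ * ξ)
        - stiefelCurve U ξ Q R t * (Uᴴ * ξ * (Uᴴ * ξ) + (c' t)ᴴ * c' t)) := by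
  set A := Uᴴ * ξ with hA
  have hAs : Aᴴ = -A := by
    rw [hA, conjTranspose_mul, conjTranspose_conjTranspose]
    exact eq_neg_of_add_eq_zero_right hξ
  have hUQR : Uᴴ * (Q * R) = 0 := by
    rw [hQR, ← Matrix.mul_assoc, Matrix.mul_sub, ← Matrix.mul_assoc, hU]
    simp
  set X : Matrix (Fin k ⊕ Fin m) (Fin k ⊕ Fin m) ℂ := fromBlocks A (-Rᴴ) R 0 with hX
  set e : Matrix (Fin k ⊕ Fin m) (Fin k) ℂ := fromRows 1 0 with he
  set Q' := Q - U * (Uᴴ * Q) with hQ'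
  set Y := fromCols U Q' with hY
  have hcurve : ∀ t, stiefelCurve U ξ Q R t = Y * NormedSpace.exp (t • X) * e := by
    intro t
    have h1 : fromCols U Q = Y + fromCols 0 (U * (Uᴴ * Q)) := by
      rw [hY, hQ']
      ext i (j | j) <;> simp
    have h2 : fromCols (0 : Matrix (Fin p) (Fin k) ℂ) (U * (Uᴴ * Q)) * X = 0 := by
      rw [hX, fromCols_mul_fromBlocks]
      have : U * (Uᴴ * Q) * R = 0 := by
        rw [Matrix.mul_assoc, Matrix.mul_assoc, hUQR, Matrix.mul_zero]
      simp [this]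
    have h3 : fromCols (0 : Matrix (Fin p) (Fin k) ℂ) (U * (Uᴴ * Q)) * e = 0 := by
      rw [he, fromCols_mul_fromRows]; simp
    change fromCols U Q * NormedSpace.exp (t • X) * e = _
    rw [h1, Matrix.add_mul, mul_exp_eq_self h2, Matrix.add_mul, h3, add_zero]
  have hXs : Xᴴ = -X := by
    rw [hX, fromBlocks_conjTranspose, hAs, fromBlocks_neg]
    simp
  have hUQ' : Uᴴ * Q' = 0 := by
    rw [hQ', Matrix.mul_sub, ← Matrix.mul_assoc, hU, Matrix.one_mul, sub_self]
  have hQ'R : Q' * R = Q * R := by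
    rw [hQ', Matrix.sub_mul, Matrix.mul_assoc, Matrix.mul_assoc, hUQR, Matrix.mul_zero, sub_zero]
  have hQQR : Q'ᴴ * Q' * R = R := by
    rw [Matrix.mul_assoc, hQ'R, hQ', conjTranspose_sub, Matrix.sub_mul, ← Matrix.mul_assoc, hQ,
      Matrix.one_mul]
    simp only [conjTranspose_mul, conjTranspose_conjTranspose, Matrix.mul_assoc, hUQR,
      Matrix.mul_zero, sub_zero]
  set M := Yᴴ * Y with hM
  have hMb : M = fromBlocks 1 0 0 (Q'ᴴ * Q') := by
    have h1 : Q'ᴴ * U = 0 := by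
      rw [← conjTranspose_conjTranspose U, ← conjTranspose_mul, hUQ', conjTranspose_zero]
    rw [hM, hY, conjTranspose_fromCols_eq_fromRows_conjTranspose, fromRows_mul_fromCols, hU, hUQ',
      h1]
  -- `Q'` is an isometry on the range of `R`, because `Q' R = Q R`.
  have hMX : M * X = X := by
    rw [hMb, hX, fromBlocks_multiply]
    simp [hQQR]
  have hXM : X * M = X := by
    have h1 : Mᴴ = M := by rw [hM, conjTranspose_mul, conjTranspose_conjTranspose]
    have h2 := congrArg conjTranspose hMX
    rw [conjTranspose_mul, hXs, h1, Matrix.neg_mul] at h2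
    exact neg_injective h2
  -- `exp(t X)` is unitary and commutes with the Gram matrix `M` of `Y`.
  have hG : ∀ t : ℝ, (Y * NormedSpace.exp (t • X))ᴴ * (Y * NormedSpace.exp (t • X)) = M := by
    intro t
    have hc : Commute M (NormedSpace.exp (t • X)) := by
      have : Commute M X := hMX.trans hXM.symm
      exact (this.smul_right t).exp_right
    rw [conjTranspose_mul, ← exp_conjTranspose, conjTranspose_smul, hXs, star_trivial, smul_neg,
      Matrix.mul_assoc, ← Matrix.mul_assoc Yᴴ, ← hM, hc.eq, ← Matrix.mul_assoc, exp_neg_mul_exp,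
      Matrix.one_mul]
  have heM : eᴴ * M = eᴴ := by
    rw [hMb, he, conjTranspose_fromRows_eq_fromCols_conjTranspose, fromCols_mul_fromBlocks]
    simp
  have hee : eᴴ * e = 1 := by
    rw [he, conjTranspose_fromRows_eq_fromCols_conjTranspose, fromCols_mul_fromRows]
    simp
  have hXe : X * e = fromRows A R := by
    rw [hX, he, fromBlocks_mul_fromRows]; simp
  have heX : eᴴ * (X * e) = A := by
    rw [hXe, he, conjTranspose_fromRows_eq_fromCols_conjTranspose, fromCols_mul_fromRows]
    simp
  have hXXe : X * (X * e) = fromRows (A * A - Rᴴ * R) (R * A) := by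
    rw [hXe, hX, fromBlocks_mul_fromRows]
    simp [sub_eq_add_neg]
  set Z : ℝ → Matrix (Fin p) (Fin k ⊕ Fin m) ℂ := fun t => Y * NormedSpace.exp (t • X) with hZ
  have hZd : ∀ t, HasDerivAt Z (Z t * X) t := fun t => by
    have h1 := (hasDerivAt_const t Y).matrixMul (hasDerivAt_matrixExp X t)
    refine h1.congr_deriv ?_
    rw [Matrix.zero_mul, zero_add, ← Matrix.mul_assoc]
  have hZe : ∀ (B : Matrix (Fin k ⊕ Fin m) (Fin k) ℂ) t,
      HasDerivAt (fun t => Z t * B) (Z t * (X * B)) t := fun B t => by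
    have h1 := (hZd t).matrixMul (hasDerivAt_const t B)
    refine h1.congr_deriv ?_
    rw [Matrix.mul_zero, add_zero, Matrix.mul_assoc]
  have hZZ : ∀ (B C : Matrix (Fin k ⊕ Fin m) (Fin k) ℂ) t, (Z t * B)ᴴ * (Z t * C) = Bᴴ * (M * C) :=
    fun B C t => by
      rw [conjTranspose_mul, Matrix.mul_assoc, ← Matrix.mul_assoc (Z t)ᴴ, hG]
  have hZ0 : ∀ B : Matrix (Fin k ⊕ Fin m) (Fin k) ℂ, Z 0 * B = Y * B := fun B => by
    simp [hZ, NormedSpace.exp_zero]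
  have hfun : stiefelCurve U ξ Q R = fun t => Z t * e := funext hcurve
  rw [hfun]
  refine ⟨fun t => Z t * (X * e), fun t => Z t * (X * (X * e)), fun t => hZe e t,
    fun t => hZe (X * e) t, ?_, ?_, fun t => ?_, fun t => ?_, fun t => ?_⟩
  · simp only [hZ0]
    rw [hY, he, fromCols_mul_fromRows]; simp
  · simp only [hZ0]
    rw [hXe, hY, fromCols_mul_fromRows, hQ'R, hQR, hA, Matrix.sub_mul, Matrix.one_mul,
      Matrix.mul_assoc]
    abel
  · simp only [hZZ]
    rw [← Matrix.mul_assoc, heM, hee]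
  · simp only [hZZ]
    rw [← Matrix.mul_assoc, heM, heX]
  · simp only [hZZ]
    rw [← Matrix.mul_assoc M, hMX, conjTranspose_mul, hXs, Matrix.mul_neg, Matrix.neg_mul,
      Matrix.mul_assoc (Z t), Matrix.mul_assoc (Z t), ← Matrix.mul_sub]
    congr 1
    have h1 : eᴴ * X * (X * e) = A * A - Rᴴ * R := by
      rw [Matrix.mul_assoc, hXXe, he, conjTranspose_fromRows_eq_fromCols_conjTranspose,
        fromCols_mul_fromRows]
      simp
    rw [h1, hXXe, hXe, he, fromRows_mul, fromRows_mul]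
    ext (i | i) j <;> simp

/-- The curve `Σ(t)` is smooth, stays positive definite, satisfies the geodesic equation
`Σ'' = Σ' Σ⁻¹ Σ'`, and keeps `Σ⁻¹ Σ'` and `Σ' Σ⁻¹` constant. -/
lemma hpdCurve_spec {S ξ : Matrix (Fin k) (Fin k) ℂ} (hS : S.PosDef) (hξ : ξᴴ = ξ) :
    ∃ c' : ℝ → Matrix (Fin k) (Fin k) ℂ,
      (∀ t, HasDerivAt (hpdCurve S ξ) (c' t) t) ∧
      (∀ t, HasDerivAt c' (c' t * (hpdCurve S ξ t)⁻¹ * c' t) t) ∧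
      hpdCurve S ξ 0 = S ∧ c' 0 = ξ ∧ (∀ t, (hpdCurve S ξ t).PosDef) ∧
      (∀ t, (hpdCurve S ξ t)⁻¹ * c' t = S⁻¹ * ξ) ∧
      (∀ t, c' t * (hpdCurve S ξ t)⁻¹ = ξ * S⁻¹) := by
  obtain ⟨h1, h2, h3⟩ := sqrt_spec hS
  have hcurve : ∀ t, hpdCurve S ξ t = CFC.sqrt S *
    NormedSpace.exp (t • ((CFC.sqrt S)⁻¹ * ξ * (CFC.sqrt S)⁻¹)) * CFC.sqrt S := fun _ => rfl
  have hfun : hpdCurve S ξ = fun t => CFC.sqrt S *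
    NormedSpace.exp (t • ((CFC.sqrt S)⁻¹ * ξ * (CFC.sqrt S)⁻¹)) * CFC.sqrt S := rfl
  generalize CFC.sqrt S = L at *
  have hLL : L * L⁻¹ = 1 := Matrix.mul_nonsing_inv _ h3
  have hLL' : L⁻¹ * L = 1 := Matrix.nonsing_inv_mul _ h3
  have hSi : S⁻¹ = L⁻¹ * L⁻¹ := by rw [← h1, Matrix.mul_inv_rev]
  have hLi : (L⁻¹)ᴴ = L⁻¹ := by rw [conjTranspose_nonsing_inv, h2]
  set X := L⁻¹ * ξ * L⁻¹ with hX
  have hXs : Xᴴ = X := by simp only [hX, conjTranspose_mul, hLi, hξ, Matrix.mul_assoc]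
  have hcomm : ∀ t : ℝ, X * NormedSpace.exp (t • X) = NormedSpace.exp (t • X) * X := fun t =>
    ((Commute.refl X).smul_right t).exp_right.eq
  have hu : ∀ t : ℝ, IsUnit (NormedSpace.exp (t • X)).det := fun t =>
    (Matrix.isUnit_iff_isUnit_det _).mp (Matrix.isUnit_exp _)
  have hd : ∀ B t, HasDerivAt (fun t : ℝ => L * NormedSpace.exp (t • X) * B)
      (L * NormedSpace.exp (t • X) * (X * B)) t := fun B t => by
    have h4 := ((hasDerivAt_const t L).matrixMul (hasDerivAt_matrixExp X t)).matrixMul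
      (hasDerivAt_const t B)
    refine h4.congr_deriv ?_
    simp only [Matrix.zero_mul, zero_add, Matrix.mul_zero, add_zero, Matrix.mul_assoc]
  have hinv : ∀ t, (hpdCurve S ξ t)⁻¹ = L⁻¹ * ((NormedSpace.exp (t • X))⁻¹ * L⁻¹) := fun t => by
    rw [hcurve, Matrix.mul_inv_rev, Matrix.mul_inv_rev]
  have hl : ∀ t, (hpdCurve S ξ t)⁻¹ * (L * NormedSpace.exp (t • X) * (X * L)) = L⁻¹ * (X * L) := by
    intro t
    rw [hinv, Matrix.mul_assoc, Matrix.mul_assoc, Matrix.mul_assoc L, ← Matrix.mul_assoc L⁻¹ L,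
      hLL', Matrix.one_mul, ← Matrix.mul_assoc (NormedSpace.exp (t • X))⁻¹,
      Matrix.nonsing_inv_mul _ (hu t), Matrix.one_mul]
  have hXL : X * L = L⁻¹ * ξ := by
    rw [hX, Matrix.mul_assoc, hLL', Matrix.mul_one]
  refine ⟨fun t => L * NormedSpace.exp (t • X) * (X * L), fun t => ?_, fun t => ?_, ?_, ?_,
    fun t => ?_, fun t => ?_, fun t => ?_⟩
  · rw [hfun]; exact hd L t
  · refine (hd (X * L) t).congr_deriv ?_
    rw [Matrix.mul_assoc (L * NormedSpace.exp (t • X) * (X * L)), hl, Matrix.mul_assoc _ (X * L),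
      Matrix.mul_assoc X L, ← Matrix.mul_assoc L, hLL, Matrix.one_mul]
  · rw [hcurve, zero_smul, NormedSpace.exp_zero, Matrix.mul_one, h1]
  · simp only [zero_smul, NormedSpace.exp_zero, Matrix.mul_one]
    rw [hXL, ← Matrix.mul_assoc, hLL, Matrix.one_mul]
  · -- `exp(t X) = exp(t/2 X)ᴴ exp(t/2 X)`
    have h4 : NormedSpace.exp (t • X)
        = NormedSpace.exp ((t / 2) • X) * NormedSpace.exp ((t / 2) • X) := by
      rw [← Matrix.exp_add_of_commute _ _ (Commute.refl _), ← add_smul, add_halves]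
    have h5 : (NormedSpace.exp ((t / 2) • X))ᴴ = NormedSpace.exp ((t / 2) • X) := by
      rw [← exp_conjTranspose, conjTranspose_smul, hXs, star_trivial]
    have h6 : hpdCurve S ξ t
        = (NormedSpace.exp ((t / 2) • X) * L)ᴴ * (NormedSpace.exp ((t / 2) • X) * L) := by
      rw [hcurve, h4, conjTranspose_mul, h5, h2]
      simp only [Matrix.mul_assoc]
    rw [h6]
    refine PosDef.conjTranspose_mul_self _ (Matrix.mulVec_injective_of_isUnit ?_)
    rw [Matrix.isUnit_iff_isUnit_det, det_mul]
    exact (hu _).mul h3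
  · rw [hl, hXL, hSi, Matrix.mul_assoc]
  · rw [hinv]
    have h4 : L * NormedSpace.exp (t • X) * (X * L) * (L⁻¹ * ((NormedSpace.exp (t • X))⁻¹ * L⁻¹))
        = L * (NormedSpace.exp (t • X) * X * (L * L⁻¹) * (NormedSpace.exp (t • X))⁻¹) * L⁻¹ := by
      simp only [Matrix.mul_assoc]
    rw [h4, hLL, Matrix.mul_one, ← hcomm, Matrix.mul_assoc X, Matrix.mul_nonsing_inv _ (hu t),
      Matrix.mul_one, hX, hSi, ← Matrix.mul_assoc L, ← Matrix.mul_assoc L, hLL, Matrix.one_mul,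
      Matrix.mul_assoc]

end Curves

end

/-! ### The curves are geodesics -/

noncomputable section

namespace Submersion.RiemannianData

variable {E X K : Type*} [NormedAddCommGroup E] [NormedSpace ℝ E]
  [NormedAddCommGroup K] [NormedSpace ℝ K] [FiniteDimensional ℝ E] [FiniteDimensional ℝ K]
  {G : Submersion E X}

lemma acceleration_eq (D : RiemannianData G K) {γ γ' : ℝ → E} {γ'' W : E} {t a b : ℝ}
    (ht : γ t ∈ G.total) (h1 : ∀ s, HasDerivAt γ (γ' s) s) (h2 : HasDerivAt γ' γ'' t)
    (ha : HasDerivAt (fun τ : ℝ => G.metric (γ t + τ • γ' t) (γ' t) W) a 0)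
    (hb : HasDerivAt (fun τ : ℝ => G.metric (γ t + τ • W) (γ' t) (γ' t)) b 0) :
    D.acceleration γ t W = G.metric (γ t) γ'' W + a - 1 / 2 * b := by
  have h3 : deriv γ = γ' := funext fun s => (h1 s).deriv
  rw [acceleration, h3, h2.deriv, D.fderiv_form_eq ht ha, D.fderiv_form_eq ht hb]

/-- A horizontal curve in the total space without tangential acceleration projects to a geodesic,
provided that any other lift of its projection can be moved to it along the fibres. -/
theorem isGeodesicOn_of_horizontal (D : RiemannianData G K) {γ : ℝ → E}
    (hγ : ∀ t, ContDiffAt ℝ ∞ γ t) (htot : ∀ t, γ t ∈ G.total)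
    (hhor : ∀ t, deriv γ t ∈ G.horizontal (γ t))
    (hacc : ∀ t, ∀ W ∈ G.tangent (γ t), D.acceleration γ t W = 0)
    (hgauge : ∀ t, ∀ δ : ℝ → E, ContDiffAt ℝ ∞ δ t →
      (∀ᶠ s in 𝓝 t, δ s ∈ G.total ∧ G.proj (δ s) = G.proj (γ s)) →
      ∃ ρ : ℝ → E →L[ℝ] E, ContDiffAt ℝ ∞ ρ t ∧ (∀ᶠ s in 𝓝 t, D.IsGaugeAt ρ s) ∧
        ∀ᶠ s in 𝓝 t, ρ s (δ s) = γ s) :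
    G.IsGeodesicOn (fun t => G.proj (γ t)) univ := by
  refine fun t _ => ⟨⟨γ, hγ t, .of_forall fun s => ⟨htot s, rfl⟩⟩, ?_⟩
  intro d σ V hσ x hx hxV w
  have hxV' := hxV.mono fun s hs => hs.1
  have hδ : ContDiffAt ℝ ∞ (fun s => σ (x s)) t :=
    (hσ.smooth.contDiffAt (hσ.isOpen.mem_nhds hxV'.self_of_nhds)).comp t hx
  obtain ⟨ρ, hρ, hg, hργ⟩ := hgauge t _ hδ (hxV.mono fun s hs => ⟨hσ.mapsTo hs.1, hs.2⟩)
  exact D.coordMetric_add_christoffel_eq_zero hσ hx hxV' hρ hg hργ (hγ t)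
    (.of_forall hhor) (hacc t) w

/-- The case of a submanifold, without any fibres. -/
theorem isGeodesicOn_of_acceleration {G : Submersion E E} (D : RiemannianData G K)
    (hproj : G.proj = id) {γ : ℝ → E} (hvert : ∀ t, G.vertical (γ t) = {0})
    (hγ : ∀ t, ContDiffAt ℝ ∞ γ t) (htot : ∀ t, γ t ∈ G.total)
    (hacc : ∀ t, ∀ W ∈ G.tangent (γ t), D.acceleration γ t W = 0) : G.IsGeodesicOn γ univ := by
  have h := D.isGeodesicOn_of_horizontal hγ htot (fun t => ⟨?_, ?_⟩) hacc (fun t δ hδ hs => ?_)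
  · simpa [hproj] using h
  · exact D.deriv_mem γ _ t ((hγ t).differentiableAt (by simp)).hasDerivAt (.of_forall htot)
  · intro ζ hζ
    rw [hvert] at hζ
    rw [hζ, ← D.form_apply, map_zero]
  · refine ⟨fun _ => ContinuousLinearMap.id ℝ E, contDiffAt_const, .of_forall fun s =>
      ⟨fun θ hθ => hθ, fun θ _ ξ η => rfl, fun θ hθ κ => D.vert_mem_vertical hθ κ,
        0, fun θ => by simp⟩, hs.mono fun s h => ?_⟩
    simpa [hproj] using h.2

end Submersion.RiemannianData

section Factors

variable {p k m : ℕ} {α β : ℝ}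

lemma contDiffAt_stiefelCurve (U : Matrix (Fin p) (Fin k) ℂ) (ξ : Matrix (Fin p) (Fin k) ℂ)
    (Q : Matrix (Fin p) (Fin m) ℂ) (R : Matrix (Fin m) (Fin k) ℂ) (t : ℝ) :
    ContDiffAt ℝ ∞ (stiefelCurve U ξ Q R) t :=
  (contDiffAt_const.matrixMul (contDiff_matrixExp _).contDiffAt).matrixMul contDiffAt_const

lemma contDiffAt_hpdCurve (S ξ : Matrix (Fin k) (Fin k) ℂ) (t : ℝ) :
    ContDiffAt ℝ ∞ (hpdCurve S ξ) t :=
  (contDiffAt_const.matrixMul (contDiff_matrixExp _).contDiffAt).matrixMul contDiffAt_const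

theorem isGeodesicOn_stiefelCurve {U ξ : Matrix (Fin p) (Fin k) ℂ} {Q : Matrix (Fin p) (Fin m) ℂ}
    {R : Matrix (Fin m) (Fin k) ℂ} (hU : Uᴴ * U = 1) (hξ : Uᴴ * ξ + ξᴴ * U = 0)
    (hQ : Qᴴ * Q = 1) (hQR : Q * R = (1 - U * Uᴴ) * ξ) :
    (stiefel p k).IsGeodesicOn (stiefelCurve U ξ Q R) univ := by
  obtain ⟨c', c'', h1, h2, -, -, h5, h6, h7⟩ := stiefelCurve_spec hU hξ hQ hQR
  have hA : (Uᴴ * ξ)ᴴ = -(Uᴴ * ξ) := by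
    rw [conjTranspose_mul, conjTranspose_conjTranspose]
    exact eq_neg_of_add_eq_zero_right hξ
  refine (stiefelData p k).isGeodesicOn_of_acceleration rfl (fun t => rfl)
    (contDiffAt_stiefelCurve U ξ Q R) h5 fun t W hW => ?_
  rw [(stiefelData p k).acceleration_eq (h5 t) h1 (h2 t) (stiefel_metric_line _ _ _ _)
    (stiefel_metric_line _ _ _ _)]
  exact stiefel_acceleration (h5 t) (by rw [h6, hA]) (by rw [h6, h7]) hW

theorem isGeodesicOn_hpdCurve (hk : 0 < k) (hα : 0 < α) (hβ : -(α / k) < β)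
    {S ξ : Matrix (Fin k) (Fin k) ℂ} (hS : S.PosDef) (hξ : ξᴴ = ξ) :
    (hpd k α β).IsGeodesicOn (hpdCurve S ξ) univ := by
  obtain ⟨c', h1, h2, -, -, h5, -, -⟩ := hpdCurve_spec hS hξ
  refine (hpdData hk hα hβ).isGeodesicOn_of_acceleration rfl (fun t => rfl)
    (contDiffAt_hpdCurve S ξ) h5 fun t W hW => ?_
  rw [(hpdData hk hα hβ).acceleration_eq (h5 t) h1 (h2 t) (hpd_metric_line (h5 t).isUnit _ _ _)
    (hpd_metric_line (h5 t).isUnit _ _ _)]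
  exact hpd_acceleration

end Factors

section Product

variable {p k m : ℕ} {α β : ℝ}

/-- A linear map on a finite-dimensional normed space is continuous. -/
def linToCLM {E F : Type*} [NormedAddCommGroup E] [NormedSpace ℝ E] [FiniteDimensional ℝ E]
    [NormedAddCommGroup F] [NormedSpace ℝ F] (f : E →ₗ[ℝ] F) : E →L[ℝ] F :=
  LinearMap.toContinuousLinearMap f

/-- The action `(U, Σ) ↦ (U O, Oᴴ Σ O)` of the unitary matrix `O`, extended linearly to the ambient
space. -/
def unitaryAct (p : ℕ) (O : Matrix (Fin k) (Fin k) ℂ) :=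
  linToCLM (E := Matrix (Fin p) (Fin k) ℂ × Matrix (Fin k) (Fin k) ℂ)
    (F := Matrix (Fin p) (Fin k) ℂ × Matrix (Fin k) (Fin k) ℂ)
    { toFun := fun θ => (θ.1 * O, Oᴴ * θ.2 * O)
      map_add' := fun θ θ' => by ext1 <;> simp [Matrix.add_mul, Matrix.mul_add]
      map_smul' := fun c θ => by ext1 <;> simp }

lemma unitaryAct_apply (O : Matrix (Fin k) (Fin k) ℂ)
    (θ : Matrix (Fin p) (Fin k) ℂ × Matrix (Fin k) (Fin k) ℂ) :
    unitaryAct p O θ = (θ.1 * O, Oᴴ * θ.2 * O) := rfl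

lemma contDiffAt_unitaryAct {r : ℕ∞ω} {O : ℝ → Matrix (Fin k) (Fin k) ℂ} {t : ℝ}
    (hO : ContDiffAt ℝ r O t) : ContDiffAt ℝ r (fun s => unitaryAct p (O s)) t := by
  refine Submersion.contDiffAt_clm_of_apply fun θ => ?_
  have h1 : ContDiffAt ℝ r (fun s => θ.1 * O s) t := contDiffAt_const.matrixMul hO
  have h2 : ContDiffAt ℝ r (fun s => (O s)ᴴ * θ.2 * O s) t :=
    (hO.conjTranspose.matrixMul contDiffAt_const).matrixMul hO
  exact h1.prodMk h2

lemma stiefel_metric_unitary {O : Matrix (Fin k) (Fin k) ℂ} (hO : O * Oᴴ = 1)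
    (U ξ η : Matrix (Fin p) (Fin k) ℂ) :
    (stiefel p k).metric (U * O) (ξ * O) (η * O) = (stiefel p k).metric U ξ η := by
  simp only [stiefel]
  have h1 : U * O * (U * O)ᴴ = U * Uᴴ := by
    rw [conjTranspose_mul, Matrix.mul_assoc, ← Matrix.mul_assoc O, hO, Matrix.one_mul]
  rw [h1, conjTranspose_mul, ← Matrix.mul_assoc, trace_mul_comm, Matrix.mul_assoc Oᴴ,
    Matrix.mul_assoc Oᴴ, ← Matrix.mul_assoc O, hO, Matrix.one_mul]

lemma hpd_metric_unitary {O : Matrix (Fin k) (Fin k) ℂ} (hO : O * Oᴴ = 1)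
    (S ξ η : Matrix (Fin k) (Fin k) ℂ) :
    (hpd k α β).metric (Oᴴ * S * O) (Oᴴ * ξ * O) (Oᴴ * η * O) = (hpd k α β).metric S ξ η := by
  have hO' : Oᴴ * O = 1 := mul_eq_one_comm.mp hO
  have hi : (Oᴴ * S * O)⁻¹ = Oᴴ * S⁻¹ * O := by
    rw [Matrix.mul_inv_rev, Matrix.mul_inv_rev, Matrix.inv_eq_right_inv hO,
      Matrix.inv_eq_right_inv hO', Matrix.mul_assoc]
  have hm : ∀ A B : Matrix (Fin k) (Fin k) ℂ, Oᴴ * A * O * (Oᴴ * B * O) = Oᴴ * (A * B) * O := by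
    intro A B
    rw [Matrix.mul_assoc Oᴴ B, ← Matrix.mul_assoc (Oᴴ * A * O), Matrix.mul_assoc (Oᴴ * A), hO,
      Matrix.mul_one, ← Matrix.mul_assoc, Matrix.mul_assoc Oᴴ]
  have ht : ∀ A : Matrix (Fin k) (Fin k) ℂ, trace (Oᴴ * A * O) = trace A := fun A => by
    rw [trace_mul_comm, ← Matrix.mul_assoc, hO, Matrix.one_mul]
  simp only [hpd, hi, hm, ht]

lemma orbit_mem_total {θ θ' : Matrix (Fin p) (Fin k) ℂ × Matrix (Fin k) (Fin k) ℂ}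
    {O : Matrix (Fin k) (Fin k) ℂ} (hO : Oᴴ * O = 1) (hθ : θ ∈ (rankQuotient p k α β).total)
    (h : θ' = (θ.1 * O, Oᴴ * θ.2 * O)) : θ' ∈ (rankQuotient p k α β).total := by
  subst h
  have h1 : θ.1ᴴ * θ.1 = 1 := hθ.1
  have h2 : θ.2.PosDef := hθ.2
  constructor
  · change (θ.1 * O)ᴴ * (θ.1 * O) = 1
    rw [conjTranspose_mul, Matrix.mul_assoc, ← Matrix.mul_assoc θ.1ᴴ, h1, Matrix.one_mul, hO]
  · refine h2.conjTranspose_mul_mul_same (Matrix.mulVec_injective_of_isUnit ?_)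
    exact ⟨⟨O, Oᴴ, mul_eq_one_comm.mp hO, hO⟩, rfl⟩

/-- Points in the same fibre are related by the unitary matrix `Uᴴ U'`. -/
lemma orbit_eq_iff {θ θ' : Matrix (Fin p) (Fin k) ℂ × Matrix (Fin k) (Fin k) ℂ}
    (hθ : θ ∈ (rankQuotient p k α β).total) :
    orbit p k θ = orbit p k θ' ↔ (θ.1ᴴ * θ'.1)ᴴ * (θ.1ᴴ * θ'.1) = 1 ∧
      θ' = (θ.1 * (θ.1ᴴ * θ'.1), (θ.1ᴴ * θ'.1)ᴴ * θ.2 * (θ.1ᴴ * θ'.1)) := by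
  have h1 : θ.1ᴴ * θ.1 = 1 := hθ.1
  constructor
  · intro h
    have h2 : θ' ∈ orbit p k θ := h ▸ ⟨1, one_mem _, by simp⟩
    obtain ⟨O, hO, rfl⟩ := h2
    have h3 : θ.1ᴴ * (θ.1 * O) = O := by rw [← Matrix.mul_assoc, h1, Matrix.one_mul]
    simp only [h3]
    exact ⟨mem_unitaryGroup_iff'.mp hO, trivial⟩
  · rintro ⟨h2, h3⟩
    generalize θ.1ᴴ * θ'.1 = O at h2 h3
    subst h3
    have h4 : O * Oᴴ = 1 := mul_eq_one_comm.mp h2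
    ext ζ
    constructor
    · rintro ⟨P, hP, rfl⟩
      refine ⟨Oᴴ * P, mul_mem (mem_unitaryGroup_iff.mpr (by
        simpa [star_eq_conjTranspose] using h2)) hP, ?_⟩
      ext1
      · simp only [Matrix.mul_assoc]
        rw [← Matrix.mul_assoc O, h4, Matrix.one_mul]
      · simp only [conjTranspose_mul, conjTranspose_conjTranspose, Matrix.mul_assoc]
        rw [← Matrix.mul_assoc O Oᴴ P, h4, Matrix.one_mul, ← Matrix.mul_assoc O Oᴴ, h4,
          Matrix.one_mul]
    · rintro ⟨P, hP, rfl⟩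
      refine ⟨O * P, mul_mem (mem_unitaryGroup_iff'.mpr h2) hP, ?_⟩
      simp only [conjTranspose_mul, Matrix.mul_assoc]

lemma isGaugeAt_unitaryAct (hk : 0 < k) (hα : 0 < α) (hβ : -(α / k) < β)
    {O : ℝ → Matrix (Fin k) (Fin k) ℂ} {t : ℝ} (hO : ContDiffAt ℝ 1 O t)
    (hOu : ∀ᶠ s in 𝓝 t, (O s)ᴴ * O s = 1) :
    (rankData p hk hα hβ).IsGaugeAt (fun s => unitaryAct p (O s)) t := by
  have h1 : (O t)ᴴ * O t = 1 := hOu.self_of_nhds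
  have h2 : O t * (O t)ᴴ = 1 := mul_eq_one_comm.mp h1
  refine ⟨fun θ hθ => orbit_mem_total h1 hθ rfl, fun θ hθ ξ η => ?_, fun θ hθ κ => ?_, ?_⟩
  · change (stiefel p k).metric (θ.1 * O t) (ξ.1 * O t) (η.1 * O t) + (hpd k α β).metric
      ((O t)ᴴ * θ.2 * O t) ((O t)ᴴ * ξ.2 * O t) ((O t)ᴴ * η.2 * O t) = _
    rw [stiefel_metric_unitary h2, hpd_metric_unitary h2]
    rfl
  · refine ⟨(O t)ᴴ * κ.1 * O t, ?_, ?_⟩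
    · have hκ : κ.1ᴴ = -κ.1 := κ.2
      simp only [conjTranspose_mul, conjTranspose_conjTranspose, hκ]
      simp [Matrix.mul_assoc]
    · change (θ.1 * κ.1 * O t, (O t)ᴴ * (θ.2 * κ.1 - κ.1 * θ.2) * O t)
        = (θ.1 * O t * ((O t)ᴴ * κ.1 * O t), (O t)ᴴ * θ.2 * O t * ((O t)ᴴ * κ.1 * O t)
          - (O t)ᴴ * κ.1 * O t * ((O t)ᴴ * θ.2 * O t))
      ext1
      · simp only [Matrix.mul_assoc]
        rw [← Matrix.mul_assoc (O t) (O t)ᴴ, h2, Matrix.one_mul]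
      · simp only [Matrix.mul_sub, Matrix.sub_mul, Matrix.mul_assoc]
        rw [← Matrix.mul_assoc (O t) (O t)ᴴ, ← Matrix.mul_assoc (O t) (O t)ᴴ, h2, Matrix.one_mul,
          Matrix.one_mul]
  · have hd : HasDerivAt O (deriv O t) t := (hO.differentiableAt (by simp)).hasDerivAt
    set O' := deriv O t
    have hd1 : O'ᴴ * O t + (O t)ᴴ * O' = 0 :=
      ((hd.matrixConjTranspose.matrixMul hd).congr_of_eventuallyEq
        (f₁ := fun _ => (1 : Matrix (Fin k) (Fin k) ℂ)) (hOu.mono fun s hs => hs.symm)).unique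
        (hasDerivAt_const t _)
    have hOu' : ∀ᶠ s in 𝓝 t, (1 : Matrix (Fin k) (Fin k) ℂ) = O s * (O s)ᴴ :=
      hOu.mono fun s hs => (mul_eq_one_comm.mp hs).symm
    have hd2 : O' * (O t)ᴴ + O t * O'ᴴ = 0 :=
      ((hd.matrixMul hd.matrixConjTranspose).congr_of_eventuallyEq
        (f₁ := fun _ => (1 : Matrix (Fin k) (Fin k) ℂ)) hOu').unique (hasDerivAt_const t _)
    refine ⟨⟨O' * (O t)ᴴ, ?_⟩, fun θ => ?_⟩
    · change (O' * (O t)ᴴ)ᴴ = -(O' * (O t)ᴴ)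
      rw [conjTranspose_mul, conjTranspose_conjTranspose]
      exact eq_neg_of_add_eq_zero_right hd2
    · have h3 : HasDerivAt (fun s => unitaryAct p (O s))
          (deriv (fun s => unitaryAct p (O s)) t) t :=
        ((contDiffAt_unitaryAct hO).differentiableAt (by simp)).hasDerivAt
      have h4 := h3.clm_apply (hasDerivAt_const t θ)
      have h5 : HasDerivAt (fun s => unitaryAct p (O s) θ)
          (θ.1 * O', O'ᴴ * θ.2 * O t + (O t)ᴴ * θ.2 * O') t := by
        have h6 := (hasDerivAt_const t θ.1).matrixMul hd
        have h7 := (hd.matrixConjTranspose.matrixMul (hasDerivAt_const t θ.2)).matrixMul hd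
        have h8 := h6.prodMk h7
        refine h8.congr_deriv ?_
        simp
      have h9 := h4.unique h5
      have h10 : unitaryAct p (O t) 0 = 0 := (unitaryAct p (O t)).map_zero
      refine (add_zero _).symm.trans ((congrArg _ h10.symm).trans (h9.trans ?_))
      change _ = (θ.1 * (O' * (O t)ᴴ) * O t,
        (O t)ᴴ * (θ.2 * (O' * (O t)ᴴ) - O' * (O t)ᴴ * θ.2) * O t)
      ext1
      · simp only [Matrix.mul_assoc, h1, Matrix.mul_one]
      · have h10 : (O t)ᴴ * O' = -(O'ᴴ * O t) := eq_neg_of_add_eq_zero_right hd1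
        simp only [Matrix.mul_sub, Matrix.sub_mul]
        rw [show (O t)ᴴ * (θ.2 * (O' * (O t)ᴴ)) * O t = (O t)ᴴ * θ.2 * O' * ((O t)ᴴ * O t) by
            simp only [Matrix.mul_assoc],
          show (O t)ᴴ * (O' * (O t)ᴴ * θ.2) * O t = (O t)ᴴ * O' * ((O t)ᴴ * θ.2 * O t) by
            simp only [Matrix.mul_assoc], h10, h1,
          show -(O'ᴴ * O t) * ((O t)ᴴ * θ.2 * O t) = -(O'ᴴ * (O t * (O t)ᴴ) * θ.2 * O t) by
            simp only [Matrix.mul_assoc, Matrix.neg_mul], h2]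
        simp only [Matrix.mul_one]
        abel

/-- The pairing of a velocity with a vertical vector, through the conserved quantities. -/
lemma rank_metric_vert {U U' : Matrix (Fin p) (Fin k) ℂ} {S S' Ω : Matrix (Fin k) (Fin k) ℂ}
    (hU : Uᴴ * U = 1) (hS : IsUnit S) :
    (rankQuotient p k α β).metric (U, S) (U', S') (U * Ω, S * Ω - Ω * S)
      = 1 / 2 * (trace ((Uᴴ * U')ᴴ * Ω)).re
        + α * ((trace (S⁻¹ * S' * Ω)).re - (trace (S' * S⁻¹ * Ω)).re) := by
  have hS' := (Matrix.isUnit_iff_isUnit_det _).mp hS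
  have h1 : S⁻¹ * S = 1 := Matrix.nonsing_inv_mul _ hS'
  have h2 : S * S⁻¹ = 1 := Matrix.mul_nonsing_inv _ hS'
  have e1 : (stiefel p k).metric U U' (U * Ω) = 1 / 2 * (trace ((Uᴴ * U')ᴴ * Ω)).re := by
    rw [stiefel_metric_eq]
    have h3 : U'ᴴ * (U * Uᴴ) * (U * Ω) = U'ᴴ * (U * (Uᴴ * U * Ω)) := by
      simp only [Matrix.mul_assoc]
    rw [h3, hU, Matrix.one_mul, conjTranspose_mul, conjTranspose_conjTranspose, Matrix.mul_assoc]
    ring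
  have e2 : trace (S⁻¹ * S' * S⁻¹ * (S * Ω - Ω * S))
      = trace (S⁻¹ * S' * Ω) - trace (S' * S⁻¹ * Ω) := by
    rw [Matrix.mul_sub, trace_sub]
    congr 1
    · rw [Matrix.mul_assoc, ← Matrix.mul_assoc S⁻¹ S, h1, Matrix.one_mul]
    · rw [← Matrix.mul_assoc, trace_mul_comm]
      simp only [← Matrix.mul_assoc]
      rw [h2, Matrix.one_mul]
  have e3 : trace (S⁻¹ * (S * Ω - Ω * S)) = 0 := by
    rw [Matrix.mul_sub, trace_sub, ← Matrix.mul_assoc, h1, Matrix.one_mul, trace_mul_comm S⁻¹,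
      Matrix.mul_assoc, h2, Matrix.mul_one, sub_self]
  change (stiefel p k).metric U U' (U * Ω) + (hpd k α β).metric S S' (S * Ω - Ω * S) = _
  rw [e1]
  simp only [hpd]
  rw [e2, e3]
  simp

variable {θ ξ : Matrix (Fin p) (Fin k) ℂ × Matrix (Fin k) (Fin k) ℂ}
  {Q : Matrix (Fin p) (Fin m) ℂ} {R : Matrix (Fin m) (Fin k) ℂ}

lemma contDiffAt_liftedCurve (θ ξ : Matrix (Fin p) (Fin k) ℂ × Matrix (Fin k) (Fin k) ℂ)
    (Q : Matrix (Fin p) (Fin m) ℂ) (R : Matrix (Fin m) (Fin k) ℂ) (t : ℝ) :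
    ContDiffAt ℝ ∞ (liftedCurve θ ξ Q R) t :=
  (contDiffAt_stiefelCurve θ.1 ξ.1 Q R t).prodMk (contDiffAt_hpdCurve θ.2 ξ.2 t)

lemma liftedCurve_mem_total (hθ : θ ∈ (rankQuotient p k α β).total)
    (hξ : ξ ∈ (rankQuotient p k α β).horizontal θ) (hQ : Qᴴ * Q = 1)
    (hQR : Q * R = (1 - θ.1 * θ.1ᴴ) * ξ.1) (t : ℝ) :
    liftedCurve θ ξ Q R t ∈ (rankQuotient p k α β).total := by
  obtain ⟨_, _, _, _, _, _, h5, _⟩ := stiefelCurve_spec hθ.1 hξ.1.1 hQ hQR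
  obtain ⟨_, _, _, _, _, g5, _⟩ := hpdCurve_spec hθ.2 hξ.1.2
  exact ⟨h5 t, g5 t⟩

lemma hasDerivAt_liftedCurve_zero (hθ : θ ∈ (rankQuotient p k α β).total)
    (hξ : ξ ∈ (rankQuotient p k α β).horizontal θ) (hQ : Qᴴ * Q = 1)
    (hQR : Q * R = (1 - θ.1 * θ.1ᴴ) * ξ.1) :
    liftedCurve θ ξ Q R 0 = θ ∧ HasDerivAt (liftedCurve θ ξ Q R) ξ 0 := by
  obtain ⟨c', _, h1, _, h3, h4, _⟩ := stiefelCurve_spec hθ.1 hξ.1.1 hQ hQR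
  obtain ⟨b', g1, _, g3, g4, _⟩ := hpdCurve_spec hθ.2 hξ.1.2
  refine ⟨Prod.ext h3 g3, ?_⟩
  have h := (h1 0).prodMk (g1 0)
  rw [h4, g4] at h
  exact h

/-- By conservation of the momenta `Uᴴ U'`, `Σ⁻¹ Σ'` and `Σ' Σ⁻¹`, the curve stays horizontal. -/
lemma liftedCurve_horizontal (hθ : θ ∈ (rankQuotient p k α β).total)
    (hξ : ξ ∈ (rankQuotient p k α β).horizontal θ) (hQ : Qᴴ * Q = 1)
    (hQR : Q * R = (1 - θ.1 * θ.1ᴴ) * ξ.1) (t : ℝ) :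
    deriv (liftedCurve θ ξ Q R) t
      ∈ (rankQuotient p k α β).horizontal (liftedCurve θ ξ Q R t) := by
  obtain ⟨c', _, h1, _, _, _, h5, h6, _⟩ := stiefelCurve_spec hθ.1 hξ.1.1 hQ hQR
  obtain ⟨b', g1, _, _, _, g5, g6, g7⟩ := hpdCurve_spec hθ.2 hξ.1.2
  have hS : θ.2.PosDef := hθ.2
  have hU : θ.1ᴴ * θ.1 = 1 := hθ.1
  have hd : deriv (liftedCurve θ ξ Q R) t = (c' t, b' t) := ((h1 t).prodMk (g1 t)).deriv
  rw [hd]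
  refine ⟨⟨?_, ?_⟩, ?_⟩
  · exact (stiefelData p k).deriv_mem (stiefelCurve θ.1 ξ.1 Q R) (c' t) t (h1 t) (.of_forall h5)
  · exact hpd_deriv_mem (g1 t) (.of_forall g5)
  · rintro _ ⟨Ω, hΩ, rfl⟩
    have h7 := hξ.2 _ ⟨Ω, hΩ, rfl⟩
    have h8 := rank_metric_vert (α := α) (β := β) (U' := ξ.1) (S' := ξ.2) (Ω := Ω) hU hS.isUnit
    have h9 := rank_metric_vert (α := α) (β := β) (U' := c' t) (S' := b' t) (Ω := Ω) (h5 t)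
      (g5 t).isUnit
    rw [h6, g6, g7, ← h8] at h9
    exact h9.trans h7

theorem isGeodesicOn_liftedCurve (hk : 0 < k) (hα : 0 < α) (hβ : -(α / k) < β)
    (hθ : θ ∈ (rankQuotient p k α β).total)
    (hξ : ξ ∈ (rankQuotient p k α β).horizontal θ) (hQ : Qᴴ * Q = 1)
    (hQR : Q * R = (1 - θ.1 * θ.1ᴴ) * ξ.1) :
    (rankQuotient p k α β).IsGeodesicOn (fun t => orbit p k (liftedCurve θ ξ Q R t)) univ := by
  have htot := liftedCurve_mem_total hθ hξ hQ hQR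
  refine (rankData p hk hα hβ).isGeodesicOn_of_horizontal (contDiffAt_liftedCurve θ ξ Q R) htot
    (liftedCurve_horizontal hθ hξ hQ hQR) (fun t W hW => ?_) (fun t δ hδ hs => ?_)
  · obtain ⟨c', c'', h1, h2, _, _, h5, h6, h7⟩ := stiefelCurve_spec hθ.1 hξ.1.1 hQ hQR
    obtain ⟨b', g1, g2, _, _, g5, _⟩ := hpdCurve_spec hθ.2 hξ.1.2
    have hA : (θ.1ᴴ * ξ.1)ᴴ = -(θ.1ᴴ * ξ.1) := by
      rw [conjTranspose_mul, conjTranspose_conjTranspose]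
      exact eq_neg_of_add_eq_zero_right hξ.1.1
    have e1 := stiefel_acceleration (U'' := c'' t) (h5 t) (by rw [h6, hA]) (by rw [h6, h7]) hW.1
    have e2 := hpd_acceleration (α := α) (β := β) (S := hpdCurve θ.2 ξ.2 t) (S' := b' t)
      (W := W.2)
    have hS := (g5 t).isUnit
    rw [(rankData p hk hα hβ).acceleration_eq (γ' := fun s => (c' s, b' s)) (htot t)
      (fun s => (h1 s).prodMk (g1 s)) ((h2 t).prodMk (g2 t))
      ((stiefel_metric_line _ _ _ _).add (hpd_metric_line hS _ _ _))
      ((stiefel_metric_line _ _ _ _).add (hpd_metric_line hS _ _ _))]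
    have key : ∀ m₁ a₁ b₁ m₂ a₂ b₂ : ℝ, m₁ + a₁ - 1 / 2 * b₁ = 0 → m₂ + a₂ - 1 / 2 * b₂ = 0 →
        m₁ + m₂ + (a₁ + a₂) - 1 / 2 * (b₁ + b₂) = 0 := by
      intros
      linarith
    exact key _ _ _ _ _ _ e1 e2
  · set γ := liftedCurve θ ξ Q R with hγ
    have h1 : ContDiffAt ℝ ∞ (fun s => (δ s).1) t := contDiffAt_fst.comp t hδ
    have h2 : ContDiffAt ℝ ∞ (fun s => (δ s).1ᴴ * (γ s).1) t :=
      h1.conjTranspose.matrixMul (contDiffAt_stiefelCurve θ.1 ξ.1 Q R t)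
    have h3 := hs.mono fun s h => (orbit_eq_iff h.1).mp h.2
    refine ⟨fun s => unitaryAct p ((δ s).1ᴴ * (γ s).1), contDiffAt_unitaryAct h2, ?_,
      h3.mono fun s h => h.2.symm⟩
    filter_upwards [(h2.of_le (m := 1) (by simp)).eventually (by simp), h3.eventually_nhds]
      with s h4 h5
    exact isGaugeAt_unitaryAct hk hα hβ h4 (h5.mono fun _ h => h.1)

end Product

end

/-! ### Charts of the quotient and uniqueness of geodesics -/

namespace Submersion

noncomputable section

variable {E X K : Type*} [NormedAddCommGroup E] [NormedSpace ℝ E]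
  [NormedAddCommGroup K] [NormedSpace ℝ K]

/-- The quotient has a chart around `proj θ`, read off on `total` near the fibre of `θ` by the
smooth function `ψ`. -/
structure IsChart (G : Submersion E X) {d : ℕ} (σ : EuclideanSpace ℝ (Fin d) → E)
    (V : Set (EuclideanSpace ℝ (Fin d))) (ψ : E → EuclideanSpace ℝ (Fin d)) (N : Set E) : Prop where
  param : G.IsParametrization σ V
  isOpen : IsOpen N
  saturated : ∀ θ ∈ G.total, ∀ θ' ∈ G.total, G.proj θ = G.proj θ' → θ ∈ N → θ' ∈ N
  smooth : ∀ θ ∈ G.total, θ ∈ N → ContDiffAt ℝ ∞ ψ θ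
  mapsTo : ∀ θ ∈ G.total, θ ∈ N → ψ θ ∈ V
  proj_eq : ∀ θ ∈ G.total, θ ∈ N → G.proj (σ (ψ θ)) = G.proj θ

/-- A local trivialization of the submersion over the open part `Ω` of a linear space `F`: a local
section `σ` on `Ω ∩ F` and a map `ψ` on `N ∩ total` that is constant on the fibres and inverts `σ`,
whose derivative has the vertical space as kernel. -/
structure IsSlice (G : Submersion E X) (F : Submodule ℝ E) (Ω N : Set E) (σ ψ : E → E) : Prop where
  isOpen_source : IsOpen Ω
  isOpen : IsOpen N
  smooth_section : ∀ y ∈ F, y ∈ Ω → ContDiffAt ℝ ∞ σ y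
  smooth : ∀ θ ∈ G.total, θ ∈ N → ContDiffAt ℝ ∞ ψ θ
  section_mem : ∀ y ∈ F, y ∈ Ω → σ y ∈ G.total ∧ σ y ∈ N
  mapsTo : ∀ θ ∈ G.total, θ ∈ N → ψ θ ∈ F ∧ ψ θ ∈ Ω
  left_inv : ∀ y ∈ F, y ∈ Ω → ψ (σ y) = y
  proj_eq : ∀ θ ∈ G.total, θ ∈ N → G.proj (σ (ψ θ)) = G.proj θ
  invariant : ∀ θ ∈ G.total, ∀ θ' ∈ G.total, G.proj θ = G.proj θ' → θ ∈ N → θ' ∈ N ∧ ψ θ' = ψ θ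
  deriv_mem : ∀ θ ∈ G.total, θ ∈ N → ∀ ξ ∈ G.tangent θ, fderiv ℝ ψ θ ξ ∈ F
  ker_eq : ∀ θ ∈ G.total, θ ∈ N → ∀ ξ ∈ G.tangent θ, fderiv ℝ ψ θ ξ = 0 ↔ ξ ∈ G.vertical θ
  tangent_sub : ∀ θ ∈ G.total, ∀ ξ ∈ G.tangent θ, ∀ η ∈ G.tangent θ, ξ - η ∈ G.tangent θ

/-- Linear coordinates on a subspace, extended to the whole space. -/
lemma exists_linear_coordinates [FiniteDimensional ℝ E] (F : Submodule ℝ E) :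
    ∃ (d : ℕ) (ι : EuclideanSpace ℝ (Fin d) →L[ℝ] E) (r : E →L[ℝ] EuclideanSpace ℝ (Fin d)),
      (∀ x, ι x ∈ F) ∧ (∀ x, r (ι x) = x) ∧ ∀ y ∈ F, ι (r y) = y := by
  obtain ⟨g, hg⟩ := F.subtype.exists_leftInverse_of_injective F.ker_subtype
  let e : F ≃ₗ[ℝ] EuclideanSpace ℝ (Fin (Module.finrank ℝ F)) :=
    LinearEquiv.ofFinrankEq _ _ (by simp)
  have hg' : ∀ y : F, g y = y := fun y => LinearMap.congr_fun hg y
  refine ⟨Module.finrank ℝ F,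
    LinearMap.toContinuousLinearMap (F.subtype ∘ₗ e.symm.toLinearMap),
    LinearMap.toContinuousLinearMap (e.toLinearMap ∘ₗ g), fun x => ?_, fun x => ?_, fun y hy => ?_⟩
  · exact (e.symm x).2
  · change e (g (e.symm x : E)) = x
    rw [hg', e.apply_symm_apply]
  · change ((e.symm (e (g y)) : F) : E) = y
    rw [e.symm_apply_apply]
    exact congrArg Subtype.val (hg' ⟨y, hy⟩)

theorem IsSlice.exists_isChart [FiniteDimensional ℝ E] {G : Submersion E X}
    (D : G.RiemannianData K) {F : Submodule ℝ E} {Ω N : Set E} {σ ψ : E → E}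
    (h : G.IsSlice F Ω N σ ψ) :
    ∃ (d : ℕ) (σ' : EuclideanSpace ℝ (Fin d) → E) (V : Set (EuclideanSpace ℝ (Fin d)))
      (ψ' : E → EuclideanSpace ℝ (Fin d)), G.IsChart σ' V ψ' N := by
  obtain ⟨d, ι, r, hι, hr, hιr⟩ := exists_linear_coordinates F
  have hV : IsOpen (ι ⁻¹' Ω) := h.isOpen_source.preimage ι.continuous
  have hsm : ∀ x ∈ ι ⁻¹' Ω, ContDiffAt ℝ ∞ (fun x => σ (ι x)) x := fun x hx =>
    (h.smooth_section _ (hι x) hx).comp x ι.contDiff.contDiffAt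
  refine ⟨d, fun x => σ (ι x), ι ⁻¹' Ω, fun θ => r (ψ θ),
    ⟨hV, fun x hx => (hsm x hx).contDiffWithinAt, fun x hx => (h.section_mem _ (hι x) hx).1,
      fun x hx y hy hxy => ?_, fun x hx ξ hξ => ?_⟩, h.isOpen,
    fun θ hθ θ' hθ' hp hN => (h.invariant θ hθ θ' hθ' hp hN).1,
    fun θ hθ hN => r.contDiff.contDiffAt.comp θ (h.smooth θ hθ hN), fun θ hθ hN => ?_,
    fun θ hθ hN => ?_⟩
  · have hx' := h.section_mem _ (hι x) hx
    have h1 := (h.invariant _ hx'.1 _ (h.section_mem _ (hι y) hy).1 hxy hx'.2).2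
    rw [h.left_inv _ (hι y) hy, h.left_inv _ (hι x) hx] at h1
    rw [← hr x, ← h1, hr]
  · obtain ⟨ht, hN⟩ := h.section_mem _ (hι x) hx
    have hσ : HasFDerivAt (fun x => σ (ι x)) (fderiv ℝ (fun x => σ (ι x)) x) x :=
      ((hsm x hx).differentiableAt (by simp)).hasFDerivAt
    set S := fderiv ℝ (fun x => σ (ι x)) x
    have hψ : HasFDerivAt ψ (fderiv ℝ ψ (σ (ι x))) (σ (ι x)) :=
      ((h.smooth _ ht hN).differentiableAt (by simp)).hasFDerivAt
    set P := fderiv ℝ ψ (σ (ι x)) with hP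
    have hcomp : HasFDerivAt (fun x => ψ (σ (ι x))) (P.comp S) x := HasFDerivAt.comp x hψ hσ
    -- the derivative `P` of `ψ` is a left inverse of the derivative `S` of the section
    have hPS : P.comp S = ι := by
      refine (hcomp.congr_of_eventuallyEq ?_).unique ι.hasFDerivAt
      filter_upwards [hV.mem_nhds hx] with y hy
      exact (h.left_inv _ (hι y) hy).symm
    have hPS' : ∀ v, P (S v) = ι v := fun v => by rw [← hPS]; rfl
    have hS : ∀ v, S v ∈ G.tangent (σ (ι x)) := fun v => by
      have h5 : ∀ᶠ τ : ℝ in 𝓝 0, x + τ • v ∈ ι ⁻¹' Ω :=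
        (hV.preimage (by fun_prop : Continuous fun τ : ℝ => x + τ • v)).mem_nhds
          (by simpa using hx)
      have h6 := D.deriv_mem (fun τ : ℝ => σ (ι (x + τ • v))) (S v) 0 (hσ.hasLineDerivAt v)
        (h5.mono fun τ hτ => (h.section_mem _ (hι _) hτ).1)
      simpa using h6
    have hiff : ∀ v, ξ - S v ∈ G.vertical (σ (ι x)) ↔ P ξ = ι v := fun v => by
      rw [← h.ker_eq _ ht hN _ (h.tangent_sub _ ht _ hξ _ (hS v)), ← hP, map_sub, hPS', sub_eq_zero]
    refine ⟨r (P ξ), (hiff _).mpr (hιr _ (h.deriv_mem _ ht hN _ hξ)).symm, fun v hv => ?_⟩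
    rw [(hiff v).mp hv, hr]
  · change ι (r (ψ θ)) ∈ Ω
    rw [hιr _ (h.mapsTo θ hθ hN).1]
    exact (h.mapsTo θ hθ hN).2
  · rw [hιr _ (h.mapsTo θ hθ hN).1]
    exact h.proj_eq θ hθ hN

section

variable {G : Submersion E X} {d : ℕ} {σ : EuclideanSpace ℝ (Fin d) → E}
  {V : Set (EuclideanSpace ℝ (Fin d))} {ψ : E → EuclideanSpace ℝ (Fin d)} {N : Set E}

lemma IsChart.eq_of_proj_eq (h : G.IsChart σ V ψ N) {θ θ' : E} (hθ : θ ∈ G.total)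
    (hN : θ ∈ N) (hθ' : θ' ∈ G.total) (hp : G.proj θ = G.proj θ') : ψ θ = ψ θ' := by
  have hN' := h.saturated _ hθ _ hθ' hp hN
  refine h.param.injOn (h.mapsTo _ hθ hN) (h.mapsTo _ hθ' hN') ?_
  change G.proj (σ (ψ θ)) = G.proj (σ (ψ θ'))
  rw [h.proj_eq _ hθ hN, h.proj_eq _ hθ' hN', hp]

/-- The coordinates of a curve do not depend on its lift. -/
lemma IsChart.eventuallyEq_of_lift (h : G.IsChart σ V ψ N) {c : ℝ → X} {γ δ : ℝ → E} {t : ℝ}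
    (hγ : ∀ᶠ s in 𝓝 t, γ s ∈ G.total ∧ G.proj (γ s) = c s)
    (hδ : ∀ᶠ s in 𝓝 t, δ s ∈ G.total ∧ G.proj (δ s) = c s)
    (hc : ContinuousAt γ t) (hN : γ t ∈ N) : (fun s => ψ (γ s)) =ᶠ[𝓝 t] fun s => ψ (δ s) := by
  filter_upwards [hγ, hδ, hc.eventually_mem (h.isOpen.mem_nhds hN)] with s h1 h2 h3
  exact h.eq_of_proj_eq h1.1 h3 h2.1 (h1.2.trans h2.2.symm)

/-- A lifted geodesic solves the geodesic equation in the coordinates of a chart. -/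
lemma IsChart.geodesic_equation (h : G.IsChart σ V ψ N) {c : ℝ → X} {γ : ℝ → E} {t : ℝ}
    {J : Set ℝ} (hJ : IsOpen J) (ht : t ∈ J) (hc : G.IsGeodesicOn c J) (hγ : ContDiffAt ℝ ∞ γ t)
    (hs : ∀ᶠ s in 𝓝 t, γ s ∈ G.total ∧ G.proj (γ s) = c s) (hN : γ t ∈ N) :
    ContDiffAt ℝ ∞ (fun s => ψ (γ s)) t ∧
    (∀ᶠ s in 𝓝 t, ψ (γ s) ∈ V ∧ G.proj (σ (ψ (γ s))) = c s) ∧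
    ∀ᶠ s in 𝓝 t, ∀ w,
      G.coordMetric σ (ψ (γ s)) (deriv (deriv fun s => ψ (γ s)) s) w
        + G.christoffel σ (ψ (γ s)) (deriv (fun s => ψ (γ s)) s) (deriv (fun s => ψ (γ s)) s) w
        = 0 := by
  have hV : ∀ᶠ s in 𝓝 t, ψ (γ s) ∈ V ∧ G.proj (σ (ψ (γ s))) = c s := by
    filter_upwards [hs, hγ.continuousAt.eventually_mem (h.isOpen.mem_nhds hN)] with s h1 h2
    exact ⟨h.mapsTo _ h1.1 h2, (h.proj_eq _ h1.1 h2).trans h1.2⟩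
  refine ⟨(h.smooth _ hs.self_of_nhds.1 hN).comp t hγ, hV, ?_⟩
  filter_upwards [hV.eventually_nhds, hs.eventually_nhds, hJ.mem_nhds ht,
    hγ.continuousAt.eventually_mem (h.isOpen.mem_nhds hN)] with s h1 h2 h3 h4
  -- `γ` need not be smooth at `s`, but there is another lift of `c` that is.
  obtain ⟨⟨δ, hδ, hδs⟩, hgeo⟩ := hc s h3
  have h5 := h2.self_of_nhds
  have h6 := hδs.self_of_nhds
  have hδN : δ s ∈ N := h.saturated _ h5.1 _ h6.1 (h5.2.trans h6.2.symm) h4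
  have h7 : ContDiffAt ℝ ∞ (fun s => ψ (δ s)) s := (h.smooth _ h6.1 hδN).comp s hδ
  exact hgeo d σ V h.param (fun s => ψ (γ s))
    (h7.congr_of_eventuallyEq (h.eventuallyEq_of_lift hδs h2 hδ.continuousAt hδN).symm) h1

end

/-- The points of `total` in a common fibre form a closed relation, so that the quotient is a
Hausdorff space, and the quotient has charts. -/
structure HasCharts (G : Submersion E X) : Prop where
  exists_isClosed : ∃ R : Set (E × E), IsClosed R ∧
    ∀ θ ∈ G.total, ∀ θ' ∈ G.total, G.proj θ = G.proj θ' ↔ (θ, θ') ∈ R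
  exists_isChart : ∀ θ ∈ G.total, ∃ (d : ℕ) (σ : EuclideanSpace ℝ (Fin d) → E)
    (V : Set (EuclideanSpace ℝ (Fin d))) (ψ : E → EuclideanSpace ℝ (Fin d)) (N : Set E),
    θ ∈ N ∧ G.IsChart σ V ψ N

namespace RiemannianData

variable [FiniteDimensional ℝ E] [FiniteDimensional ℝ K] {G : Submersion E X}

/-- A geodesic of the quotient is determined by its position and velocity at one time. The set of
times near which two geodesics agree is open, and closed by continuity of position and velocity. -/
theorem eqOn_of_isGeodesicOn (D : G.RiemannianData K) (hG : G.HasCharts) {J : Set ℝ}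
    (hJ : IsOpen J) (hJ' : J.OrdConnected) {c₁ c₂ : ℝ → X} (h₁ : G.IsGeodesicOn c₁ J)
    (h₂ : G.IsGeodesicOn c₂ J) {t₀ : ℝ} (ht₀ : t₀ ∈ J) {θ ξ : E} (hv₁ : G.HasVelocityAt c₁ θ ξ t₀)
    (hv₂ : G.HasVelocityAt c₂ θ ξ t₀) : EqOn c₁ c₂ J := by
  set u : Set ℝ := {t | c₁ =ᶠ[𝓝 t] c₂} with hu
  have huo : IsOpen u := isOpen_iff_mem_nhds.mpr fun t ht => ht.eventually_nhds
  -- Two geodesics agree near `t` if their lifts have the same coordinates to first order.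
  have key : ∀ t ∈ J, c₁ t = c₂ t →
      (∀ (d : ℕ) (σ : EuclideanSpace ℝ (Fin d) → E) (V : Set (EuclideanSpace ℝ (Fin d)))
        (ψ : E → EuclideanSpace ℝ (Fin d)) (N : Set E) (γ₁ γ₂ : ℝ → E), G.IsChart σ V ψ N →
        ContDiffAt ℝ ∞ γ₁ t → (∀ᶠ s in 𝓝 t, γ₁ s ∈ G.total ∧ G.proj (γ₁ s) = c₁ s) →
        ContDiffAt ℝ ∞ γ₂ t → (∀ᶠ s in 𝓝 t, γ₂ s ∈ G.total ∧ G.proj (γ₂ s) = c₂ s) →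
        γ₁ t ∈ N → γ₂ t ∈ N → deriv (fun s => ψ (γ₁ s)) t = deriv (fun s => ψ (γ₂ s)) t) →
      t ∈ u := by
    intro t ht hc hder
    obtain ⟨γ₁, hγ₁, hs₁⟩ := (h₁ t ht).1
    obtain ⟨γ₂, hγ₂, hs₂⟩ := (h₂ t ht).1
    have a₁ := hs₁.self_of_nhds
    have a₂ := hs₂.self_of_nhds
    obtain ⟨d, σ, V, ψ, N, hN, hψ⟩ := hG.exists_isChart _ a₁.1
    have hp : G.proj (γ₁ t) = G.proj (γ₂ t) := by rw [a₁.2, a₂.2, hc]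
    have hN₂ := hψ.saturated _ a₁.1 _ a₂.1 hp hN
    obtain ⟨b₁, e₁, g₁⟩ := hψ.geodesic_equation hJ ht h₁ hγ₁ hs₁ hN
    obtain ⟨b₂, e₂, g₂⟩ := hψ.geodesic_equation hJ ht h₂ hγ₂ hs₂ hN₂
    have heq := D.eventuallyEq_of_geodesic hψ.param b₁ b₂ (e₁.mono fun _ h => h.1)
      (e₂.mono fun _ h => h.1) g₁ g₂ (hψ.eq_of_proj_eq a₁.1 hN a₂.1 hp)
      (hder d σ V ψ N γ₁ γ₂ hψ hγ₁ hs₁ hγ₂ hs₂ hN hN₂)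
    filter_upwards [heq, e₁, e₂] with s r1 r2 r3
    rw [← r2.2, ← r3.2, r1]
  have h0 : t₀ ∈ u := by
    obtain ⟨δ₁, d₁, rfl, f₁⟩ := hv₁
    obtain ⟨δ₂, d₂, e₂, f₂⟩ := hv₂
    have hc : c₁ t₀ = c₂ t₀ := by rw [← d₁.self_of_nhds.2, ← d₂.self_of_nhds.2, e₂]
    refine key t₀ ht₀ hc ?_
    intro d σ V ψ N γ₁ γ₂ hψ hγ₁ hs₁ hγ₂ hs₂ hN₁ hN₂
    rw [(hψ.eventuallyEq_of_lift hs₁ d₁ hγ₁.continuousAt hN₁).deriv_eq,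
      (hψ.eventuallyEq_of_lift hs₂ d₂ hγ₂.continuousAt hN₂).deriv_eq]
    have hN : δ₁ t₀ ∈ N := hψ.saturated _ hs₁.self_of_nhds.1 _ d₁.self_of_nhds.1
      (hs₁.self_of_nhds.2.trans d₁.self_of_nhds.2.symm) hN₁
    have hψ' := ((hψ.smooth _ d₁.self_of_nhds.1 hN).differentiableAt (by simp)).hasFDerivAt
    have r1 : HasDerivAt (fun s => ψ (δ₁ s)) (fderiv ℝ ψ (δ₁ t₀) ξ) t₀ :=
      hψ'.comp_hasDerivAt t₀ f₁
    rw [← e₂] at hψ'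
    have r2 : HasDerivAt (fun s => ψ (δ₂ s)) (fderiv ℝ ψ (δ₂ t₀) ξ) t₀ :=
      hψ'.comp_hasDerivAt t₀ f₂
    rw [r1.deriv, r2.deriv, e₂]
  have hcl : closure u ∩ J ⊆ u := by
    rintro t ⟨htu, ht⟩
    have hfr : ∃ᶠ s in 𝓝 t, s ∈ u := mem_closure_iff_frequently.mp htu
    refine key t ht ?_ ?_
    · obtain ⟨γ₁, hγ₁, hs₁⟩ := (h₁ t ht).1
      obtain ⟨γ₂, hγ₂, hs₂⟩ := (h₂ t ht).1
      obtain ⟨R, hR, hR'⟩ := hG.exists_isClosed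
      have h3 : (γ₁ t, γ₂ t) ∈ R := by
        refine hR.mem_of_frequently_of_tendsto ?_
          (hγ₁.continuousAt.prodMk hγ₂.continuousAt)
        refine (hfr.and_eventually (hs₁.and hs₂)).mono fun s h => ?_
        have h4 : c₁ s = c₂ s := h.1.self_of_nhds
        exact (hR' _ h.2.1.1 _ h.2.2.1).mp (by rw [h.2.1.2, h.2.2.2, h4])
      have h5 := (hR' _ hs₁.self_of_nhds.1 _ hs₂.self_of_nhds.1).mpr h3
      rwa [hs₁.self_of_nhds.2, hs₂.self_of_nhds.2] at h5
    · intro d σ V ψ N γ₁ γ₂ hψ hγ₁ hs₁ hγ₂ hs₂ hN₁ hN₂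
      have b₁ := (hψ.geodesic_equation hJ ht h₁ hγ₁ hs₁ hN₁).1
      have b₂ := (hψ.geodesic_equation hJ ht h₂ hγ₂ hs₂ hN₂).1
      refine tendsto_nhds_unique_of_frequently_eq
        (contDiffAt_deriv (m := ∞) b₁ (by simp)).continuousAt
        (contDiffAt_deriv (m := ∞) b₂ (by simp)).continuousAt ?_
      refine (hfr.and_eventually ((hs₁.and hs₂).eventually_nhds.and
        (hγ₁.continuousAt.eventually_mem (hψ.isOpen.mem_nhds hN₁)).eventually_nhds)).mono
        fun s h => ?_
      refine Filter.EventuallyEq.deriv_eq ?_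
      filter_upwards [h.1, h.2.1, h.2.2] with τ r1 r2 r3
      exact hψ.eq_of_proj_eq r2.1.1 r3 r2.2.1 (by rw [r2.1.2, r2.2.2, r1])
  intro t ht
  exact (hJ'.isPreconnected.subset_of_closure_inter_subset huo ⟨t₀, ht₀, h0⟩ hcl ht).self_of_nhds

/-- Two horizontal curves related by gauge transformations differ by a constant one. -/
lemma deriv_gauge_eq_zero (D : G.RiemannianData K) {ρ : ℝ → E →L[ℝ] E} {γ δ : ℝ → E} {t : ℝ}
    (hρ : DifferentiableAt ℝ ρ t) (hg : D.IsGaugeAt ρ t) (hγ : DifferentiableAt ℝ γ t)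
    (htot : γ t ∈ G.total) (hh : deriv γ t ∈ G.horizontal (γ t))
    (hδ : deriv δ t ∈ G.horizontal (δ t)) (heq : δ =ᶠ[𝓝 t] fun s => ρ s (γ s)) :
    deriv ρ t = 0 := by
  obtain ⟨κ, hκ⟩ := hg.deriv_eq
  have h1 : deriv δ t = ρ t (D.vert (γ t) κ) + ρ t (deriv γ t) := by
    rw [heq.deriv_eq, (hρ.hasDerivAt.clm_apply hγ.hasDerivAt).deriv, hκ]
  have h2 := hδ.2 (ρ t (D.vert (γ t) κ)) (by
    rw [heq.self_of_nhds]
    exact hg.vertical _ htot κ)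
  have h3 := hh.2 _ (D.vert_mem_vertical htot κ)
  rw [h1, heq.self_of_nhds, D.metric_add, hg.isometry _ htot, hg.isometry _ htot, h3,
    add_zero] at h2
  have h4 : D.vert (γ t) κ = 0 := by
    by_contra hne
    exact (D.metric_pos _ htot _ (D.vert_mem _ htot κ) hne).ne' h2
  have h5 : κ = 0 := D.vert_injective _ htot (h4.trans (map_zero _).symm)
  ext θ
  rw [hκ, h5, map_zero, map_zero]
  rfl

end RiemannianData

end

end Submersion

/-! ### Slices for the unitary action -/

noncomputable section

lemma hasDerivAt_line {F : Type*} [NormedAddCommGroup F] [NormedSpace ℝ F] (x v : F) :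
    HasDerivAt (fun τ : ℝ => x + τ • v) v 0 :=
  (((hasDerivAt_id (0 : ℝ)).smul_const v).const_add x).congr_deriv (one_smul ℝ v)

section LocalSqrt

/-- The inverse function theorem, in the analytic category, where smoothness at a point is inherited
by the neighbouring points. -/
lemma exists_analytic_localInverse {F : Type*} [NormedAddCommGroup F] [NormedSpace ℝ F]
    [CompleteSpace F] {f : F → F} {a : F} (hf : ContDiffAt ℝ ω f a) (e : F ≃L[ℝ] F)
    (he : HasFDerivAt f (e : F →L[ℝ] F) a) :
    ∃ g : F → F, (∀ᶠ y in 𝓝 (f a), ContDiffAt ℝ ∞ g y) ∧ Filter.Tendsto g (𝓝 (f a)) (𝓝 a) ∧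
      (∀ᶠ y in 𝓝 (f a), f (g y) = y) ∧ ∀ᶠ x in 𝓝 a, g (f x) = x := by
  have hs := hf.hasStrictFDerivAt' he (by simp)
  refine ⟨hf.localInverse he (by simp), ?_, hs.localInverse_tendsto, hs.eventually_right_inverse,
    hs.eventually_left_inverse⟩
  exact ((hf.to_localInverse he (by simp)).eventually (by simp)).mono fun y hy =>
    hy.of_le (by simp)

/-- A smooth square root near the identity matrix, Hermitian on Hermitian matrices. -/
lemma exists_smooth_sqrt (k : ℕ) :
    ∃ (g : Matrix (Fin k) (Fin k) ℂ → Matrix (Fin k) (Fin k) ℂ)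
      (W : Set (Matrix (Fin k) (Fin k) ℂ)), IsOpen W ∧ 1 ∈ W ∧ ∀ Y ∈ W,
      ContDiffAt ℝ ∞ g Y ∧ g Y * g Y = Y ∧ IsUnit (g Y) ∧ (Yᴴ = Y → (g Y)ᴴ = g Y) := by
  let e : Matrix (Fin k) (Fin k) ℂ ≃L[ℝ] Matrix (Fin k) (Fin k) ℂ :=
    ContinuousLinearEquiv.smulLeft (Units.mk0 (2 : ℝ) two_ne_zero)
  have hf : ∀ a, ContDiffAt ℝ ω (fun X : Matrix (Fin k) (Fin k) ℂ => X * X) a :=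
    fun a => contDiffAt_id.matrixMul contDiffAt_id
  have he : HasFDerivAt (fun X : Matrix (Fin k) (Fin k) ℂ => X * X)
      (e : Matrix (Fin k) (Fin k) ℂ →L[ℝ] Matrix (Fin k) (Fin k) ℂ) 1 := by
    have h1 := ((hf 1).differentiableAt (by simp)).hasFDerivAt
    refine h1.congr_fderiv (ContinuousLinearMap.ext fun v => ?_)
    have h2 := h1.hasLineDerivAt v
    have h3 : HasDerivAt (fun τ : ℝ => (1 : Matrix (Fin k) (Fin k) ℂ) + τ • v) v 0 :=
      hasDerivAt_line 1 v
    have h4 := h3.matrixMul h3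
    refine h2.unique (h4.congr_deriv ?_)
    change v * (1 + (0 : ℝ) • v) + (1 + (0 : ℝ) • v) * v = (2 : ℝ) • v
    rw [zero_smul, add_zero, Matrix.mul_one, Matrix.one_mul, two_smul]
  obtain ⟨g, h1, h2, h3, h4⟩ := exists_analytic_localInverse (hf 1) e he
  simp only [Matrix.mul_one] at h1 h2 h3
  have h5 : ∀ᶠ Y in 𝓝 (1 : Matrix (Fin k) (Fin k) ℂ), IsUnit Y := by
    let _ : NormedRing (Matrix (Fin k) (Fin k) ℂ) := Matrix.linftyOpNormedRing
    exact Units.isOpen.mem_nhds isUnit_one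
  have h6 : ∀ᶠ Y in 𝓝 (1 : Matrix (Fin k) (Fin k) ℂ), g ((g Y)ᴴ * (g Y)ᴴ) = (g Y)ᴴ := by
    refine Filter.Tendsto.eventually (f := fun Y => (g Y)ᴴ) ?_ h4
    have h7 : Filter.Tendsto (fun X : Matrix (Fin k) (Fin k) ℂ => Xᴴ) (𝓝 1) (𝓝 1ᴴ) :=
      (contDiffAt_id (n := 1)).conjTranspose.continuousAt
    rw [conjTranspose_one] at h7
    exact h7.comp h2
  obtain ⟨W, hW, hWo, hW1⟩ := mem_nhds_iff.mp (h1.and (h3.and (h5.and h6)))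
  refine ⟨g, W, hWo, hW1, fun Y hY => ?_⟩
  obtain ⟨r1, r2, r3, r4⟩ := hW hY
  refine ⟨r1, r2, ?_, fun hYH => ?_⟩
  · have r5 : g Y * g Y = Y := r2
    rw [← r5] at r3
    exact isUnit_of_mul_isUnit_left r3
  · have r5 : g Y * g Y = Y := r2
    rw [← conjTranspose_mul, r5, hYH] at r4
    exact r4.symm

end LocalSqrt

section Slice

variable {p k : ℕ} {α β : ℝ}

/-- The function `(U, Σ) ↦ (U C⁻¹ - U₀, C Σ Cᴴ)`, `C = U₀ᴴ U`, which is constant on the fibres. -/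
def sliceMap (U₀ : Matrix (Fin p) (Fin k) ℂ)
    (θ : Matrix (Fin p) (Fin k) ℂ × Matrix (Fin k) (Fin k) ℂ) :
    Matrix (Fin p) (Fin k) ℂ × Matrix (Fin k) (Fin k) ℂ :=
  (θ.1 * (U₀ᴴ * θ.1)⁻¹ - U₀, U₀ᴴ * θ.1 * θ.2 * (U₀ᴴ * θ.1)ᴴ)

/-- The local section `(B, S) ↦ (T D⁻¹, D S D)`, where `T = U₀ + B` and `D` is the square root of
`Tᴴ T` that `g` provides. -/
def sliceSection (g : Matrix (Fin k) (Fin k) ℂ → Matrix (Fin k) (Fin k) ℂ)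
    (U₀ : Matrix (Fin p) (Fin k) ℂ) (y : Matrix (Fin p) (Fin k) ℂ × Matrix (Fin k) (Fin k) ℂ) :
    Matrix (Fin p) (Fin k) ℂ × Matrix (Fin k) (Fin k) ℂ :=
  ((U₀ + y.1) * (g ((U₀ + y.1)ᴴ * (U₀ + y.1)))⁻¹,
    g ((U₀ + y.1)ᴴ * (U₀ + y.1)) * y.2 * g ((U₀ + y.1)ᴴ * (U₀ + y.1)))

/-- The pairs `(B, S)` with `U₀ᴴ B = 0` and `S` Hermitian. -/
def sliceSpace (U₀ : Matrix (Fin p) (Fin k) ℂ) :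
    Submodule ℝ (Matrix (Fin p) (Fin k) ℂ × Matrix (Fin k) (Fin k) ℂ) where
  carrier := {y | U₀ᴴ * y.1 = 0 ∧ y.2ᴴ = y.2}
  add_mem' {a b} ha hb := by
    refine ⟨?_, ?_⟩
    · change U₀ᴴ * (a.1 + b.1) = 0
      rw [Matrix.mul_add, ha.1, hb.1, add_zero]
    · change (a.2 + b.2)ᴴ = a.2 + b.2
      rw [conjTranspose_add, ha.2, hb.2]
  zero_mem' := ⟨Matrix.mul_zero _, conjTranspose_zero⟩
  smul_mem' c a ha := by
    refine ⟨?_, ?_⟩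
    · change U₀ᴴ * (c • a.1) = 0
      rw [Matrix.mul_smul, ha.1, smul_zero]
    · change (c • a.2)ᴴ = c • a.2
      rw [conjTranspose_smul, ha.2, star_trivial]

lemma contDiffAt_fst_prod (θ : Matrix (Fin p) (Fin k) ℂ × Matrix (Fin k) (Fin k) ℂ) {r : ℕ∞ω} :
    ContDiffAt ℝ r
      (fun θ : Matrix (Fin p) (Fin k) ℂ × Matrix (Fin k) (Fin k) ℂ => θ.1) θ := contDiffAt_fst

lemma contDiffAt_snd_prod (θ : Matrix (Fin p) (Fin k) ℂ × Matrix (Fin k) (Fin k) ℂ) {r : ℕ∞ω} :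
    ContDiffAt ℝ r
      (fun θ : Matrix (Fin p) (Fin k) ℂ × Matrix (Fin k) (Fin k) ℂ => θ.2) θ := contDiffAt_snd

lemma contDiffAt_sliceMap (U₀ : Matrix (Fin p) (Fin k) ℂ)
    {θ : Matrix (Fin p) (Fin k) ℂ × Matrix (Fin k) (Fin k) ℂ} (hC : IsUnit (U₀ᴴ * θ.1)) :
    ContDiffAt ℝ ∞ (sliceMap U₀) θ := by
  have h1 : ContDiffAt ℝ ∞ (fun θ : Matrix (Fin p) (Fin k) ℂ × Matrix (Fin k) (Fin k) ℂ =>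
      U₀ᴴ * θ.1) θ := contDiffAt_const.matrixMul (contDiffAt_fst_prod θ)
  exact (((contDiffAt_fst_prod θ).matrixMul (h1.matrixInv hC)).sub contDiffAt_const).prodMk
    ((h1.matrixMul (contDiffAt_snd_prod θ)).matrixMul h1.conjTranspose)

lemma fderiv_sliceMap (U₀ : Matrix (Fin p) (Fin k) ℂ)
    {θ : Matrix (Fin p) (Fin k) ℂ × Matrix (Fin k) (Fin k) ℂ} (hC : IsUnit (U₀ᴴ * θ.1))
    (ξ : Matrix (Fin p) (Fin k) ℂ × Matrix (Fin k) (Fin k) ℂ) :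
    fderiv ℝ (sliceMap U₀) θ ξ
      = (ξ.1 * (U₀ᴴ * θ.1)⁻¹ - θ.1 * ((U₀ᴴ * θ.1)⁻¹ * (U₀ᴴ * ξ.1) * (U₀ᴴ * θ.1)⁻¹),
        (U₀ᴴ * ξ.1 * θ.2 + U₀ᴴ * θ.1 * ξ.2) * (U₀ᴴ * θ.1)ᴴ
          + U₀ᴴ * θ.1 * θ.2 * (U₀ᴴ * ξ.1)ᴴ) := by
  have h1 := ((contDiffAt_sliceMap U₀ hC).differentiableAt (by simp)).hasFDerivAt.hasLineDerivAt ξ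
  have h2 : HasDerivAt (fun τ : ℝ => θ.1 + τ • ξ.1) ξ.1 0 :=
    hasDerivAt_line θ.1 ξ.1
  have h3 : HasDerivAt (fun τ : ℝ => θ.2 + τ • ξ.2) ξ.2 0 :=
    hasDerivAt_line θ.2 ξ.2
  have h4 : HasDerivAt (fun τ : ℝ => U₀ᴴ * (θ.1 + τ • ξ.1)) (U₀ᴴ * ξ.1) 0 := by
    have := (hasDerivAt_const (0 : ℝ) U₀ᴴ).matrixMul h2
    rwa [Matrix.zero_mul, zero_add] at this
  have z1 : θ.1 + (0 : ℝ) • ξ.1 = θ.1 := by rw [zero_smul, add_zero]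
  have z2 : θ.2 + (0 : ℝ) • ξ.2 = θ.2 := by rw [zero_smul, add_zero]
  have h5 := (h2.matrixMul (h4.matrixInv (by rwa [z1]))).sub_const U₀
  have h6 := (h4.matrixMul h3).matrixMul h4.matrixConjTranspose
  rw [z1] at h5
  rw [z1, z2] at h6
  refine h1.unique ((h5.prodMk h6).congr_deriv ?_)
  rw [Matrix.mul_neg, ← sub_eq_add_neg]

lemma orbit_unitary {θ : Matrix (Fin p) (Fin k) ℂ × Matrix (Fin k) (Fin k) ℂ}
    (hθ : θ ∈ (rankQuotient p k α β).total) {O : Matrix (Fin k) (Fin k) ℂ} (hO : Oᴴ * O = 1) :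
    orbit p k θ = orbit p k (θ.1 * O, Oᴴ * θ.2 * O) := by
  have h1 : θ.1ᴴ * θ.1 = 1 := hθ.1
  have h2 : θ.1ᴴ * (θ.1 * O) = O := by rw [← Matrix.mul_assoc, h1, Matrix.one_mul]
  rw [orbit_eq_iff hθ, h2]
  exact ⟨hO, rfl⟩

lemma posDef_conj {S A : Matrix (Fin k) (Fin k) ℂ} (hS : S.PosDef) (hA : IsUnit A) :
    (Aᴴ * S * A).PosDef :=
  hS.conjTranspose_mul_mul_same (Matrix.mulVec_injective_of_isUnit hA)

lemma sliceMap_unitary (U₀ : Matrix (Fin p) (Fin k) ℂ)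
    (θ : Matrix (Fin p) (Fin k) ℂ × Matrix (Fin k) (Fin k) ℂ) {O : Matrix (Fin k) (Fin k) ℂ}
    (hO : Oᴴ * O = 1) : sliceMap U₀ (θ.1 * O, Oᴴ * θ.2 * O) = sliceMap U₀ θ := by
  have h1 : O * Oᴴ = 1 := mul_eq_one_comm.mp hO
  have h2 : O⁻¹ = Oᴴ := Matrix.inv_eq_right_inv h1
  simp only [sliceMap]
  ext1
  · rw [← Matrix.mul_assoc, Matrix.mul_inv_rev, h2, Matrix.mul_assoc, ← Matrix.mul_assoc O, h1,
      Matrix.one_mul]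
  · rw [← Matrix.mul_assoc U₀ᴴ, conjTranspose_mul (U₀ᴴ * θ.1) O]
    calc _ = U₀ᴴ * θ.1 * (O * Oᴴ) * θ.2 * (O * Oᴴ) * (U₀ᴴ * θ.1)ᴴ := by
          simp only [Matrix.mul_assoc]
      _ = _ := by rw [h1, Matrix.mul_one, Matrix.mul_one]

/-- The kernel of the derivative of `sliceMap` on the tangent space is the vertical space: if it
annihilates `ξ`, then `ξ_U = U Ω` with `Ω = C⁻¹ U₀ᴴ ξ_U`, which is skew-Hermitian. -/
lemma fderiv_sliceMap_eq_zero_iff (U₀ : Matrix (Fin p) (Fin k) ℂ)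
    {θ ξ : Matrix (Fin p) (Fin k) ℂ × Matrix (Fin k) (Fin k) ℂ} (hC : IsUnit (U₀ᴴ * θ.1))
    (hθ : θ ∈ (rankQuotient p k α β).total) (hξ : ξ ∈ (rankQuotient p k α β).tangent θ) :
    fderiv ℝ (sliceMap U₀) θ ξ = 0 ↔ ξ ∈ (rankQuotient p k α β).vertical θ := by
  rw [fderiv_sliceMap U₀ hC]
  have hC' := (Matrix.isUnit_iff_isUnit_det _).mp hC
  have c1 : (U₀ᴴ * θ.1)⁻¹ * (U₀ᴴ * θ.1) = 1 := Matrix.nonsing_inv_mul _ hC'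
  have c2 : U₀ᴴ * θ.1 * (U₀ᴴ * θ.1)⁻¹ = 1 := Matrix.mul_nonsing_inv _ hC'
  have c3 : (U₀ᴴ * θ.1)ᴴ * ((U₀ᴴ * θ.1)⁻¹)ᴴ = 1 := by
    rw [← conjTranspose_mul, c1, conjTranspose_one]
  have hU : θ.1ᴴ * θ.1 = 1 := hθ.1
  have hξ1 : θ.1ᴴ * ξ.1 + ξ.1ᴴ * θ.1 = 0 := hξ.1
  -- the second component, for `ξ_U = U Ω` with `Ω` skew-Hermitian
  have key : ∀ Ω : Matrix (Fin k) (Fin k) ℂ, Ωᴴ = -Ω → ξ.1 = θ.1 * Ω →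
      (U₀ᴴ * ξ.1 * θ.2 + U₀ᴴ * θ.1 * ξ.2) * (U₀ᴴ * θ.1)ᴴ + U₀ᴴ * θ.1 * θ.2 * (U₀ᴴ * ξ.1)ᴴ
        = U₀ᴴ * θ.1 * (ξ.2 - (θ.2 * Ω - Ω * θ.2)) * (U₀ᴴ * θ.1)ᴴ := by
    intro Ω hΩ h
    rw [h, ← Matrix.mul_assoc U₀ᴴ]
    generalize U₀ᴴ * θ.1 = C
    rw [conjTranspose_mul C Ω, hΩ]
    simp only [Matrix.mul_sub, Matrix.sub_mul, Matrix.add_mul, Matrix.mul_assoc, Matrix.neg_mul,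
      Matrix.mul_neg]
    abel
  constructor
  · intro h
    have h1 := congrArg Prod.fst h
    have h2 := congrArg Prod.snd h
    simp only [Prod.fst_zero, Prod.snd_zero] at h1 h2
    have h3 : ξ.1 = θ.1 * ((U₀ᴴ * θ.1)⁻¹ * (U₀ᴴ * ξ.1)) := by
      have h4 := congrArg (fun A => A * (U₀ᴴ * θ.1)) (sub_eq_zero.mp h1)
      simp only [Matrix.mul_assoc] at h4 c1 ⊢
      simpa only [c1, Matrix.mul_one] using h4
    generalize (U₀ᴴ * θ.1)⁻¹ * (U₀ᴴ * ξ.1) = Ω at h3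
    have hΩ : Ωᴴ = -Ω := by
      rw [h3, conjTranspose_mul, ← Matrix.mul_assoc, hU, Matrix.one_mul, Matrix.mul_assoc, hU,
        Matrix.mul_one] at hξ1
      exact eq_neg_of_add_eq_zero_right hξ1
    refine ⟨Ω, hΩ, Prod.ext h3 ?_⟩
    rw [key Ω hΩ h3] at h2
    have h5 := congrArg (fun A => (U₀ᴴ * θ.1)⁻¹ * A * ((U₀ᴴ * θ.1)⁻¹)ᴴ) h2
    simp only [Matrix.mul_zero, Matrix.zero_mul] at h5
    generalize U₀ᴴ * θ.1 = C at *
    rw [Matrix.mul_assoc, Matrix.mul_assoc, c3, Matrix.mul_one, ← Matrix.mul_assoc, c1,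
      Matrix.one_mul] at h5
    exact sub_eq_zero.mp h5
  · rintro ⟨Ω, hΩ, h⟩
    have h1 : ξ.1 = θ.1 * Ω := congrArg Prod.fst h
    have h2 : ξ.2 = θ.2 * Ω - Ω * θ.2 := congrArg Prod.snd h
    ext1
    · change ξ.1 * (U₀ᴴ * θ.1)⁻¹ - θ.1 * ((U₀ᴴ * θ.1)⁻¹ * (U₀ᴴ * ξ.1) * (U₀ᴴ * θ.1)⁻¹) = 0
      rw [h1, ← Matrix.mul_assoc U₀ᴴ, ← Matrix.mul_assoc _ _ Ω, c1, Matrix.one_mul,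
        Matrix.mul_assoc, sub_self]
    · change (U₀ᴴ * ξ.1 * θ.2 + U₀ᴴ * θ.1 * ξ.2) * (U₀ᴴ * θ.1)ᴴ
        + U₀ᴴ * θ.1 * θ.2 * (U₀ᴴ * ξ.1)ᴴ = 0
      rw [key Ω hΩ h1, h2, sub_self, Matrix.mul_zero, Matrix.zero_mul]

lemma fderiv_sliceMap_mem {U₀ : Matrix (Fin p) (Fin k) ℂ}
    {θ ξ : Matrix (Fin p) (Fin k) ℂ × Matrix (Fin k) (Fin k) ℂ} (hC : IsUnit (U₀ᴴ * θ.1))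
    (hθ : θ.2ᴴ = θ.2) (hξ : ξ.2ᴴ = ξ.2) :
    fderiv ℝ (sliceMap U₀) θ ξ ∈ sliceSpace U₀ := by
  rw [fderiv_sliceMap U₀ hC]
  have hC' := (Matrix.isUnit_iff_isUnit_det _).mp hC
  have c2 : U₀ᴴ * θ.1 * (U₀ᴴ * θ.1)⁻¹ = 1 := Matrix.mul_nonsing_inv _ hC'
  constructor
  · change U₀ᴴ * (ξ.1 * (U₀ᴴ * θ.1)⁻¹ - θ.1 * ((U₀ᴴ * θ.1)⁻¹ * (U₀ᴴ * ξ.1) * (U₀ᴴ * θ.1)⁻¹)) = 0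
    rw [Matrix.mul_sub, ← Matrix.mul_assoc U₀ᴴ θ.1, ← Matrix.mul_assoc (U₀ᴴ * θ.1),
      ← Matrix.mul_assoc (U₀ᴴ * θ.1), c2, Matrix.one_mul, Matrix.mul_assoc, sub_self]
  · change ((U₀ᴴ * ξ.1 * θ.2 + U₀ᴴ * θ.1 * ξ.2) * (U₀ᴴ * θ.1)ᴴ
      + U₀ᴴ * θ.1 * θ.2 * (U₀ᴴ * ξ.1)ᴴ)ᴴ = _
    generalize U₀ᴴ * θ.1 = C
    generalize U₀ᴴ * ξ.1 = C'
    simp only [conjTranspose_add, conjTranspose_mul, conjTranspose_conjTranspose, hθ, hξ,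
      Matrix.add_mul, Matrix.mul_assoc]
    abel

variable {U₀ : Matrix (Fin p) (Fin k) ℂ} {L : Matrix (Fin k) (Fin k) ℂ}
  {g : Matrix (Fin k) (Fin k) ℂ → Matrix (Fin k) (Fin k) ℂ} {W : Set (Matrix (Fin k) (Fin k) ℂ)}

/-- The domain of `sliceSection`. The second condition forces `S` to be positive definite, because
`L⁻¹ S L⁻¹` then has an invertible Hermitian square root. -/
def sliceSource (U₀ : Matrix (Fin p) (Fin k) ℂ) (L : Matrix (Fin k) (Fin k) ℂ)
    (W : Set (Matrix (Fin k) (Fin k) ℂ)) :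
    Set (Matrix (Fin p) (Fin k) ℂ × Matrix (Fin k) (Fin k) ℂ) :=
  {y | (U₀ + y.1)ᴴ * (U₀ + y.1) ∈ W ∧ L⁻¹ * y.2 * L⁻¹ ∈ W}

lemma isOpen_sliceSource (hW : IsOpen W) : IsOpen (sliceSource U₀ L W) := by
  have h1 : Continuous fun y : Matrix (Fin p) (Fin k) ℂ × Matrix (Fin k) (Fin k) ℂ =>
      (U₀ + y.1)ᴴ * (U₀ + y.1) := continuous_iff_continuousAt.mpr fun y =>
    have h : ContDiffAt ℝ 1 (fun y : Matrix (Fin p) (Fin k) ℂ × Matrix (Fin k) (Fin k) ℂ =>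
      U₀ + y.1) y := contDiffAt_const.add (contDiffAt_fst_prod y)
    (h.conjTranspose.matrixMul h).continuousAt
  have h2 : Continuous fun y : Matrix (Fin p) (Fin k) ℂ × Matrix (Fin k) (Fin k) ℂ =>
      L⁻¹ * y.2 * L⁻¹ := continuous_iff_continuousAt.mpr fun y =>
    ((contDiffAt_const.matrixMul (contDiffAt_snd_prod y)).matrixMul
      (contDiffAt_const (n := 1))).continuousAt
  exact (hW.preimage h1).inter (hW.preimage h2)

/-- The domain of `sliceMap`: a saturated neighbourhood of `(U₀, L²)`. -/
def sliceTarget (U₀ : Matrix (Fin p) (Fin k) ℂ) (L : Matrix (Fin k) (Fin k) ℂ)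
    (W : Set (Matrix (Fin k) (Fin k) ℂ)) :
    Set (Matrix (Fin p) (Fin k) ℂ × Matrix (Fin k) (Fin k) ℂ) :=
  {θ | IsUnit (U₀ᴴ * θ.1) ∧ sliceMap U₀ θ ∈ sliceSource U₀ L W}

lemma isOpen_setOf_isUnit : IsOpen {A : Matrix (Fin k) (Fin k) ℂ | IsUnit A} := by
  let _ : NormedRing (Matrix (Fin k) (Fin k) ℂ) := Matrix.linftyOpNormedRing
  exact Units.isOpen

lemma isOpen_sliceTarget (hW : IsOpen W) : IsOpen (sliceTarget U₀ L W) := by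
  refine isOpen_iff_mem_nhds.mpr fun θ hθ => ?_
  have h1 : ContinuousAt (fun θ : Matrix (Fin p) (Fin k) ℂ × Matrix (Fin k) (Fin k) ℂ =>
      U₀ᴴ * θ.1) θ :=
    ((contDiffAt_const (n := 1)).matrixMul (contDiffAt_fst_prod θ)).continuousAt
  exact Filter.inter_mem (h1.preimage_mem_nhds (isOpen_setOf_isUnit.mem_nhds hθ.1))
    ((contDiffAt_sliceMap U₀ hθ.1).continuousAt.preimage_mem_nhds
      ((isOpen_sliceSource hW).mem_nhds hθ.2))

lemma contDiffAt_sliceSection {y : Matrix (Fin p) (Fin k) ℂ × Matrix (Fin k) (Fin k) ℂ}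
    (hg : ContDiffAt ℝ ∞ g ((U₀ + y.1)ᴴ * (U₀ + y.1)))
    (hu : IsUnit (g ((U₀ + y.1)ᴴ * (U₀ + y.1)))) : ContDiffAt ℝ ∞ (sliceSection g U₀) y := by
  have h1 : ContDiffAt ℝ ∞ (fun y : Matrix (Fin p) (Fin k) ℂ × Matrix (Fin k) (Fin k) ℂ =>
      U₀ + y.1) y := contDiffAt_const.add (contDiffAt_fst_prod y)
  have h2 : ContDiffAt ℝ ∞ (fun y : Matrix (Fin p) (Fin k) ℂ × Matrix (Fin k) (Fin k) ℂ =>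
      g ((U₀ + y.1)ᴴ * (U₀ + y.1))) y :=
    ContDiffAt.comp y hg (h1.conjTranspose.matrixMul h1)
  exact (h1.matrixMul (h2.matrixInv hu)).prodMk
    ((h2.matrixMul (contDiffAt_snd_prod y)).matrixMul h2)

/-- Near the fibre of `(U₀, L²)` the quotient is parametrized by the pairs `(B, S)` in
`sliceSpace U₀`. The map `g` is a square root on `W`. -/
lemma isSlice_rankQuotient (hU₀ : U₀ᴴ * U₀ = 1) (hL : Lᴴ = L) (hL' : IsUnit L) (hW : IsOpen W)
    (hg : ∀ Y ∈ W, ContDiffAt ℝ ∞ g Y ∧ g Y * g Y = Y ∧ IsUnit (g Y) ∧ (Yᴴ = Y → (g Y)ᴴ = g Y)) :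
    (rankQuotient p k α β).IsSlice (sliceSpace U₀) (sliceSource U₀ L W) (sliceTarget U₀ L W)
      (sliceSection g U₀) (sliceMap U₀) := by
  have hT : ∀ T : Matrix (Fin p) (Fin k) ℂ, (Tᴴ * T)ᴴ = Tᴴ * T := fun T => by
    rw [conjTranspose_mul, conjTranspose_conjTranspose]
  -- `C = U₀ᴴ U` is `D⁻¹` on the image of the section
  have hC : ∀ y ∈ sliceSpace U₀, U₀ᴴ * (sliceSection g U₀ y).1
      = (g ((U₀ + y.1)ᴴ * (U₀ + y.1)))⁻¹ := fun y hy => by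
    change U₀ᴴ * ((U₀ + y.1) * _) = _
    rw [← Matrix.mul_assoc, Matrix.mul_add, hU₀, hy.1, add_zero, Matrix.one_mul]
  have hinv : ∀ y ∈ sliceSpace U₀, y ∈ sliceSource U₀ L W →
      sliceMap U₀ (sliceSection g U₀ y) = y := fun y hy hyΩ => by
    obtain ⟨-, -, r3, r4⟩ := hg _ hyΩ.1
    have r5 := r4 (hT _)
    have hd := (Matrix.isUnit_iff_isUnit_det _).mp r3
    rw [sliceMap, hC y hy, Matrix.nonsing_inv_nonsing_inv _ hd, conjTranspose_nonsing_inv, r5]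
    simp only [sliceSection]
    generalize g ((U₀ + y.1)ᴴ * (U₀ + y.1)) = D at *
    have d1 : D⁻¹ * D = 1 := Matrix.nonsing_inv_mul _ hd
    have d2 : D * D⁻¹ = 1 := Matrix.mul_nonsing_inv _ hd
    ext1
    · rw [Matrix.mul_assoc, d1, Matrix.mul_one, add_sub_cancel_left]
    · change D⁻¹ * (D * y.2 * D) * D⁻¹ = y.2
      rw [Matrix.mul_assoc D, ← Matrix.mul_assoc D⁻¹, d1, Matrix.one_mul, Matrix.mul_assoc, d2,
        Matrix.mul_one]
  have hLd := (Matrix.isUnit_iff_isUnit_det _).mp hL'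
  refine ⟨isOpen_sliceSource hW, isOpen_sliceTarget hW,
    fun y _ hyΩ => contDiffAt_sliceSection (hg _ hyΩ.1).1 (hg _ hyΩ.1).2.2.1,
    fun θ _ hN => contDiffAt_sliceMap U₀ hN.1, fun y hy hyΩ => ⟨⟨?_, ?_⟩, ?_, ?_⟩,
    fun θ hθ hN => ⟨⟨?_, ?_⟩, hN.2⟩, hinv, fun θ hθ hN => ?_, fun θ hθ θ' hθ' hp hN => ?_,
    fun θ hθ hN ξ hξ => fderiv_sliceMap_mem hN.1 hθ.2.isHermitian hξ.2,
    fun θ hθ hN ξ hξ => fderiv_sliceMap_eq_zero_iff U₀ hN.1 hθ hξ,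
    fun θ _ ξ hξ η hη => ⟨?_, ?_⟩⟩
  · obtain ⟨-, r2, r3, r4⟩ := hg _ hyΩ.1
    have r5 := r4 (hT _)
    have hd := (Matrix.isUnit_iff_isUnit_det _).mp r3
    change ((U₀ + y.1) * _)ᴴ * ((U₀ + y.1) * _) = 1
    rw [conjTranspose_mul, Matrix.mul_assoc, ← Matrix.mul_assoc (U₀ + y.1)ᴴ,
      conjTranspose_nonsing_inv, r5]
    generalize (U₀ + y.1)ᴴ * (U₀ + y.1) = Y at *
    nth_rw 2 [← r2]
    rw [Matrix.mul_assoc, Matrix.mul_nonsing_inv _ hd, Matrix.mul_one,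
      Matrix.nonsing_inv_mul _ hd]
  · obtain ⟨-, -, r3, r4⟩ := hg _ hyΩ.1
    obtain ⟨-, s2, s3, s4⟩ := hg _ hyΩ.2
    have hy2 : y.2ᴴ = y.2 := hy.2
    have s5 := s4 (by
      rw [conjTranspose_mul, conjTranspose_mul, conjTranspose_nonsing_inv, hL, hy2,
        Matrix.mul_assoc])
    have hP := posDef_conj (posDef_conj Matrix.PosDef.one s3) hL'
    rw [Matrix.mul_one, s5, s2, hL] at hP
    have e1 : L * (L⁻¹ * y.2 * L⁻¹) * L = y.2 := by
      rw [← Matrix.mul_assoc, ← Matrix.mul_assoc, Matrix.mul_nonsing_inv _ hLd, Matrix.one_mul,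
        Matrix.mul_assoc, Matrix.nonsing_inv_mul _ hLd, Matrix.mul_one]
    rw [e1] at hP
    have hP' := posDef_conj hP r3
    rw [r4 (hT _)] at hP'
    exact hP'
  · rw [hC y hy]
    exact Matrix.isUnit_nonsing_inv_iff.mpr (hg _ hyΩ.1).2.2.1
  · rw [hinv y hy hyΩ]
    exact hyΩ
  · have hC' := (Matrix.isUnit_iff_isUnit_det _).mp hN.1
    change U₀ᴴ * (θ.1 * (U₀ᴴ * θ.1)⁻¹ - U₀) = 0
    rw [Matrix.mul_sub, ← Matrix.mul_assoc, Matrix.mul_nonsing_inv _ hC', hU₀, sub_self]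
  · have hθ2 : θ.2ᴴ = θ.2 := hθ.2.isHermitian
    change (U₀ᴴ * θ.1 * θ.2 * (U₀ᴴ * θ.1)ᴴ)ᴴ = U₀ᴴ * θ.1 * θ.2 * (U₀ᴴ * θ.1)ᴴ
    rw [conjTranspose_mul, conjTranspose_conjTranspose, conjTranspose_mul, hθ2, ← Matrix.mul_assoc]
  · have hU : θ.1ᴴ * θ.1 = 1 := hθ.1
    have hC' := (Matrix.isUnit_iff_isUnit_det _).mp hN.1
    obtain ⟨-, r2, r3, r4⟩ := hg _ hN.2.1
    have r5 := r4 (hT _)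
    have hd := (Matrix.isUnit_iff_isUnit_det _).mp r3
    have e1 : U₀ + (sliceMap U₀ θ).1 = θ.1 * (U₀ᴴ * θ.1)⁻¹ := add_sub_cancel _ _
    have e2 : (sliceMap U₀ θ).2 = U₀ᴴ * θ.1 * θ.2 * (U₀ᴴ * θ.1)ᴴ := rfl
    change orbit p k _ = orbit p k θ
    rw [sliceSection]
    rw [e1] at r2 r5 hd ⊢
    rw [e2]
    generalize U₀ᴴ * θ.1 = C at *
    have e3 : (θ.1 * C⁻¹)ᴴ * (θ.1 * C⁻¹) = (C⁻¹)ᴴ * C⁻¹ := by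
      rw [conjTranspose_mul, Matrix.mul_assoc, ← Matrix.mul_assoc θ.1ᴴ, hU, Matrix.one_mul]
    rw [e3] at r2 r5 hd ⊢
    generalize g ((C⁻¹)ᴴ * C⁻¹) = D at *
    -- the section reaches the fibre of `θ` at its image under `O = C⁻¹ D⁻¹ = (D C)ᴴ`
    have d1 : D⁻¹ * D = 1 := Matrix.nonsing_inv_mul _ hd
    have d2 : D * D⁻¹ = 1 := Matrix.mul_nonsing_inv _ hd
    have c1 : C⁻¹ * C = 1 := Matrix.nonsing_inv_mul _ hC'
    have c2 : C * C⁻¹ = 1 := Matrix.mul_nonsing_inv _ hC'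
    have c3 : Cᴴ * (C⁻¹)ᴴ = 1 := by rw [← conjTranspose_mul, c1, conjTranspose_one]
    have e4 : Cᴴ * D = C⁻¹ * D⁻¹ := by
      calc Cᴴ * D = Cᴴ * (D * D) * D⁻¹ := by
            rw [Matrix.mul_assoc, Matrix.mul_assoc, d2, Matrix.mul_one]
        _ = _ := by rw [r2, ← Matrix.mul_assoc, c3, Matrix.one_mul]
    have e5 : (Cᴴ * D)ᴴ = D * C := by rw [conjTranspose_mul, conjTranspose_conjTranspose, r5]
    have e6 : (Cᴴ * D)ᴴ * (Cᴴ * D) = 1 := by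
      rw [e5, e4, Matrix.mul_assoc, ← Matrix.mul_assoc C, c2, Matrix.one_mul, d2]
    rw [orbit_unitary hθ e6, e5]
    congr 1
    ext1
    · change θ.1 * C⁻¹ * D⁻¹ = θ.1 * (Cᴴ * D)
      rw [e4, Matrix.mul_assoc]
    · change D * (C * θ.2 * Cᴴ) * D = D * C * θ.2 * (Cᴴ * D)
      simp only [Matrix.mul_assoc]
  · obtain ⟨h1, h2⟩ := (orbit_eq_iff hθ).mp hp
    generalize θ.1ᴴ * θ'.1 = O at h1 h2
    have h3 : sliceMap U₀ θ' = sliceMap U₀ θ := by rw [h2, sliceMap_unitary U₀ θ h1]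
    refine ⟨⟨?_, ?_⟩, h3⟩
    · rw [h2]
      change IsUnit (U₀ᴴ * (θ.1 * O))
      rw [← Matrix.mul_assoc]
      exact hN.1.mul ⟨⟨O, Oᴴ, mul_eq_one_comm.mp h1, h1⟩, rfl⟩
    · rw [h3]
      exact hN.2
  · have h1 : θ.1ᴴ * ξ.1 + ξ.1ᴴ * θ.1 = 0 := hξ.1
    have h2 : θ.1ᴴ * η.1 + η.1ᴴ * θ.1 = 0 := hη.1
    change θ.1ᴴ * (ξ.1 - η.1) + (ξ.1 - η.1)ᴴ * θ.1 = 0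
    rw [conjTranspose_sub, Matrix.mul_sub, Matrix.sub_mul, sub_add_sub_comm, h1, h2, sub_self]
  · have h1 : ξ.2ᴴ = ξ.2 := hξ.2
    have h2 : η.2ᴴ = η.2 := hη.2
    change (ξ.2 - η.2)ᴴ = ξ.2 - η.2
    rw [conjTranspose_sub, h1, h2]

lemma hasCharts_rankQuotient (hk : 0 < k) (hα : 0 < α) (hβ : -(α / k) < β) :
    (rankQuotient p k α β).HasCharts := by
  constructor
  · have h1 : ∀ z : (Matrix (Fin p) (Fin k) ℂ × Matrix (Fin k) (Fin k) ℂ) ×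
        (Matrix (Fin p) (Fin k) ℂ × Matrix (Fin k) (Fin k) ℂ),
        ContDiffAt ℝ 1 (fun z => z.1.1ᴴ * z.2.1) z := fun z =>
      ((contDiffAt_fst_prod z.1).comp z contDiffAt_fst).conjTranspose.matrixMul
        ((contDiffAt_fst_prod z.2).comp z contDiffAt_snd)
    have h2 := fun z => (h1 z).conjTranspose.matrixMul (h1 z)
    have h3 := fun z => (((contDiffAt_fst_prod z.1).comp z contDiffAt_fst).matrixMul (h1 z)).prodMk
      (((h1 z).conjTranspose.matrixMul ((contDiffAt_snd_prod z.1).comp z contDiffAt_fst)).matrixMul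
        (h1 z))
    exact ⟨_, (isClosed_eq (continuous_iff_continuousAt.mpr fun z => (h2 z).continuousAt)
      continuous_const).inter (isClosed_eq continuous_snd
        (continuous_iff_continuousAt.mpr fun z => (h3 z).continuousAt)),
      fun θ hθ θ' _ => orbit_eq_iff hθ⟩
  · intro θ hθ
    have hU : θ.1ᴴ * θ.1 = 1 := hθ.1
    obtain ⟨g, W, hW, hW1, hg⟩ := exists_smooth_sqrt k
    obtain ⟨l1, l2, l3⟩ := sqrt_spec hθ.2
    obtain ⟨d, σ, V, ψ, h⟩ := (isSlice_rankQuotient (α := α) (β := β) hU l2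
      ((Matrix.isUnit_iff_isUnit_det _).mpr l3) hW hg).exists_isChart (rankData p hk hα hβ)
    refine ⟨d, σ, V, ψ, sliceTarget θ.1 (CFC.sqrt θ.2) W, ?_, h⟩
    refine ⟨by rw [hU]; exact isUnit_one, ?_⟩
    rw [sliceMap, hU, inv_one, Matrix.mul_one, sub_self, Matrix.one_mul, conjTranspose_one,
      Matrix.mul_one]
    constructor
    · change (θ.1 + 0)ᴴ * (θ.1 + 0) ∈ W
      rwa [add_zero, hU]
    · change (CFC.sqrt θ.2)⁻¹ * θ.2 * (CFC.sqrt θ.2)⁻¹ ∈ W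
      generalize CFC.sqrt θ.2 = L at *
      rwa [← l1, ← Matrix.mul_assoc, Matrix.nonsing_inv_mul _ l3, Matrix.one_mul,
        Matrix.mul_nonsing_inv _ l3]

end Slice

end

/-! ### Uniqueness of the horizontal lift -/

noncomputable section

section

variable {p k m : ℕ} {α β : ℝ}

/-- Horizontal lifts of a curve with the same initial point agree. -/
theorem eqOn_of_isHorizontalLiftOn (hk : 0 < k) (hα : 0 < α) (hβ : -(α / k) < β) {J : Set ℝ}
    (hJ : IsOpen J) (hJ' : J.OrdConnected)
    {c : ℝ → Set (Matrix (Fin p) (Fin k) ℂ × Matrix (Fin k) (Fin k) ℂ)}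
    {γ δ : ℝ → Matrix (Fin p) (Fin k) ℂ × Matrix (Fin k) (Fin k) ℂ} {t₀ : ℝ} (ht₀ : t₀ ∈ J)
    (hγ : (rankQuotient p k α β).IsHorizontalLiftOn γ c J)
    (hδ : (rankQuotient p k α β).IsHorizontalLiftOn δ c J) (h0 : δ t₀ = γ t₀) : EqOn δ γ J := by
  set O : ℝ → Matrix (Fin k) (Fin k) ℂ := fun s => (γ s).1ᴴ * (δ s).1 with hO
  have hrel : ∀ t ∈ J, (O t)ᴴ * O t = 1 ∧ δ t = unitaryAct p (O t) (γ t) := fun t ht =>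
    (orbit_eq_iff (hγ t ht).1).mp ((hγ t ht).2.1.trans (hδ t ht).2.1.symm)
  have hOs : ∀ t ∈ J, ContDiffAt ℝ 1 O t := fun t ht => by
    have h1 : ContDiffAt ℝ 1 (fun s => (γ s).1) t :=
      contDiffAt_fst.comp t ((hγ t ht).2.2.1.of_le (by simp))
    have h2 : ContDiffAt ℝ 1 (fun s => (δ s).1) t :=
      contDiffAt_fst.comp t ((hδ t ht).2.2.1.of_le (by simp))
    exact h1.conjTranspose.matrixMul h2
  have hρ : ∀ t ∈ J, DifferentiableAt ℝ (fun s => unitaryAct p (O s)) t := fun t ht =>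
    (contDiffAt_unitaryAct (hOs t ht)).differentiableAt (by simp)
  have hderiv : EqOn (deriv fun s => unitaryAct p (O s)) 0 J := fun t ht => by
    have hJt := hJ.mem_nhds ht
    exact (rankData p hk hα hβ).deriv_gauge_eq_zero (γ := γ) (δ := δ) (hρ t ht)
      (isGaugeAt_unitaryAct hk hα hβ (hOs t ht)
        (Filter.eventually_of_mem hJt fun s hs => (hrel s hs).1))
      ((hγ t ht).2.2.1.differentiableAt (by simp)) (hγ t ht).1 (hγ t ht).2.2.2 (hδ t ht).2.2.2
      (Filter.eventually_of_mem hJt fun s hs => (hrel s hs).2)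
  intro t ht
  have hconst := hJ.is_const_of_deriv_eq_zero hJ'.isPreconnected
    (fun s hs => (hρ s hs).differentiableWithinAt) hderiv ht ht₀
  have hO0 : O t₀ = 1 := by
    have h1 : (γ t₀).1ᴴ * (γ t₀).1 = 1 := (hγ t₀ ht₀).1.1
    change (γ t₀).1ᴴ * (δ t₀).1 = 1
    rw [h0, h1]
  calc δ t = unitaryAct p (O t) (γ t) := (hrel t ht).2
    _ = unitaryAct p (O t₀) (γ t) := congrArg (fun ρ => ρ (γ t)) hconst
    _ = γ t := by
      rw [hO0, unitaryAct_apply, conjTranspose_one, Matrix.mul_one, Matrix.mul_one, Matrix.one_mul]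

end

end

theorem mainTheorem2 {p k m : ℕ} (hk : 0 < k) {α β : ℝ} (hα : 0 < α) (hβ : -(α / k) < β)
    (θ ξ : Matrix (Fin p) (Fin k) ℂ × Matrix (Fin k) (Fin k) ℂ)
    (hθ : θ ∈ (rankQuotient p k α β).total)
    (hξ : ξ ∈ (rankQuotient p k α β).horizontal θ)
    -- a QR decomposition; `R` need not be triangular
    (Q : Matrix (Fin p) (Fin m) ℂ) (R : Matrix (Fin m) (Fin k) ℂ)
    (hQ : Qᴴ * Q = 1) (hQR : Q * R = (1 - θ.1 * θ.1ᴴ) * ξ.1) :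
    -- the projected curve is a geodesic of the quotient with the given initial data
    (rankQuotient p k α β).IsGeodesicOn (fun t => orbit p k (liftedCurve θ ξ Q R t)) univ ∧
    (rankQuotient p k α β).HasVelocityAt (fun t => orbit p k (liftedCurve θ ξ Q R t)) θ ξ 0 ∧
    -- the curve is its horizontal lift
    (rankQuotient p k α β).IsHorizontalLiftOn (liftedCurve θ ξ Q R)
      (fun t => orbit p k (liftedCurve θ ξ Q R t)) univ ∧
    liftedCurve θ ξ Q R 0 = θ ∧ HasDerivAt (liftedCurve θ ξ Q R) ξ 0 ∧
    -- the geodesic and its horizontal lift are unique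
    (∀ (J : Set ℝ) (c : ℝ → Set (Matrix (Fin p) (Fin k) ℂ × Matrix (Fin k) (Fin k) ℂ)),
      IsOpen J → J.OrdConnected → 0 ∈ J →
      (rankQuotient p k α β).IsGeodesicOn c J → (rankQuotient p k α β).HasVelocityAt c θ ξ 0 →
      EqOn c (fun t => orbit p k (liftedCurve θ ξ Q R t)) J ∧
      ∀ γ, (rankQuotient p k α β).IsHorizontalLiftOn γ c J → γ 0 = θ →
        EqOn γ (liftedCurve θ ξ Q R) J) ∧
    -- its two components are the geodesics of the two factors
    (stiefel p k).IsGeodesicOn (stiefelCurve θ.1 ξ.1 Q R) univ ∧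
    (hpd k α β).IsGeodesicOn (hpdCurve θ.2 ξ.2) univ := by
  have htot := liftedCurve_mem_total hθ hξ hQ hQR
  obtain ⟨h0, h0'⟩ := hasDerivAt_liftedCurve_zero hθ hξ hQ hQR
  have hgeo := isGeodesicOn_liftedCurve hk hα hβ hθ hξ hQ hQR
  have hvel : (rankQuotient p k α β).HasVelocityAt
      (fun t => orbit p k (liftedCurve θ ξ Q R t)) θ ξ 0 :=
    ⟨liftedCurve θ ξ Q R, .of_forall fun s => ⟨htot s, rfl⟩, h0, h0'⟩
  have hlift : (rankQuotient p k α β).IsHorizontalLiftOn (liftedCurve θ ξ Q R)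
      (fun t => orbit p k (liftedCurve θ ξ Q R t)) univ := fun t _ =>
    ⟨htot t, rfl, contDiffAt_liftedCurve θ ξ Q R t, liftedCurve_horizontal hθ hξ hQ hQR t⟩
  refine ⟨hgeo, hvel, hlift, h0, h0', fun J c hJ hJ' hJ0 hc hv => ?_,
    isGeodesicOn_stiefelCurve hθ.1 hξ.1.1 hQ hQR, isGeodesicOn_hpdCurve hk hα hβ hθ.2 hξ.1.2⟩
  have heq : EqOn c (fun t => orbit p k (liftedCurve θ ξ Q R t)) J :=
    (rankData p hk hα hβ).eqOn_of_isGeodesicOn (hasCharts_rankQuotient hk hα hβ) hJ hJ' hc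
      (fun t _ => hgeo t (mem_univ t)) hJ0 hv hvel
  refine ⟨heq, fun γ hγ hγ0 => ?_⟩
  refine eqOn_of_isHorizontalLiftOn hk hα hβ hJ hJ' hJ0 (c := c) (fun t ht => ?_) hγ
    (hγ0.trans h0.symm)
  obtain ⟨r1, r2, r3⟩ := hlift t (mem_univ t)
  exact ⟨r1, r2.trans (heq ht).symm, r3⟩
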